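/- Notation. On $\mathbb R^3$ let $\hat f(\xi)=\int f(x)e^{-2\pi i x\cdot\xi}\,dx$, $\langle\xi\rangle=(1+|\xi|^2)^{1/2}$, $\|f\|_{H^s}=\|\langle\xi\rangle^s\hat f\|_{L^2}$, and let $e^{it\Delta}$ be the free Schrödinger propagator, $\widehat{e^{it\Delta}f}(\xi)=e^{-4\pi^2 i t|\xi|^2}\hat f(\xi)$. Put $F(v)=-|v|^2v$, $\mathrm{MASS}(v)=\int|v|^2$, $\mathrm{ENERGY}(v)=\int \frac12|\nabla v|^2-\frac14|v|^4$. Let $\langle f,g\rangle_{L^2}=\int f\bar g$, extended by duality to $H^1\times H^{-1}$, and $\langle f,g\rangle_{H^1}=\int f\bar g+\nabla f\cdot\nabla\bar g$. A solution of the focusing cubic NLS $iu_t+\Delta u=F(u)$ on $[0,\infty)\times\mathbb R^3$ means a function $u\in C([0,\infty);H^1(\mathbb R^3))\cap C^1([0,\infty);H^{-1}(\mathbb R^3))$ for which the equation holds in $H^{-1}$ at all times $t\ge 0$. Theorem. For every $E>0$ there is a constant $C>0$, depending only on $E$, such that the following holds. Let $u$ be a solution (not necessarily spherically symmetric) with $\sup_{t\ge0}\|u(t)\|_{H^1}\le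 E$. Then there is a unique decomposition $$u(t)=u_{\rm wb}(t)+e^{it\Delta}u_+\qquad(t\ge0),\qquad u_+\in H^1,\ u_{\rm wb}(t)\in H^1,$$ satisfying the asymptotic orthogonality condition $$\lim_{t\to+\infty}\langle u_{\rm wb}(t),e^{it\Delta}f\rangle_{L^2}=0\quad\text{for all } f\in H^{-1},$$ which, for any $H^1$-valued function of time in place of $u_{\rm wb}$, is equivalent to $$\lim_{t\to+\infty}\langle u_{\rm wb}(t),e^{it\Delta}f\rangle_{H^1}=0\quad\text{for all } f\in H^{1}.$$ This decomposition has the following properties. 1. $\|u_+\|_{H^1}\le C$ and $\sup_{t\ge0}\|u_{\rm wb}(t)\|_{H^1}\le C$. 2. $u_{\rm wb}$ is a local-in-time approximate solution: it is differentiable in time with values in $H^{-1}$, the function $(i\partial_t+\Delta)u_{\rm wb}-F(u_{\rm wb})$ belongs to $L^1_tH^1_x([T,T+\tau]\times\mathbb R^3)$ for all $T\ge0$ and $\tau>0$, and for every $\tau>0$ $$\lim_{T\to+\infty}\|(i\partial_t+\Delta)u_{\rm wb}-F(u_{\rm wb})\|_{L^1_tH^1_x([T,T+\tau]\times\mathbb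 R^3)}=0.$$ 3. The limits $\lim_{T\to+\infty}\mathrm{MASS}(u_{\rm wb}(T))$ and $\lim_{T\to+\infty}\mathrm{ENERGY}(u_{\rm wb}(T))$ exist, and $$\mathrm{MASS}(u_+)+\lim_{T\to+\infty}\mathrm{MASS}(u_{\rm wb}(T))=\mathrm{MASS}(u(0)),$$ $$\tfrac12\int|\nabla u_+|^2+\lim_{T\to+\infty}\mathrm{ENERGY}(u_{\rm wb}(T))=\mathrm{ENERGY}(u(0)).$$ 4. If $u(t)$ is spherically symmetric for all $t\ge0$, then so are $u_+$ and $u_{\rm wb}(t)$ for all $t\ge 0$. -/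

import Mathlib

open MeasureTheory Filter Topology Set TemperedDistribution
open scoped SchwartzMap LineDeriv Laplacian ENNReal

noncomputable section

namespace CubicNLS

/-- Three-dimensional Euclidean space. -/
abbrev R3 : Type := EuclideanSpace ℝ (Fin 3)

/-- The complex Hilbert space `L²(ℝ³)`. -/
abbrev L2 : Type := Lp ℂ 2 (volume : Measure R3)

/-- Tempered distributions on `ℝ³`. Every function space below consists of such distributions. -/
abbrev Distr : Type := 𝓢'(R3, ℂ)

open Classical in
/-- The `L²` function which represents the tempered distribution `T`
(and `0` if `T` is not given by an `L²` function). -/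
def toL2 (T : Distr) : L2 :=
  if h : ∃ g : L2, (g : Distr) = T then h.choose else 0

theorem coe_injective {g h : L2} (hgh : (g : Distr) = (h : Distr)) : g = h := by
  have key := Lp.ker_toTemperedDistributionCLM_eq_bot (E := R3) (F := ℂ) (p := 2)
    (μ := (volume : Measure R3))
  exact LinearMap.ker_eq_bot.mp key hgh

theorem toL2_coe (g : L2) : toL2 (g : Distr) = g := by
  have h : ∃ g' : L2, (g' : Distr) = (g : Distr) := ⟨g, rfl⟩
  rw [toL2, dif_pos h]
  exact coe_injective h.choose_spec

/-- `T` belongs to the Sobolev space `H^s(ℝ³)`, i.e. `⟨ξ⟩^s 𝓕T ∈ L²` with `⟨ξ⟩ = (1 + |ξ|²)^(1/2)`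
and `𝓕f(ξ) = ∫ f(x) e^{-2πi x·ξ} dx`. -/
def MemH (s : ℝ) (T : Distr) : Prop := MemSobolev s 2 T

/-- The operator `⟨D⟩^s`, i.e. multiplication of the Fourier transform by `⟨ξ⟩^s`, as the
linear bijection of `H^s` onto `L²`. It is isometric for the `H^s` norm. -/
def J (s : ℝ) (T : Distr) : L2 := toL2 (besselPotential R3 ℂ s T)

theorem coe_J {s : ℝ} {T : Distr} (h : MemH s T) : (J s T : Distr) = besselPotential R3 ℂ s T := by
  obtain ⟨g, hg⟩ := h
  rw [J, hg, toL2_coe]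

/-- The Sobolev norm `‖T‖_{H^s} = ‖⟨ξ⟩^s 𝓕T‖_{L²}`. -/
def normH (s : ℝ) (T : Distr) : ℝ := ‖J s T‖

/-- The Fourier multiplier `exp(-4π² i t |ξ|²)` of `e^{itΔ}`. -/
def freeSymbol (t : ℝ) (ξ : R3) : ℂ :=
  Complex.exp (((-(4 * Real.pi ^ 2 * t) * ‖ξ‖ ^ 2 : ℝ) : ℂ) * Complex.I)

/-- The free Schrödinger propagator `e^{itΔ}`. -/
def freeProp (t : ℝ) : Distr →L[ℂ] Distr := fourierMultiplierCLM ℂ (freeSymbol t)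

theorem hasTemperateGrowth_cexp_I :
    (fun x : ℝ => Complex.exp ((x : ℂ) * Complex.I)).HasTemperateGrowth := by
  have hd : ∀ n : ℕ, iteratedDeriv n (fun x : ℝ => Complex.exp ((x : ℂ) * Complex.I)) =
      fun x : ℝ => Complex.I ^ n * Complex.exp ((x : ℂ) * Complex.I) := by
    intro n
    induction n with
    | zero => simp
    | succ n ih =>
      rw [iteratedDeriv_succ, ih]
      funext x
      have h1 : HasDerivAt (fun x : ℝ => (x : ℂ) * Complex.I) (1 * Complex.I) x :=
        (HasDerivAt.ofReal_comp (hasDerivAt_id x)).mul_const Complex.I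
      rw [(h1.cexp.const_mul (Complex.I ^ n)).deriv]
      ring
  refine ⟨(Complex.ofRealCLM.contDiff.mul contDiff_const).cexp, fun n => ⟨0, 1, fun x => ?_⟩⟩
  rw [norm_iteratedFDeriv_eq_norm_iteratedDeriv, hd n]
  simp [Complex.norm_exp_ofReal_mul_I]

theorem freeSymbol_hasTemperateGrowth (t : ℝ) : (freeSymbol t).HasTemperateGrowth := by
  have h : (fun ξ : R3 => -(4 * Real.pi ^ 2 * t) * ‖ξ‖ ^ 2).HasTemperateGrowth :=
    (Function.HasTemperateGrowth.const _).mul (Function.hasTemperateGrowth_norm_sq R3)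
  exact hasTemperateGrowth_cexp_I.comp h

/-- The free propagator maps each Sobolev space `H^s` to itself. -/
theorem MemH.freeProp {s : ℝ} {T : Distr} (hT : MemH s T) (t : ℝ) :
    MemH s (freeProp t T) := by
  refine MemSobolev.fourierMultiplierCLM_of_bounded hT (freeSymbol_hasTemperateGrowth t) ⟨1, ?_⟩
  intro ξ
  rw [freeSymbol, Complex.norm_exp_ofReal_mul_I]

open Classical in
/-- The focusing cubic nonlinearity `F(v) = -|v|² v`. For `v ∈ H¹(ℝ³)` one has `v ∈ L⁶` by
Sobolev embedding, so that `F(v) ∈ L²`, and the second alternative does not occur. -/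
def nonlin (v : Distr) : Distr :=
  if h : MemLp (fun x : R3 => -((‖toL2 v x‖ ^ 2 : ℝ) : ℂ) * toL2 v x) 2 volume then
    ((h.toLp _ : L2) : Distr)
  else 0

/-- The partial derivative `∂_j v` of a function `v ∈ H¹(ℝ³)` (the distributional derivative, which
is an `L²` function). -/
def partialD (j : Fin 3) (v : Distr) : L2 := toL2 (∂_{(EuclideanSpace.single j 1 : R3)} v)

/-- `|∇v(x)|²` for `v ∈ H¹(ℝ³)`. -/
def gradSq (v : Distr) (x : R3) : ℝ := ∑ j : Fin 3, ‖partialD j v x‖ ^ 2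

/-- The mass `∫ |v|²`. -/
def mass (v : Distr) : ℝ := ∫ x : R3, ‖toL2 v x‖ ^ 2

/-- The energy (Hamiltonian) `∫ ½ |∇v|² - ¼ |v|⁴`. -/
def energy (v : Distr) : ℝ := ∫ x : R3, ((1 / 2) * gradSq v x - (1 / 4) * ‖toL2 v x‖ ^ 4)

/-- The pairing `⟨v, f⟩_{L²} = ∫ v f̄`, extended by duality to `v ∈ H¹`, `f ∈ H^{-1}`:
it is `∫ ⟨ξ⟩ 𝓕v · conj (⟨ξ⟩⁻¹ 𝓕f) dξ`, written through Plancherel. (Mathlib's `inner` is conjugate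
linear in its first argument.) -/
def pairL2 (v f : Distr) : ℂ := inner ℂ (J (-1) f) (J 1 v)

/-- The inner product `⟨v, g⟩_{H¹} = ∫ v ḡ + ∇v · ∇ḡ` for `v, g ∈ H¹`. -/
def innerH1 (v g : Distr) : ℂ :=
  ∫ x : R3, (toL2 v x * starRingEnd ℂ (toL2 g x)
    + ∑ j : Fin 3, partialD j v x * starRingEnd ℂ (partialD j g x))

/-- At the time `t ∈ [0,∞)`, the curve `v` has the time derivative `v'` in the norm of `H^s`
(one-sided at `t = 0`). -/
def HasDerivH (s : ℝ) (v : ℝ → Distr) (v' : Distr) (t : ℝ) : Prop :=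
  MemH s v' ∧ HasDerivWithinAt (fun r => J s (v r)) (J s v') (Ici 0) t

/-- The expression `i v_t + Δv - F(v)`, where `vt` is the time derivative. -/
def nlsDefect (v vt : Distr) : Distr := Complex.I • vt + Δ v - nonlin v

/-- `u : [0,∞) × ℝ³ → ℂ` is a (global, forward in time, energy class) solution of
`i u_t + Δu = F(u)`: one has `u ∈ C([0,∞); H¹) ∩ C¹([0,∞); H^{-1})`, and the equation holds in
`H^{-1}` at all times. (Continuity of the time derivative follows from the equation.) Values at
negative times play no role. -/
structure IsSolution (u : ℝ → Distr) : Prop where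
  memH : ∀ t, 0 ≤ t → MemH 1 (u t)
  continuousOn : ContinuousOn (fun t => J 1 (u t)) (Ici 0)
  equation : ∀ t, 0 ≤ t → ∃ ut : Distr, HasDerivH (-1) u ut t ∧ nlsDefect (u t) ut = 0

/-- `u(t) = w(t) + e^{itΔ} p` for all `t ≥ 0`, with `w(t), p ∈ H¹`. -/
structure IsDecomposition (u w : ℝ → Distr) (p : Distr) : Prop where
  memH_left : ∀ t, 0 ≤ t → MemH 1 (w t)
  memH_right : MemH 1 p
  eq : ∀ t, 0 ≤ t → u t = w t + freeProp t p

/-- `⟨w(t), e^{itΔ} f⟩_{L²} → 0` as `t → +∞`, for all `f ∈ H^{-1}`. -/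
def AsymptOrthL2 (w : ℝ → Distr) : Prop :=
  ∀ f : Distr, MemH (-1) f → Tendsto (fun t => pairL2 (w t) (freeProp t f)) atTop (𝓝 0)

/-- `⟨w(t), e^{itΔ} f⟩_{H¹} → 0` as `t → +∞`, for all `f ∈ H¹`. -/
def AsymptOrthH1 (w : ℝ → Distr) : Prop :=
  ∀ f : Distr, MemH 1 f → Tendsto (fun t => innerH1 (w t) (freeProp t f)) atTop (𝓝 0)

/-- `w` is asymptotically a solution on time intervals of fixed length: it has a time derivative
`wt` in `H^{-1}`, the function `N = i w_t + Δw - F(w)` belongs to `L¹_t H¹_x` on each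
`[T, T + τ] × ℝ³` with `T ≥ 0`, and its norm there tends to zero as `T → +∞`. -/
def IsApproxSolution (w : ℝ → Distr) : Prop :=
  ∃ wt : ℝ → Distr, (∀ t, 0 ≤ t → HasDerivH (-1) w (wt t) t) ∧
    (∀ᵐ t ∂(volume.restrict (Ici (0 : ℝ))), MemH 1 (nlsDefect (w t) (wt t))) ∧
    ∀ τ : ℝ, 0 < τ →
      (∀ T, 0 ≤ T →
        IntervalIntegrable (fun t => J 1 (nlsDefect (w t) (wt t))) volume T (T + τ)) ∧
      Tendsto (fun T : ℝ => ∫ t in T..(T + τ), normH 1 (nlsDefect (w t) (wt t))) atTop (𝓝 0)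

/-- The function `v` is spherically symmetric: it is invariant under all rotations and reflections
about the origin (almost everywhere). -/
def IsRadial (v : Distr) : Prop :=
  ∀ A : R3 ≃ₗᵢ[ℝ] R3, (fun x => toL2 v (A x)) =ᵐ[volume] fun x => toL2 v x

end CubicNLS

end

noncomputable section

namespace CubicNLS

open FourierTransform BoundedContinuousFunction

/-! ### Bounded Fourier multipliers on `L²` -/

/-! Everything is transported to `L²` by the substitution `k = ⟨D⟩u`: `H¹` is the range of `opB =
⟨D⟩⁻¹`; the free propagator, translations and derivatives of `⟨D⟩⁻¹ k` become bounded, commuting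
Fourier multipliers; a bounded solution becomes a bounded continuous curve `k` (`IsFlow`).

The radiation `u₊` is the weak `H¹` limit of `e^{-itΔ}u(t)`. By Duhamel, the pairing of this curve
with a test function `χ` changes at the rate `⟨χ, e^{-isΔ}F(u(s))⟩`. Since `F(u)` is bounded in
`L¹`, the dispersive estimate `L¹ → L^∞` makes the rate `O(s^{-3/2})`, which is integrable at
infinity; boundedness and density then cover all test functions (`IsFlow.exists_weak_limit`). As
`e^{itΔ}` is unitary, asymptotic orthogonality of the remainder says exactly that `u₊` is this weak
limit. Existence, uniqueness and the inheritance of symmetry follow, and the mass decouples on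
expanding a square.

For the approximate equation put `v = e^{itΔ}u₊` and `w = u - v`. The defect of `w` is `F(u) - F(u -
v)`, whose terms all contain `v`. Its `H¹` norm is controlled by Hölder, with one factor in `L^∞`
and two in `L⁴`, provided that `u` is bounded in `L²_t W^{1,4}` on windows of fixed length. That
bound comes from a local Strichartz estimate in `L²_t L⁴`: the `TT*` kernel `|t|^{-3/4}` is locally
integrable, so Schur's test is enough. Regularity is propagated by comparing `u` with its translate
by `h`: the two solutions differ by `O(|h|)` in `L²` at every time, and the stability estimate
`IsFlow.integral_n4_sub_sq_le` turns this into `O(|h|)` in `L²_t L⁴`. Morrey's inequality then gives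
`L²_t L^∞`. On the free side, the `L⁴` norm of `v` and its difference quotients in `L²_t L⁴` tend to
zero. The `H¹` norm of the defect is itself read off from `L²` difference quotients
(`exists_opB_of_dq2`), so no chain rule for weak derivatives enters.

The energy of an `H¹` solution cannot be differentiated directly, because `u_t` lies only in `H⁻¹`.
Instead `u(t)` and `u(t+h)` are compared by the trapezoidal rule, which is exact on the quadratic
part; the quartic error is `o(h)` after integration in time, by the `L²_t L^∞` bound. The main terms
are the increment of one continuous function and the exact derivative of an antisymmetric current,
and they cancel in the limit (`IsFlow.en_eq`). The energy then decouples by weak convergence and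
`‖v‖_{L⁴} → 0`. -/

/-- Multiplication by a bounded continuous function on `L²`. -/
def mulOp (σ : R3 →ᵇ ℂ) : L2 →L[ℂ] L2 :=
  (ContinuousLinearMap.lsmul ℂ ℂ).holderL volume ∞ 2 2 (σ.memLp_top.toLp (μ := volume))

theorem coeFn_mulOp (σ : R3 →ᵇ ℂ) (g : L2) : mulOp σ g =ᵐ[volume] fun ξ => σ ξ * g ξ := by
  have h1 := (ContinuousLinearMap.lsmul ℂ ℂ : ℂ →L[ℂ] ℂ →L[ℂ] ℂ).coeFn_holder (r := 2)
    (σ.memLp_top.toLp (μ := (volume : Measure R3))) g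
  have h2 := (σ.memLp_top (μ := (volume : Measure R3))).coeFn_toLp
  filter_upwards [h1, h2] with x hx hx2
  rw [hx2] at hx
  exact hx

/-- The Fourier multiplier with a bounded continuous symbol, as an operator on `L²`. -/
def fmul (σ : R3 →ᵇ ℂ) : L2 →L[ℂ] L2 :=
  ((Lp.fourierTransformₗᵢ R3 ℂ).symm.toContinuousLinearEquiv : L2 →L[ℂ] L2) ∘L mulOp σ ∘L
    ((Lp.fourierTransformₗᵢ R3 ℂ).toContinuousLinearEquiv : L2 →L[ℂ] L2)

theorem fmul_eq (σ : R3 →ᵇ ℂ) (g : L2) : fmul σ g = 𝓕⁻ (mulOp σ (𝓕 g)) := rfl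

theorem fourier_fmul (σ : R3 →ᵇ ℂ) (g : L2) : 𝓕 (fmul σ g) = mulOp σ (𝓕 g) := by
  rw [fmul_eq, fourier_fourierInv_eq]

theorem coeFn_fourier_fmul (σ : R3 →ᵇ ℂ) (g : L2) :
    (𝓕 (fmul σ g) : L2) =ᵐ[volume] fun ξ => σ ξ * (𝓕 g : L2) ξ := by
  rw [fourier_fmul]
  exact coeFn_mulOp σ _

theorem fourier_injective {f g : L2} (h : (𝓕 f : L2) = 𝓕 g) : f = g := by
  rw [← fourierInv_fourier_eq (F := L2) f, h, fourierInv_fourier_eq]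

theorem eq_of_fourier_ae {f g : L2} (h : (𝓕 f : L2) =ᵐ[volume] (𝓕 g : L2)) : f = g :=
  fourier_injective (Lp.ext h)

theorem fmul_mul (σ τ : R3 →ᵇ ℂ) (g : L2) : fmul (σ * τ) g = fmul σ (fmul τ g) := by
  apply eq_of_fourier_ae
  filter_upwards [coeFn_fourier_fmul (σ * τ) g, coeFn_fourier_fmul σ (fmul τ g),
    coeFn_fourier_fmul τ g] with x h1 h2 h3
  rw [h1, h2, h3, BoundedContinuousFunction.mul_apply, mul_assoc]

theorem fmul_comm (σ τ : R3 →ᵇ ℂ) (g : L2) : fmul σ (fmul τ g) = fmul τ (fmul σ g) := by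
  rw [← fmul_mul, mul_comm, fmul_mul]

theorem fmul_one (g : L2) : fmul 1 g = g := by
  apply eq_of_fourier_ae
  filter_upwards [coeFn_fourier_fmul 1 g] with x h1
  rw [h1, BoundedContinuousFunction.coe_one, Pi.one_apply, one_mul]

theorem fmul_add (σ τ : R3 →ᵇ ℂ) (g : L2) : fmul (σ + τ) g = fmul σ g + fmul τ g := by
  apply eq_of_fourier_ae
  rw [fourier_add (F := L2)]
  filter_upwards [coeFn_fourier_fmul (σ + τ) g, coeFn_fourier_fmul σ g,
    coeFn_fourier_fmul τ g, Lp.coeFn_add (𝓕 (fmul σ g)) (𝓕 (fmul τ g))] with x h1 h2 h3 h4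
  rw [h1, h4, Pi.add_apply, h2, h3, BoundedContinuousFunction.add_apply, add_mul]

theorem fmul_smul (c : ℂ) (σ : R3 →ᵇ ℂ) (g : L2) : fmul (c • σ) g = c • fmul σ g := by
  apply eq_of_fourier_ae
  rw [fourier_smul (F := L2)]
  filter_upwards [coeFn_fourier_fmul (c • σ) g, coeFn_fourier_fmul σ g,
    Lp.coeFn_smul c (𝓕 (fmul σ g))] with x h1 h2 h4
  rw [h1, h4, Pi.smul_apply, h2, BoundedContinuousFunction.smul_apply, smul_eq_mul, smul_eq_mul,
    mul_assoc]

theorem inner_fmul_right (σ : R3 →ᵇ ℂ) (f g : L2) :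
    inner ℂ f (fmul σ g) = inner ℂ (fmul (star σ) f) g := by
  rw [← Lp.inner_fourier_eq, ← Lp.inner_fourier_eq (fmul (star σ) f), L2.inner_def, L2.inner_def]
  apply integral_congr_ae
  filter_upwards [coeFn_fourier_fmul σ g, coeFn_fourier_fmul (star σ) f] with x h1 h2
  rw [h1, h2]
  simp only [RCLike.inner_apply, BoundedContinuousFunction.star_apply, map_mul,
    RCLike.star_def, Complex.conj_conj]
  ring

theorem norm_fmul_sq (σ : R3 →ᵇ ℂ) (g : L2) :
    ‖fmul σ g‖ ^ 2 = ∫ ξ, ‖σ ξ * (𝓕 g : L2) ξ‖ ^ 2 := by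
  rw [← Lp.norm_fourier_eq, ← inner_self_eq_norm_sq (𝕜 := ℂ), L2.inner_def, ← integral_re
    (L2.integrable_inner _ _)]
  apply integral_congr_ae
  filter_upwards [coeFn_fourier_fmul σ g] with x h1
  rw [h1, inner_self_eq_norm_sq (𝕜 := ℂ)]

theorem norm_fmul_le (σ : R3 →ᵇ ℂ) {C : ℝ} (hC : ∀ ξ, ‖σ ξ‖ ≤ C) (g : L2) :
    ‖fmul σ g‖ ≤ C * ‖g‖ := by
  rw [← Lp.norm_fourier_eq, ← Lp.norm_fourier_eq g]
  apply Lp.norm_le_mul_norm_of_ae_le_mul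
  filter_upwards [coeFn_fourier_fmul σ g] with x h1
  rw [h1, norm_mul]
  exact mul_le_mul_of_nonneg_right (hC x) (norm_nonneg _)

theorem norm_fmul_eq (σ : R3 →ᵇ ℂ) (hσ : ∀ ξ, ‖σ ξ‖ = 1) (g : L2) : ‖fmul σ g‖ = ‖g‖ := by
  apply le_antisymm
  · simpa using norm_fmul_le σ (fun ξ => (hσ ξ).le) g
  · have h : fmul (star σ * σ) g = g := by
      have : star σ * σ = 1 := by
        ext ξ
        simp only [BoundedContinuousFunction.mul_apply, BoundedContinuousFunction.star_apply,
          BoundedContinuousFunction.coe_one, Pi.one_apply, RCLike.star_def]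
        rw [mul_comm, Complex.mul_conj, Complex.normSq_eq_norm_sq, hσ]
        simp
      rw [this, fmul_one]
    rw [fmul_mul] at h
    calc ‖g‖ = ‖fmul (star σ) (fmul σ g)‖ := by rw [h]
      _ ≤ 1 * ‖fmul σ g‖ := norm_fmul_le _ (fun ξ => by
        simp [hσ ξ]) _
      _ = _ := one_mul _

/-- Strong continuity of multipliers. -/
theorem tendsto_fmul {ι : Type*} {l : Filter ι} [l.IsCountablyGenerated] {σ : ι → R3 →ᵇ ℂ}
    {τ : R3 →ᵇ ℂ} {C : ℝ} (hC : ∀ i ξ, ‖σ i ξ‖ ≤ C)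
    (h : ∀ ξ, Tendsto (fun i => σ i ξ) l (𝓝 (τ ξ))) (g : L2) :
    Tendsto (fun i => fmul (σ i) g) l (𝓝 (fmul τ g)) := by
  by_cases hl : l = ⊥
  · simp [hl]
  have : l.NeBot := ⟨hl⟩
  have hτ : ∀ ξ, ‖τ ξ‖ ≤ C := fun ξ => le_of_tendsto' (h ξ).norm (fun i => hC i ξ)
  rw [tendsto_iff_norm_sub_tendsto_zero]
  have key : Tendsto (fun i => ‖fmul (σ i) g - fmul τ g‖ ^ 2) l (𝓝 0) := by
    have e : ∀ i, ‖fmul (σ i) g - fmul τ g‖ ^ 2 = ∫ ξ, ‖(σ i ξ - τ ξ) * (𝓕 g : L2) ξ‖ ^ 2 := by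
      intro i
      have : fmul (σ i) g - fmul τ g = fmul (σ i + (-1 : ℂ) • τ) g := by
        rw [fmul_add, fmul_smul]; simp [sub_eq_add_neg]
      rw [this, norm_fmul_sq]
      simp [sub_eq_add_neg]
    simp_rw [e]
    -- On the Fourier side the integrand is dominated by `(2C)²|𝓕g|²`, since the limit symbol
    -- inherits the bound `C`.
    have hint : Integrable (fun ξ => (2 * C) ^ 2 * ‖(𝓕 g : L2) ξ‖ ^ 2) :=
      (Lp.memLp (𝓕 g : L2)).integrable_norm_pow (by norm_num) |>.const_mul _
    have := tendsto_integral_filter_of_dominated_convergence (μ := volume) (l := l)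
      (F := fun i ξ => ‖(σ i ξ - τ ξ) * (𝓕 g : L2) ξ‖ ^ 2) (f := fun _ => (0 : ℝ)) _
      (Eventually.of_forall fun i => ?_) (Eventually.of_forall fun i => ?_) hint ?_
    · simpa using this
    · exact ((((σ i).continuous.sub τ.continuous).aestronglyMeasurable.mul
        (Lp.aestronglyMeasurable _)).norm.pow 2)
    · refine Eventually.of_forall fun ξ => ?_
      rw [Real.norm_eq_abs, abs_of_nonneg (by positivity), norm_mul, mul_pow]
      gcongr
      calc ‖σ i ξ - τ ξ‖ ≤ ‖σ i ξ‖ + ‖τ ξ‖ := norm_sub_le _ _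
        _ ≤ 2 * C := by linarith [hC i ξ, hτ ξ]
    · refine Eventually.of_forall fun ξ => ?_
      have h0 : Tendsto (fun i => σ i ξ - τ ξ) l (𝓝 0) := by
        simpa using (h ξ).sub_const (τ ξ)
      simpa using ((h0.mul_const ((𝓕 g : L2) ξ)).norm.pow 2)
  have := key.sqrt
  simpa using this

/-- The bridge between the two calculi: on the Fourier side both operators multiply by the same
function, and temperate growth is what makes that product meaningful on all tempered distributions.
-/
theorem coe_fmul {σ : R3 →ᵇ ℂ} (hσ : (σ : R3 → ℂ).HasTemperateGrowth) (g : L2) :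
    (fmul σ g : Distr) = TemperedDistribution.fourierMultiplierCLM ℂ (σ : R3 → ℂ) (g : Distr) := by
  rw [fmul_eq, ← Lp.fourierInv_toTemperedDistribution_eq,
    TemperedDistribution.fourierMultiplierCLM_apply, Lp.fourier_toTemperedDistribution_eq]
  congr 1
  exact Lp.toTemperedDistribution_smul_eq hσ σ.memLp_top (𝓕 g : L2)

theorem toL2_eq_iff {T : Distr} {g : L2} (h : T = (g : Distr)) : toL2 T = g := by
  rw [h, toL2_coe]

/-! ### The Bessel potential and the `L²` coordinate on `H¹`. -/

/-- The bracket `⟨ξ⟩⁻¹`. -/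
def symB : R3 →ᵇ ℂ :=
  BoundedContinuousFunction.ofNormedAddCommGroup
    (fun ξ => (((1 + ‖ξ‖ ^ 2) ^ ((-1 : ℝ) / 2) : ℝ) : ℂ))
    ((by fun_prop : (fun ξ : R3 => (((1 + ‖ξ‖ ^ 2) ^ ((-1 : ℝ) / 2) : ℝ) : ℂ)).HasTemperateGrowth
      ).1.continuous) 1 (by
      intro ξ
      rw [Complex.norm_real, Real.norm_eq_abs, abs_of_nonneg (by positivity)]
      exact Real.rpow_le_one_of_one_le_of_nonpos (by simp) (by norm_num))

theorem symB_apply (ξ : R3) : symB ξ = (((1 + ‖ξ‖ ^ 2) ^ ((-1 : ℝ) / 2) : ℝ) : ℂ) := rfl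

theorem symB_tg : (symB : R3 → ℂ).HasTemperateGrowth := by
  change (fun ξ : R3 => (((1 + ‖ξ‖ ^ 2) ^ ((-1 : ℝ) / 2) : ℝ) : ℂ)).HasTemperateGrowth
  fun_prop

theorem norm_symB_le (ξ : R3) : ‖symB ξ‖ ≤ 1 := by
  rw [symB_apply, Complex.norm_real, Real.norm_eq_abs, abs_of_nonneg (by positivity)]
  exact Real.rpow_le_one_of_one_le_of_nonpos (by simp) (by norm_num)

theorem symB_ne_zero (ξ : R3) : symB ξ ≠ 0 := by
  rw [symB_apply, Complex.ofReal_ne_zero]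
  positivity

theorem star_symB : star symB = symB := by
  ext ξ
  simp [symB_apply]

theorem symB_sq (ξ : R3) : symB ξ * symB ξ = (((1 + ‖ξ‖ ^ 2)⁻¹ : ℝ) : ℂ) := by
  rw [symB_apply, ← Complex.ofReal_mul, ← Real.rpow_add (by positivity)]
  norm_num [Real.rpow_neg_one]

theorem norm_symB_sq (ξ : R3) : ‖symB ξ‖ ^ 2 = (1 + ‖ξ‖ ^ 2)⁻¹ := by
  have := congrArg norm (symB_sq ξ)
  rw [norm_mul, Complex.norm_real, Real.norm_eq_abs, abs_of_nonneg (by positivity)] at this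
  rw [sq, this]

/-- The operator `⟨D⟩⁻¹` on `L²`. -/
def opB : L2 →L[ℂ] L2 := fmul symB

theorem inner_opB (f g : L2) : inner ℂ f (opB g) = inner ℂ (opB f) g := by
  rw [opB, inner_fmul_right, star_symB]

theorem norm_opB_le (g : L2) : ‖opB g‖ ≤ ‖g‖ :=
  (norm_fmul_le symB norm_symB_le g).trans_eq (one_mul _)

theorem opB_injective {f g : L2} (h : opB f = opB g) : f = g := by
  apply eq_of_fourier_ae
  have h' : (𝓕 (fmul symB f) : L2) = 𝓕 (fmul symB g) := by
    change (𝓕 (opB f) : L2) = 𝓕 (opB g); rw [h]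
  filter_upwards [coeFn_fourier_fmul symB f, coeFn_fourier_fmul symB g] with x h1 h2
  rw [h'] at h1
  exact mul_left_cancel₀ (symB_ne_zero x) (h1.symm.trans h2)

theorem coe_opB (g : L2) : (opB g : Distr) = besselPotential R3 ℂ (-1) (g : Distr) :=
  coe_fmul symB_tg g

/-- This lemma and the three after it make `opB` and `J 1` mutually inverse between `L²` and `H¹`,
so that `J 1 v` serves as the coordinate of `v` throughout. -/
theorem memH_opB (k : L2) : MemH 1 (opB k : Distr) :=
  ⟨k, by rw [coe_opB]; simp⟩

theorem J_eq_of {s : ℝ} {T : Distr} {k : L2} (h : besselPotential R3 ℂ s T = (k : Distr)) :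
    J s T = k := by
  rw [J, h, toL2_coe]

theorem J_opB (k : L2) : J 1 (opB k : Distr) = k := J_eq_of (by rw [coe_opB]; simp)

theorem coe_opB_J {v : Distr} (hv : MemH 1 v) : (opB (J 1 v) : Distr) = v := by
  rw [coe_opB, coe_J hv]; simp

theorem toL2_eq_opB {v : Distr} (hv : MemH 1 v) : toL2 v = opB (J 1 v) :=
  toL2_eq_iff (coe_opB_J hv).symm

theorem memH_neg_one_coe (g : L2) : MemH (-1) (g : Distr) := ⟨opB g, (coe_opB g).symm⟩

theorem J_neg_one_coe (g : L2) : J (-1) (g : Distr) = opB g := J_eq_of (coe_opB g).symm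

/-- In the coordinate `k = J 1 v` the `H⁻¹` topology is that of `⟨D⟩⁻² k`. This is why every time
derivative below is taken of `opB (opB (k t))`. -/
theorem J_neg_one {v : Distr} (hv : MemH 1 v) : J (-1) v = opB (opB (J 1 v)) := by
  conv_lhs => rw [← coe_opB_J hv]
  exact J_neg_one_coe _

theorem J_add {s : ℝ} {v w : Distr} (hv : MemH s v) (hw : MemH s w) :
    J s (v + w) = J s v + J s w := by
  apply J_eq_of
  rw [map_add, ← coe_J hv, ← coe_J hw, ← Lp.toTemperedDistributionCLM_apply,
    ← Lp.toTemperedDistributionCLM_apply, ← Lp.toTemperedDistributionCLM_apply, map_add]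

theorem J_sub {s : ℝ} {v w : Distr} (hv : MemH s v) (hw : MemH s w) :
    J s (v - w) = J s v - J s w := by
  apply J_eq_of
  rw [map_sub, ← coe_J hv, ← coe_J hw, ← Lp.toTemperedDistributionCLM_apply,
    ← Lp.toTemperedDistributionCLM_apply, ← Lp.toTemperedDistributionCLM_apply, map_sub]

theorem J_smul {s : ℝ} (c : ℂ) {v : Distr} (hv : MemH s v) : J s (c • v) = c • J s v := by
  apply J_eq_of
  rw [map_smul, ← coe_J hv, ← Lp.toTemperedDistributionCLM_apply,
    ← Lp.toTemperedDistributionCLM_apply, map_smul]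

/-- The element of `H^{-1}` with a given image under `⟨D⟩⁻¹`. -/
theorem exists_memH_neg_one (m : L2) : ∃ f : Distr, MemH (-1) f ∧ J (-1) f = m :=
  ⟨besselPotential R3 ℂ 1 (m : Distr), ⟨m, by simp⟩, J_eq_of (by simp)⟩

/-! ### The free propagator on `L²` -/

/-- The symbol of `e^{itΔ}` as a bounded continuous function. -/
def symU (t : ℝ) : R3 →ᵇ ℂ :=
  BoundedContinuousFunction.ofNormedAddCommGroup (freeSymbol t)
    (freeSymbol_hasTemperateGrowth t).1.continuous 1
    (fun ξ => by rw [freeSymbol, Complex.norm_exp_ofReal_mul_I])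

theorem symU_apply (t : ℝ) (ξ : R3) : symU t ξ = freeSymbol t ξ := rfl

theorem norm_symU (t : ℝ) (ξ : R3) : ‖symU t ξ‖ = 1 := by
  rw [symU_apply, freeSymbol, Complex.norm_exp_ofReal_mul_I]

theorem symU_add (s t : ℝ) : symU (s + t) = symU s * symU t := by
  ext ξ
  rw [BoundedContinuousFunction.mul_apply, symU_apply, symU_apply, symU_apply, freeSymbol,
    freeSymbol, freeSymbol, ← Complex.exp_add]
  congr 1
  push_cast
  ring

theorem symU_zero : symU 0 = 1 := by
  ext ξ
  simp [symU_apply, freeSymbol]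

theorem star_symU (t : ℝ) : star (symU t) = symU (-t) := by
  ext ξ
  rw [BoundedContinuousFunction.star_apply, symU_apply, symU_apply, freeSymbol, freeSymbol,
    RCLike.star_def, ← Complex.exp_conj]
  congr 1
  rw [map_mul, Complex.conj_I, Complex.conj_ofReal]
  push_cast
  ring

/-- The free propagator on `L²`. -/
def opU (t : ℝ) : L2 →L[ℂ] L2 := fmul (symU t)

theorem opU_add (s t : ℝ) (g : L2) : opU (s + t) g = opU s (opU t g) := by
  rw [opU, symU_add, fmul_mul]; rfl

theorem opU_zero (g : L2) : opU 0 g = g := by rw [opU, symU_zero, fmul_one]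

theorem opU_neg_opU (t : ℝ) (g : L2) : opU (-t) (opU t g) = g := by
  rw [← opU_add, neg_add_cancel, opU_zero]

theorem opU_opU_neg (t : ℝ) (g : L2) : opU t (opU (-t) g) = g := by
  rw [← opU_add, add_neg_cancel, opU_zero]

theorem norm_opU (t : ℝ) (g : L2) : ‖opU t g‖ = ‖g‖ := norm_fmul_eq _ (norm_symU t) g

theorem inner_opU (t : ℝ) (f g : L2) : inner ℂ f (opU t g) = inner ℂ (opU (-t) f) g := by
  rw [opU, inner_fmul_right, star_symU]; rfl

theorem opU_opB (t : ℝ) (g : L2) : opU t (opB g) = opB (opU t g) := fmul_comm _ _ _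

theorem continuous_opU (g : L2) : Continuous fun t => opU t g := by
  rw [continuous_iff_continuousAt]
  intro t
  refine tendsto_fmul (C := 1) (fun s ξ => (norm_symU s ξ).le) (fun ξ => ?_) g
  have : Continuous fun s : ℝ => freeSymbol s ξ := by
    unfold freeSymbol
    fun_prop
  exact this.tendsto t

theorem coe_opU (t : ℝ) (g : L2) : (opU t g : Distr) = freeProp t (g : Distr) :=
  coe_fmul (freeSymbol_hasTemperateGrowth t) g

theorem J_freeProp {s : ℝ} {T : Distr} (hT : MemH s T) (t : ℝ) :
    J s (freeProp t T) = opU t (J s T) := by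
  apply J_eq_of
  rw [coe_opU, coe_J hT, besselPotential, freeProp,
    fourierMultiplierCLM_fourierMultiplierCLM_apply (by fun_prop) (freeSymbol_hasTemperateGrowth t),
    fourierMultiplierCLM_fourierMultiplierCLM_apply (freeSymbol_hasTemperateGrowth t) (by fun_prop),
    mul_comm]

/-! ### Derivatives -/

theorem one_le_bracket (ξ : R3) : (0 : ℝ) < 1 + ‖ξ‖ ^ 2 := by positivity

/-- The symbol `2πi ξ_j ⟨ξ⟩⁻¹`. -/
def symD (j : Fin 3) : R3 →ᵇ ℂ :=
  BoundedContinuousFunction.ofNormedAddCommGroup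
    (fun ξ => (2 * Real.pi * Complex.I) *
      ((inner ℝ ξ (EuclideanSpace.single j 1 : R3) * (1 + ‖ξ‖ ^ 2) ^ (-1 / 2 : ℝ) : ℝ) : ℂ))
    ((by fun_prop : (fun ξ : R3 => (2 * Real.pi * Complex.I) *
      ((inner ℝ ξ (EuclideanSpace.single j 1 : R3) * (1 + ‖ξ‖ ^ 2) ^ (-1 / 2 : ℝ) : ℝ) : ℂ)
      ).HasTemperateGrowth).1.continuous) (2 * Real.pi) (by
      intro ξ
      have h1 : ‖(2 * Real.pi * Complex.I : ℂ)‖ = 2 * Real.pi := by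
        simp [abs_of_pos Real.pi_pos]
      rw [norm_mul, h1, Complex.norm_real, norm_mul]
      have h2 : ‖inner ℝ ξ (EuclideanSpace.single j 1 : R3)‖ ≤ ‖ξ‖ := by
        simpa using norm_inner_le_norm (𝕜 := ℝ) ξ (EuclideanSpace.single j 1 : R3)
      have h3 : ‖ξ‖ ^ 2 * ‖symB ξ‖ ^ 2 ≤ 1 := by
        rw [norm_symB_sq, ← div_eq_mul_inv, div_le_one (one_le_bracket ξ)]
        linarith
      have h4 : ‖symB ξ‖ = ‖(1 + ‖ξ‖ ^ 2) ^ (-1 / 2 : ℝ)‖ := by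
        rw [symB_apply, Complex.norm_real]
      rw [← h4]
      have h5 : ‖ξ‖ * ‖symB ξ‖ ≤ 1 := by
        rw [← mul_pow] at h3
        exact (sq_le_one_iff₀ (by positivity)).mp h3
      calc 2 * Real.pi * (‖inner ℝ ξ (EuclideanSpace.single j 1 : R3)‖ * ‖symB ξ‖)
          ≤ 2 * Real.pi * (‖ξ‖ * ‖symB ξ‖) := by gcongr
        _ ≤ 2 * Real.pi * 1 := by gcongr
        _ = _ := mul_one _)

theorem symD_apply (j : Fin 3) (ξ : R3) :
    symD j ξ = (2 * Real.pi * Complex.I) * (ξ j : ℂ) * symB ξ := by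
  change (2 * Real.pi * Complex.I) *
      ((inner ℝ ξ (EuclideanSpace.single j 1 : R3) * (1 + ‖ξ‖ ^ 2) ^ (-1 / 2 : ℝ) : ℝ) : ℂ) = _
  rw [symB_apply, EuclideanSpace.inner_single_right]
  simp
  ring

theorem symD_tg (j : Fin 3) : (symD j : R3 → ℂ).HasTemperateGrowth := by
  change (fun ξ : R3 => (2 * Real.pi * Complex.I) *
      ((inner ℝ ξ (EuclideanSpace.single j 1 : R3) * (1 + ‖ξ‖ ^ 2) ^ (-1 / 2 : ℝ) : ℝ) : ℂ)
      ).HasTemperateGrowth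
  fun_prop

/-- The operator `∂_j ⟨D⟩⁻¹` on `L²`. -/
def opD (j : Fin 3) : L2 →L[ℂ] L2 := fmul (symD j)

theorem coe_opD (j : Fin 3) (k : L2) :
    (opD j k : Distr) = ∂_{(EuclideanSpace.single j 1 : R3)} (opB k : Distr) := by
  rw [opD, coe_fmul (symD_tg j), coe_opB, besselPotential,
    TemperedDistribution.lineDeriv_eq_fourierMultiplierCLM,
    TemperedDistribution.fourierMultiplierCLM_fourierMultiplierCLM_apply (by fun_prop)
      (by fun_prop),
    ← _root_.smul_apply, ← TemperedDistribution.fourierMultiplierCLM_smul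
      (by fun_prop)]
  congr 2
  ext ξ
  simp only [Pi.smul_apply, Pi.mul_apply, smul_eq_mul]
  rw [symD_apply, symB_apply, EuclideanSpace.inner_single_right]
  simp
  ring

theorem partialD_eq (j : Fin 3) {v : Distr} (hv : MemH 1 v) : partialD j v = opD j (J 1 v) := by
  apply toL2_eq_iff
  rw [coe_opD, coe_opB_J hv]

/-- The symbol `4π²|ξ|²⟨ξ⟩⁻²`. -/
def symL : R3 →ᵇ ℂ := ∑ j : Fin 3, star (symD j) * symD j

theorem symL_apply (ξ : R3) :
    symL ξ = ((4 * Real.pi ^ 2 * ‖ξ‖ ^ 2 * (1 + ‖ξ‖ ^ 2)⁻¹ : ℝ) : ℂ) := by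
  have h : ∀ j : Fin 3, (star (symD j) * symD j) ξ =
      ((4 * Real.pi ^ 2 * (ξ j) ^ 2 * (1 + ‖ξ‖ ^ 2)⁻¹ : ℝ) : ℂ) := by
    intro j
    have hB : star (symB ξ) = symB ξ := by rw [symB_apply]; simp
    rw [BoundedContinuousFunction.mul_apply, BoundedContinuousFunction.star_apply, symD_apply,
      star_mul, star_mul, star_mul, hB]
    rw [star_mul]
    simp only [Complex.ofReal_mul, Complex.ofReal_pow, Complex.ofReal_ofNat]
    rw [← symB_sq]
    simp only [RCLike.star_def, Complex.conj_I, Complex.conj_ofReal, map_ofNat]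
    linear_combination (-4 * (Real.pi : ℂ) ^ 2 * (ξ j : ℂ) ^ 2 * symB ξ ^ 2) * Complex.I_sq
  rw [symL, BoundedContinuousFunction.coe_sum, Finset.sum_apply]
  simp_rw [h]
  rw [← Complex.ofReal_sum, EuclideanSpace.norm_sq_eq]
  congr 1
  simp only [Real.norm_eq_abs, sq_abs]
  rw [← Finset.sum_mul, ← Finset.mul_sum]

theorem symL_tg : (symL : R3 → ℂ).HasTemperateGrowth := by
  have : (symL : R3 → ℂ) = fun ξ => ((4 * Real.pi ^ 2 * ‖ξ‖ ^ 2 * (1 + ‖ξ‖ ^ 2) ^ (-1 : ℝ) : ℝ) : ℂ) := by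
    ext ξ; rw [symL_apply, Real.rpow_neg_one]
  rw [this]
  fun_prop

/-- The operator `-Δ ⟨D⟩⁻²` on `L²`. -/
def opL : L2 →L[ℂ] L2 := fmul symL

theorem star_symL : star symL = symL := by
  ext ξ
  rw [BoundedContinuousFunction.star_apply, symL_apply]
  simp

theorem inner_opL (f g : L2) : inner ℂ f (opL g) = inner ℂ (opL f) g := by
  rw [opL, inner_fmul_right, star_symL]

theorem fmul_sum {ι : Type*} (s : Finset ι) (σ : ι → R3 →ᵇ ℂ) (g : L2) :
    fmul (∑ i ∈ s, σ i) g = ∑ i ∈ s, fmul (σ i) g := by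
  classical
  induction s using Finset.induction_on with
  | empty =>
    have := fmul_smul 0 0 g
    simpa using this
  | insert a s ha ih => rw [Finset.sum_insert ha, fmul_add, ih, Finset.sum_insert ha]

theorem inner_opL_eq_sum (f g : L2) :
    inner ℂ f (opL g) = ∑ j : Fin 3, inner ℂ (opD j f) (opD j g) := by
  rw [opL, symL, fmul_sum, inner_sum]
  refine Finset.sum_congr rfl fun j _ => ?_
  rw [fmul_mul, inner_fmul_right, star_star]
  rfl

theorem memH_laplacian {v : Distr} (hv : MemH 1 v) : MemH (-1) (Δ v) := by
  have := MemSobolev.laplacian hv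
  norm_num at this
  exact this

theorem J_laplacian {v : Distr} (hv : MemH 1 v) : J (-1) (Δ v) = - opL (J 1 v) := by
  apply J_eq_of
  -- Written as `⟨D⟩ · ⟨D⟩⁻²`, the operator `⟨D⟩⁻¹` meets the Laplacian through the bounded
  -- multiplier `⟨D⟩⁻²Δ`.
  have e1 : besselPotential R3 ℂ (-1) (Δ v) =
      besselPotential R3 ℂ 1 (besselPotential R3 ℂ (-2) (Δ v)) := by
    rw [besselPotential_besselPotential_apply]; norm_num
  have e2 : ((- opL (J 1 v) : L2) : Distr) = - (opL (J 1 v) : Distr) := by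
    rw [← Lp.toTemperedDistributionCLM_apply, map_neg, Lp.toTemperedDistributionCLM_apply]
  rw [e1, besselPotential_neg_two_laplacian_eq, e2, opL, coe_fmul symL_tg, coe_J hv,
    besselPotential]
  have e3 : (symL : R3 → ℂ) = ((2 * Real.pi) ^ 2 : ℂ) •
      (fun ξ : R3 => ((‖ξ‖ ^ 2 * (1 + ‖ξ‖ ^ 2) ^ (-1 : ℝ) : ℝ) : ℂ)) := by
    ext ξ
    rw [symL_apply, Pi.smul_apply, Real.rpow_neg_one]
    push_cast
    simp only [smul_eq_mul]
    ring
  rw [e3, TemperedDistribution.fourierMultiplierCLM_smul (by fun_prop)]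
  have e4 : ∀ T : Distr, ((2 * Real.pi) ^ 2 : ℝ) • T = ((2 * Real.pi) ^ 2 : ℂ) • T := by
    intro T
    refine (Complex.coe_smul ((2 * Real.pi) ^ 2) T).symm.trans ?_
    push_cast
    rfl
  rw [neg_smul, map_neg, e4, map_smul, _root_.smul_apply,
    fourierMultiplierCLM_fourierMultiplierCLM_apply (by fun_prop) (by fun_prop),
    fourierMultiplierCLM_fourierMultiplierCLM_apply (by fun_prop) (by fun_prop)]
  congr 4
  exact mul_comm _ _

/-! ### Mass, gradient and pairings -/

theorem integral_norm_sq_eq (g : L2) : ∫ x, ‖g x‖ ^ 2 = ‖g‖ ^ 2 := by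
  rw [← inner_self_eq_norm_sq (𝕜 := ℂ), L2.inner_def, ← integral_re (L2.integrable_inner _ _)]
  simp only [inner_self_eq_norm_sq (𝕜 := ℂ)]

theorem integrable_norm_sq (g : L2) : Integrable fun x => ‖g x‖ ^ 2 :=
  (Lp.memLp g).integrable_norm_pow (by norm_num)

theorem mass_eq {v : Distr} (hv : MemH 1 v) : mass v = ‖opB (J 1 v)‖ ^ 2 := by
  rw [mass, integral_norm_sq_eq, toL2_eq_opB hv]

theorem integrable_gradSq (v : Distr) : Integrable (gradSq v) :=
  integrable_finsetSum _ fun j _ => integrable_norm_sq (partialD j v)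

theorem integral_gradSq {v : Distr} (hv : MemH 1 v) :
    ∫ x, gradSq v x = (inner ℂ (J 1 v) (opL (J 1 v)) : ℂ).re := by
  unfold gradSq
  rw [integral_finsetSum _ fun j _ => integrable_norm_sq (partialD j v), inner_opL_eq_sum,
    Complex.re_sum]
  refine Finset.sum_congr rfl fun j _ => ?_
  rw [integral_norm_sq_eq, partialD_eq j hv]
  exact (inner_self_eq_norm_sq (𝕜 := ℂ) _).symm

theorem innerH1_eq {v g : Distr} (hv : MemH 1 v) (hg : MemH 1 g) :
    innerH1 v g = inner ℂ (opB (J 1 g)) (opB (J 1 v)) + inner ℂ (J 1 g) (opL (J 1 v)) := by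
  have hmul : ∀ a b : ℂ, a * starRingEnd ℂ b = inner ℂ b a := by
    intro a b
    rw [RCLike.inner_apply]
  unfold innerH1
  simp_rw [hmul]
  rw [integral_add (L2.integrable_inner _ _)
    (integrable_finsetSum _ fun j _ => L2.integrable_inner _ _),
    integral_finsetSum _ fun j _ => L2.integrable_inner _ _, inner_opL_eq_sum,
    toL2_eq_opB hv, toL2_eq_opB hg, ← L2.inner_def]
  congr 1
  refine Finset.sum_congr rfl fun j _ => ?_
  rw [← L2.inner_def, partialD_eq j hv, partialD_eq j hg]

/-- The symbol `(1 + 4π²|ξ|²)⟨ξ⟩⁻²` of `(1 - Δ)⟨D⟩⁻²`. -/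
def symK : R3 →ᵇ ℂ := symB * symB + symL

theorem symK_apply (ξ : R3) :
    symK ξ = (((1 + 4 * Real.pi ^ 2 * ‖ξ‖ ^ 2) * (1 + ‖ξ‖ ^ 2)⁻¹ : ℝ) : ℂ) := by
  rw [symK, BoundedContinuousFunction.add_apply, BoundedContinuousFunction.mul_apply, symB_sq,
    symL_apply, ← Complex.ofReal_add]
  congr 1
  ring

theorem innerH1_eq_fmul {v g : Distr} (hv : MemH 1 v) (hg : MemH 1 g) :
    innerH1 v g = inner ℂ (fmul symK (J 1 g)) (J 1 v) := by
  have hs : star symK = symK := by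
    ext ξ
    rw [BoundedContinuousFunction.star_apply, symK_apply]
    simp
  rw [innerH1_eq hv hg, ← hs, ← inner_fmul_right, symK, fmul_add, inner_add_right, fmul_mul]
  change _ = inner ℂ (J 1 g) (opB (opB (J 1 v))) + _
  rw [inner_opB (J 1 g) (opB (J 1 v))]
  rfl

/-- The inner product `∫ v ḡ + ∇v · ∇ḡ` has weight `1 + 4π²|ξ|²`, while the norm uses `1 + |ξ|²`.
Their ratio is at least `1`, so its inverse is again a bounded continuous symbol. -/
theorem fmul_symK_surjective (m : L2) : ∃ k : L2, fmul symK k = m := by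
  have hle : ∀ ξ : R3, 1 ≤ (1 + 4 * Real.pi ^ 2 * ‖ξ‖ ^ 2) * (1 + ‖ξ‖ ^ 2)⁻¹ := by
    intro ξ
    rw [← div_eq_mul_inv, le_div_iff₀ (one_le_bracket ξ)]
    have hp : (1 : ℝ) ≤ Real.pi ^ 2 := by nlinarith [Real.pi_gt_three]
    nlinarith [sq_nonneg ‖ξ‖]
  have hK : ∀ ξ, symK ξ ≠ 0 := by
    intro ξ
    rw [symK_apply, Complex.ofReal_ne_zero]
    exact (zero_lt_one.trans_le (hle ξ)).ne'
  let τ : R3 →ᵇ ℂ := BoundedContinuousFunction.ofNormedAddCommGroup (fun ξ => (symK ξ)⁻¹)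
    (symK.continuous.inv₀ hK) 1 (fun ξ => by
      rw [norm_inv, symK_apply, Complex.norm_real, Real.norm_eq_abs,
        abs_of_pos (zero_lt_one.trans_le (hle ξ))]
      exact inv_le_one_of_one_le₀ (hle ξ))
  refine ⟨fmul τ m, ?_⟩
  rw [← fmul_mul]
  have : symK * τ = 1 := by
    ext ξ
    exact mul_inv_cancel₀ (hK ξ)
  rw [this, fmul_one]

/-! ### The two forms of asymptotic orthogonality. -/

theorem asymptOrthL2_iff {w : ℝ → Distr} :
    AsymptOrthL2 w ↔ ∀ m : L2, Tendsto (fun t => (inner ℂ (opU t m) (J 1 (w t)) : ℂ)) atTop (𝓝 0) := by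
  constructor
  · intro h m
    obtain ⟨f, hf, rfl⟩ := exists_memH_neg_one m
    have := h f hf
    unfold pairL2 at this
    simpa only [J_freeProp hf] using this
  · intro h f hf
    unfold pairL2
    simpa only [J_freeProp hf] using h (J (-1) f)

/-- The multiplier `symK` relating the two pairings commutes with the propagator and maps `L²` onto
itself, so it merely relabels the test functions. -/
theorem asymptOrthH1_iff {w : ℝ → Distr} (hw : ∀ t, 0 ≤ t → MemH 1 (w t)) :
    AsymptOrthH1 w ↔ ∀ m : L2, Tendsto (fun t => (inner ℂ (opU t m) (J 1 (w t)) : ℂ)) atTop (𝓝 0) := by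
  have key : ∀ f : Distr, MemH 1 f → (fun t => innerH1 (w t) (freeProp t f)) =ᶠ[atTop]
      fun t => (inner ℂ (opU t (fmul symK (J 1 f))) (J 1 (w t)) : ℂ) := by
    intro f hf
    filter_upwards [eventually_ge_atTop 0] with t ht
    rw [innerH1_eq_fmul (hw t ht) (hf.freeProp t), J_freeProp hf, opU, fmul_comm]
  constructor
  · intro h m
    obtain ⟨k, rfl⟩ := fmul_symK_surjective m
    have h1 := h (opB k : Distr) (memH_opB k)
    have h2 := key _ (memH_opB k)
    rw [J_opB] at h2
    exact h1.congr' h2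
  · intro h f hf
    exact (h _).congr' (key f hf).symm

theorem asymptOrth_equiv {w : ℝ → Distr} (hw : ∀ t, 0 ≤ t → MemH 1 (w t)) :
    AsymptOrthL2 w ↔ AsymptOrthH1 w := by
  rw [asymptOrthL2_iff, asymptOrthH1_iff hw]

/-! ### Fourier integrals, translations and rotations -/

theorem continuous_fourier_of_integrable {f : R3 → ℂ} (hf : Integrable f) :
    Continuous (𝓕 f : R3 → ℂ) :=
  VectorFourier.fourierIntegral_continuous Real.continuous_fourierChar
    (by exact continuous_inner) hf

/-- On `L¹ ∩ L²` the Fourier transform is given by the Fourier integral. -/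
theorem fourier_ae_of_integrable {f : L2} (hf : Integrable f) :
    (𝓕 f : L2) =ᵐ[volume] (𝓕 (f : R3 → ℂ) : R3 → ℂ) := by
  apply ae_eq_of_integral_contDiff_smul_eq
  · exact (Lp.memLp _).locallyIntegrable (by norm_num)
  · exact (continuous_fourier_of_integrable hf).locallyIntegrable
  · intro g g_smooth g_cpt
    have hg₁ : HasCompactSupport (Complex.ofRealCLM ∘ g) := g_cpt.comp_left rfl
    have hg₂ : ContDiff ℝ ((⊤ : ℕ∞) : WithTop ℕ∞) (Complex.ofRealCLM ∘ g) := by fun_prop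
    let φ : 𝓢(R3, ℂ) := hg₁.toSchwartzMap hg₂
    -- Against a test function both candidates reduce to `∫ f · 𝓕φ`: `e1` by the definition of the
    -- Fourier transform of a distribution, `e2` by Fubini for the Fourier integral.
    have e1 : ((𝓕 f : L2) : Distr) φ = (f : Distr) (𝓕 φ) := by
      rw [← Lp.fourier_toTemperedDistribution_eq]; rfl
    rw [Lp.toTemperedDistribution_apply, Lp.toTemperedDistribution_apply] at e1
    have e2 := VectorFourier.integral_fourierIntegral_smul_eq_flip (μ := (volume : Measure R3))
      (ν := (volume : Measure R3)) (L := innerₗ R3) (f := (φ : R3 → ℂ)) (g := (f : R3 → ℂ))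
      Real.continuous_fourierChar (by exact continuous_inner) φ.integrable hf
    have e3 : (∫ x, (𝓕 φ : 𝓢(R3, ℂ)) x • f x) = ∫ x, φ x • (𝓕 (f : R3 → ℂ) : R3 → ℂ) x := by
      rw [flip_innerₗ] at e2
      exact e2
    rw [e3] at e1
    have e4 : ∀ x, φ x = (g x : ℂ) := fun x => rfl
    simpa [e4] using e1

/-- A property closed in `L²` which holds for Schwartz functions holds everywhere. -/
theorem schwartz_dense {p : L2 → Prop} (hp : IsClosed {g | p g})
    (h : ∀ φ : 𝓢(R3, ℂ), p (φ.toLp 2)) (g : L2) : p g :=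
  DenseRange.induction_on (p := p) (SchwartzMap.denseRange_toLpCLM (p := 2) ENNReal.ofNat_ne_top)
    g hp h

theorem integrable_toLp (φ : 𝓢(R3, ℂ)) : Integrable (φ.toLp 2 : L2) :=
  φ.integrable.congr (φ.coeFn_toLp 2).symm

/-- The symbol of a translation. -/
def symT (h : R3) : R3 →ᵇ ℂ :=
  BoundedContinuousFunction.ofNormedAddCommGroup
    (fun ξ => (Real.fourierChar (inner ℝ h ξ) : ℂ))
    (by
      have : Continuous fun ξ : R3 => inner ℝ h ξ := by fun_prop
      exact continuous_subtype_val.comp (Real.continuous_fourierChar.comp this)) 1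
    (fun ξ => (Circle.norm_coe _).le)

theorem symT_apply (h ξ : R3) : symT h ξ = (Real.fourierChar (inner ℝ h ξ) : ℂ) := rfl

theorem norm_symT (h ξ : R3) : ‖symT h ξ‖ = 1 := Circle.norm_coe _

/-- Translation `f ↦ f(· + h)` on `L²`, as a Fourier multiplier. -/
def opT (h : R3) : L2 →L[ℂ] L2 := fmul (symT h)

theorem norm_opT (h : R3) (g : L2) : ‖opT h g‖ = ‖g‖ := norm_fmul_eq _ (norm_symT h) g

/-- Both sides are isometric in `f`, so Schwartz functions suffice; for these the transforms are
Fourier integrals and a translation visibly becomes a character. -/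
theorem opT_eq_comp (h : R3) (f : L2) :
    opT h f = Lp.compMeasurePreserving (· + h) (measurePreserving_add_right volume h) f := by
  revert f
  apply schwartz_dense
  · exact isClosed_eq (opT h).continuous
      (Lp.isometry_compMeasurePreserving (measurePreserving_add_right volume h)).continuous
  intro φ
  set f : L2 := φ.toLp 2
  have hf : Integrable f := integrable_toLp φ
  set f' : L2 := Lp.compMeasurePreserving (· + h) (measurePreserving_add_right volume h) f
  have hf'f : f' =ᵐ[volume] f ∘ (· + h) := Lp.coeFn_compMeasurePreserving _ _
  have hf' : Integrable f' := (hf.comp_add_right h).congr hf'f.symm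
  apply eq_of_fourier_ae
  filter_upwards [coeFn_fourier_fmul (symT h) f, fourier_ae_of_integrable hf,
    fourier_ae_of_integrable hf'] with ξ h1 h2 h3
  rw [opT, h1, h2, h3, Real.fourier_congr_ae hf'f]
  have := congrFun (VectorFourier.fourierIntegral_comp_add_right Real.fourierChar
    (volume : Measure R3) (innerₗ R3) (f : R3 → ℂ) h) ξ
  exact this.symm

theorem coeFn_opT (h : R3) (f : L2) : opT h f =ᵐ[volume] fun x => f (x + h) := by
  rw [opT_eq_comp]
  exact Lp.coeFn_compMeasurePreserving _ _

theorem opT_opB (h : R3) (g : L2) : opT h (opB g) = opB (opT h g) := fmul_comm _ _ _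

theorem opT_opU (h : R3) (t : ℝ) (g : L2) : opT h (opU t g) = opU t (opT h g) := fmul_comm _ _ _

theorem norm_symT_sub_one_le (h ξ : R3) : ‖symT h ξ - 1‖ ≤ 2 * Real.pi * |inner ℝ h ξ| := by
  rw [symT_apply, Real.fourierChar_apply]
  have := Real.norm_exp_I_mul_ofReal_sub_one_le (x := 2 * Real.pi * inner ℝ h ξ)
  rw [mul_comm Complex.I] at this
  refine this.trans_eq ?_
  rw [norm_mul, Real.norm_eq_abs, Real.norm_eq_abs, abs_of_pos (by positivity)]

/-- Since `|e^{2πi h·ξ} - 1| ≤ 2π|h||ξ|` and `|ξ|⟨ξ⟩⁻¹ ≤ 1`. This linear modulus of continuity of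
`H¹` functions in `L²` is the initial smallness in the comparison of a solution with its translate.
-/
theorem norm_opT_sub_opB_le (h : R3) (k : L2) :
    ‖opB (opT h k - k)‖ ≤ 2 * Real.pi * ‖h‖ * ‖k‖ := by
  have e : opB (opT h k - k) = fmul (symB * (symT h + (-1 : ℂ) • 1)) k := by
    rw [fmul_mul, fmul_add, fmul_smul, fmul_one, neg_one_smul, sub_eq_add_neg]
    rfl
  rw [e]
  apply norm_fmul_le
  intro ξ
  have e2 : (symB * (symT h + (-1 : ℂ) • 1)) ξ = symB ξ * (symT h ξ - 1) := by
    simp [sub_eq_add_neg]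
  rw [e2, norm_mul]
  have h1 := norm_symT_sub_one_le h ξ
  have h2 : |inner ℝ h ξ| ≤ ‖h‖ * ‖ξ‖ := abs_real_inner_le_norm h ξ
  have h3 : ‖ξ‖ * ‖symB ξ‖ ≤ 1 := by
    rw [← sq_le_one_iff₀ (by positivity), mul_pow, norm_symB_sq, ← div_eq_mul_inv,
      div_le_one (one_le_bracket ξ)]
    linarith
  calc ‖symB ξ‖ * ‖symT h ξ - 1‖ ≤ ‖symB ξ‖ * (2 * Real.pi * (‖h‖ * ‖ξ‖)) := by
        gcongr
        exact h1.trans (by gcongr)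
    _ = 2 * Real.pi * ‖h‖ * (‖ξ‖ * ‖symB ξ‖) := by ring
    _ ≤ 2 * Real.pi * ‖h‖ * 1 := by gcongr
    _ = _ := mul_one _

/-- Composition with a linear isometry of `ℝ³`, on `L²`. -/
def opR (A : R3 ≃ₗᵢ[ℝ] R3) : L2 →ₗᵢ[ℂ] L2 :=
  Lp.compMeasurePreservingₗᵢ ℂ A A.measurePreserving

theorem coeFn_opR (A : R3 ≃ₗᵢ[ℝ] R3) (f : L2) : opR A f =ᵐ[volume] fun x => f (A x) :=
  Lp.coeFn_compMeasurePreserving _ _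

theorem fourier_opR (A : R3 ≃ₗᵢ[ℝ] R3) (f : L2) : (𝓕 (opR A f) : L2) = opR A (𝓕 f) := by
  revert f
  apply schwartz_dense
  · exact isClosed_eq ((Lp.fourierTransformₗᵢ R3 ℂ).continuous.comp (opR A).continuous)
      ((opR A).continuous.comp (Lp.fourierTransformₗᵢ R3 ℂ).continuous)
  intro φ
  set f : L2 := φ.toLp 2
  have hf : Integrable f := integrable_toLp φ
  have hf' : Integrable (opR A f) :=
    ((A.measurePreserving.integrable_comp_emb
      A.toHomeomorph.measurableEmbedding).mpr hf).congr (coeFn_opR A f).symm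
  apply Lp.ext
  filter_upwards [fourier_ae_of_integrable hf', coeFn_opR A (𝓕 f : L2),
    A.measurePreserving.quasiMeasurePreserving.ae (fourier_ae_of_integrable hf)] with ξ h1 h2 h3
  rw [h1, h2, h3, Real.fourier_congr_ae (coeFn_opR A f)]
  exact Real.fourier_comp_linearIsometry A f ξ

/-- The Fourier transform commutes with linear isometries, so a radial symbol gives an operator that
commutes with them too. -/
theorem fmul_opR (A : R3 ≃ₗᵢ[ℝ] R3) {σ : R3 →ᵇ ℂ} (hσ : ∀ ξ, σ (A ξ) = σ ξ) (f : L2) :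
    fmul σ (opR A f) = opR A (fmul σ f) := by
  apply eq_of_fourier_ae
  rw [fourier_opR]
  filter_upwards [coeFn_fourier_fmul σ (opR A f), coeFn_opR A (𝓕 (fmul σ f) : L2),
    A.measurePreserving.quasiMeasurePreserving.ae (coeFn_fourier_fmul σ f),
    coeFn_opR A (𝓕 f : L2)] with ξ h1 h2 h3 h4
  rw [h1, h2, h3, fourier_opR, h4, hσ]

theorem opB_opR (A : R3 ≃ₗᵢ[ℝ] R3) (f : L2) : opB (opR A f) = opR A (opB f) :=
  fmul_opR A (fun ξ => by simp [symB_apply]) f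

theorem opU_opR (A : R3 ≃ₗᵢ[ℝ] R3) (t : ℝ) (f : L2) : opU t (opR A f) = opR A (opU t f) :=
  fmul_opR A (fun ξ => by simp [symU_apply, freeSymbol]) f

theorem isRadial_iff {v : Distr} (hv : MemH 1 v) :
    IsRadial v ↔ ∀ A : R3 ≃ₗᵢ[ℝ] R3, opR A (J 1 v) = J 1 v := by
  unfold IsRadial
  refine forall_congr' fun A => ?_
  rw [toL2_eq_opB hv]
  constructor
  · intro h
    apply opB_injective
    rw [opB_opR]
    exact Lp.ext ((coeFn_opR A _).trans h)
  · intro h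
    have h1 := coeFn_opR A (opB (J 1 v))
    rw [← opB_opR, h] at h1
    exact h1.symm

/-! ### Characterization of `H¹` by difference quotients -/

/-- The unit vector `e_j` scaled by `1/(n+1)`. -/
def step (j : Fin 3) (n : ℕ) : R3 := EuclideanSpace.single j (1 / ((n : ℝ) + 1))

theorem norm_step (j : Fin 3) (n : ℕ) : ‖step j n‖ = 1 / ((n : ℝ) + 1) := by
  rw [step, PiLp.norm_single, Real.norm_eq_abs, abs_of_pos (by positivity)]

theorem tendsto_fourierChar_quotient (a : ℝ) :
    Tendsto (fun n : ℕ => ((n : ℝ) + 1) *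
      ‖(Real.fourierChar (1 / ((n : ℝ) + 1) * a) : ℂ) - 1‖) atTop (𝓝 (2 * Real.pi * |a|)) := by
  have hd : HasDerivAt (fun s : ℝ => (Real.fourierChar (s * a) : ℂ))
      ((2 * Real.pi * a : ℝ) * Complex.I) 0 := by
    simp only [Real.fourierChar_apply]
    have h1 : HasDerivAt (fun s : ℝ => ((2 * Real.pi * (s * a) : ℝ) : ℂ) * Complex.I)
        ((2 * Real.pi * a : ℝ) * Complex.I) 0 := by
      have h0 : HasDerivAt (fun s : ℝ => 2 * Real.pi * (s * a)) (2 * Real.pi * a) 0 := by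
        simpa using ((hasDerivAt_id (0 : ℝ)).mul_const a).const_mul (2 * Real.pi)
      exact h0.ofReal_comp.mul_const Complex.I
    simpa using h1.cexp
  have hs := hd.tendsto_slope_zero
  have hn : Tendsto (fun n : ℕ => 1 / ((n : ℝ) + 1)) atTop (𝓝[≠] 0) := by
    rw [tendsto_nhdsWithin_iff]
    exact ⟨tendsto_one_div_add_atTop_nhds_zero_nat,
      Eventually.of_forall fun n => by simp only [mem_compl_iff, mem_singleton_iff]; positivity⟩
  have := (hs.comp hn).norm
  have e2 : ‖((2 * Real.pi * a : ℝ) : ℂ) * Complex.I‖ = 2 * Real.pi * |a| := by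
    rw [norm_mul, Complex.norm_I, mul_one, Complex.norm_real, norm_mul, Real.norm_eq_abs,
      Real.norm_eq_abs, abs_of_pos (by positivity)]
  rw [e2] at this
  refine this.congr fun n => ?_
  simp only [Function.comp_apply, zero_add, zero_mul, AddChar.map_zero_eq_one, Circle.coe_one]
  rw [norm_smul, norm_inv, one_div, norm_inv, inv_inv, Real.norm_eq_abs, abs_of_pos (by positivity)]

/-- The `L²` difference quotient in the direction `e_j`. -/
def dq2 (j : Fin 3) (n : ℕ) (g : L2) : ℝ≥0∞ :=
  ENNReal.ofReal (((n : ℝ) + 1) * ‖opT (step j n) g - g‖)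

theorem ofReal_norm_eq_eLpNorm (g : L2) : ENNReal.ofReal ‖g‖ = eLpNorm g 2 volume := by
  rw [Lp.norm_def, ENNReal.ofReal_toReal (Lp.eLpNorm_ne_top g)]

/-- Fatou's lemma on the Fourier side: the symbol of the difference quotient converges in modulus to
`2π|ξ_j|`. -/
theorem eLpNorm_fourier_deriv_le (j : Fin 3) (g : L2) :
    eLpNorm (fun ξ : R3 => ((2 * Real.pi * |ξ j| : ℝ) : ℂ) * (𝓕 g : L2) ξ) 2 volume ≤
      liminf (fun n => dq2 j n g) atTop := by
  have hdq : ∀ n, dq2 j n g = eLpNorm (fun ξ : R3 => (((n : ℝ) + 1 : ℝ) : ℂ) *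
      ((symT (step j n) ξ - 1) * (𝓕 g : L2) ξ)) 2 volume := by
    intro n
    have e : opT (step j n) g - g = fmul (symT (step j n) + (-1 : ℂ) • 1) g := by
      rw [fmul_add, fmul_smul, fmul_one, neg_one_smul, sub_eq_add_neg]
      rfl
    have e3 : ((n : ℝ) + 1) * ‖opT (step j n) g - g‖ =
        ‖(((n : ℝ) + 1 : ℝ) : ℂ) • (𝓕 (opT (step j n) g - g) : L2)‖ := by
      rw [norm_smul, Lp.norm_fourier_eq, Complex.norm_real, Real.norm_eq_abs,
        abs_of_pos (by positivity)]
    rw [dq2, e3, ofReal_norm_eq_eLpNorm]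
    apply eLpNorm_congr_ae
    rw [e]
    filter_upwards [coeFn_fourier_fmul (symT (step j n) + (-1 : ℂ) • 1) g,
      Lp.coeFn_smul (((n : ℝ) + 1 : ℝ) : ℂ)
        (𝓕 (fmul (symT (step j n) + (-1 : ℂ) • 1) g) : L2)] with ξ h1 h2
    rw [h2, Pi.smul_apply, h1]
    simp [sub_eq_add_neg]
  simp_rw [hdq]
  have hlim := Lp.eLpNorm_lim_le_liminf_eLpNorm (p := 2) (μ := (volume : Measure R3))
    (f := fun n ξ => ((((n : ℝ) + 1) * ‖symT (step j n) ξ - 1‖ : ℝ) : ℂ) * (𝓕 g : L2) ξ) (fun n => ?_)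
    (fun ξ : R3 => ((2 * Real.pi * |ξ j| : ℝ) : ℂ) * (𝓕 g : L2) ξ) ?_
  · refine hlim.trans_eq ?_
    congr 1
    ext n
    apply eLpNorm_congr_norm_ae
    refine Eventually.of_forall fun ξ => ?_
    simp [mul_assoc]
  · refine Continuous.aestronglyMeasurable ?_ |>.mul (Lp.aestronglyMeasurable _)
    have := (symT (step j n)).continuous
    fun_prop
  · refine Eventually.of_forall fun ξ => ?_
    have h := tendsto_fourierChar_quotient (ξ j)
    refine Tendsto.mul_const _ ?_
    refine (Complex.continuous_ofReal.tendsto _).comp (h.congr fun n => ?_)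
    rw [symT_apply, step, EuclideanSpace.inner_single_left]
    simp

/-- A function in `L²` whose difference quotients are bounded in `L²` belongs to `H¹`. -/
theorem exists_opB_of_dq2 {g : L2}
    (hfin : ∀ j, liminf (fun n => dq2 j n g) atTop ≠ ∞) :
    ∃ k : L2, opB k = g ∧
      ENNReal.ofReal ‖k‖ ≤ ENNReal.ofReal ‖g‖ + ∑ j, liminf (fun n => dq2 j n g) atTop := by
  have hmeas : ∀ j : Fin 3, AEStronglyMeasurable
      (fun ξ : R3 => ((2 * Real.pi * |ξ j| : ℝ) : ℂ) * (𝓕 g : L2) ξ) volume := by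
    intro j
    refine Continuous.aestronglyMeasurable ?_ |>.mul (Lp.aestronglyMeasurable _)
    fun_prop
  -- The only possible candidate for the transform of `⟨D⟩g`; the work is to show that it lies in
  -- `L²`, through `⟨ξ⟩ ≤ 1 + ∑_j 2π|ξ_j|`.
  set K : R3 → ℂ := fun ξ => (Real.sqrt (1 + ‖ξ‖ ^ 2) : ℂ) * (𝓕 g : L2) ξ
  have hKmeas : AEStronglyMeasurable K volume := by
    refine Continuous.aestronglyMeasurable ?_ |>.mul (Lp.aestronglyMeasurable _)
    fun_prop
  have hpt : ∀ ξ : R3, ‖K ξ‖ₑ ≤ ‖(𝓕 g : L2) ξ‖ₑ +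
      ∑ j : Fin 3, ‖((2 * Real.pi * |ξ j| : ℝ) : ℂ) * (𝓕 g : L2) ξ‖ₑ := by
    intro ξ
    have hb : Real.sqrt (1 + ‖ξ‖ ^ 2) ≤ 1 + ∑ j : Fin 3, 2 * Real.pi * |ξ j| := by
      rw [Real.sqrt_le_left (by positivity), EuclideanSpace.norm_sq_eq, Fin.sum_univ_three,
        Fin.sum_univ_three]
      simp only [Real.norm_eq_abs]
      have hp : (1 : ℝ) ≤ 2 * Real.pi := by nlinarith [Real.pi_gt_three]
      have h0 : ∀ j, 0 ≤ |ξ j| := fun j => abs_nonneg _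
      have h1 : ∀ j, |ξ j| ≤ 2 * Real.pi * |ξ j| := fun j =>
        le_mul_of_one_le_left (h0 j) hp
      have h2 : 1 + (|ξ 0| ^ 2 + |ξ 1| ^ 2 + |ξ 2| ^ 2) ≤ (1 + (|ξ 0| + |ξ 1| + |ξ 2|)) ^ 2 := by
        nlinarith [mul_nonneg (h0 0) (h0 1), mul_nonneg (h0 0) (h0 2), mul_nonneg (h0 1) (h0 2),
          h0 0, h0 1, h0 2]
      refine h2.trans ?_
      have := h0 0
      have := h0 1
      have := h0 2
      gcongr
      · exact h1 0
      · exact h1 1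
      · exact h1 2
    have e : ‖K ξ‖ ≤ ‖(𝓕 g : L2) ξ‖ +
        ∑ j : Fin 3, ‖((2 * Real.pi * |ξ j| : ℝ) : ℂ) * (𝓕 g : L2) ξ‖ := by
      have e2 : ∀ j : Fin 3, ‖((2 * Real.pi * |ξ j| : ℝ) : ℂ) * (𝓕 g : L2) ξ‖ =
          2 * Real.pi * |ξ j| * ‖(𝓕 g : L2) ξ‖ := by
        intro j
        rw [norm_mul, Complex.norm_real, Real.norm_eq_abs, abs_of_nonneg (by positivity)]
      simp_rw [e2]
      rw [← Finset.sum_mul, ← one_add_mul]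
      change ‖(Real.sqrt (1 + ‖ξ‖ ^ 2) : ℂ) * (𝓕 g : L2) ξ‖ ≤ _
      rw [norm_mul, Complex.norm_real, Real.norm_eq_abs, abs_of_nonneg (Real.sqrt_nonneg _)]
      exact mul_le_mul_of_nonneg_right hb (norm_nonneg _)
    simp only [← ofReal_norm]
    rw [← ENNReal.ofReal_sum_of_nonneg (fun j _ => norm_nonneg _),
      ← ENNReal.ofReal_add (norm_nonneg _) (Finset.sum_nonneg fun j _ => norm_nonneg _)]
    exact ENNReal.ofReal_le_ofReal e
  have hKle : eLpNorm K 2 volume ≤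
      ENNReal.ofReal ‖g‖ + ∑ j, liminf (fun n => dq2 j n g) atTop := by
    have h1 : eLpNorm K 2 volume ≤ eLpNorm (fun ξ : R3 => ‖(𝓕 g : L2) ξ‖ₑ +
      ∑ j : Fin 3, ‖((2 * Real.pi * |ξ j| : ℝ) : ℂ) * (𝓕 g : L2) ξ‖ₑ) 2 volume :=
      eLpNorm_mono_enorm fun ξ => by simpa using hpt ξ
    refine h1.trans ?_
    have h2 := eLpNorm_add_le (p := 2) (μ := (volume : Measure R3))
      (f := fun ξ => ‖(𝓕 g : L2) ξ‖ₑ)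
      (g := fun ξ : R3 => ∑ j : Fin 3, ‖((2 * Real.pi * |ξ j| : ℝ) : ℂ) * (𝓕 g : L2) ξ‖ₑ)
      (Lp.aestronglyMeasurable _).enorm.aestronglyMeasurable
      (Finset.aestronglyMeasurable_fun_sum _ fun j _ => (hmeas j).enorm.aestronglyMeasurable)
      (by norm_num)
    refine h2.trans ?_
    have h3 := eLpNorm_sum_le (p := 2) (μ := (volume : Measure R3)) (s := Finset.univ)
      (f := fun (j : Fin 3) (ξ : R3) => ‖((2 * Real.pi * |ξ j| : ℝ) : ℂ) * (𝓕 g : L2) ξ‖ₑ)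
      (fun j _ => (hmeas j).enorm.aestronglyMeasurable) (by norm_num)
    have e0 : (∑ j : Fin 3, fun ξ : R3 => ‖((2 * Real.pi * |ξ j| : ℝ) : ℂ) * (𝓕 g : L2) ξ‖ₑ) =
      fun ξ : R3 => ∑ j : Fin 3, ‖((2 * Real.pi * |ξ j| : ℝ) : ℂ) * (𝓕 g : L2) ξ‖ₑ := by
      ext ξ; rw [Finset.sum_apply]
    rw [e0] at h3
    refine add_le_add ?_ (h3.trans (Finset.sum_le_sum fun j _ => ?_))
    · rw [← Lp.norm_fourier_eq, ofReal_norm_eq_eLpNorm, eLpNorm_enorm]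
    · rw [eLpNorm_enorm]
      exact eLpNorm_fourier_deriv_le j g
  have hfin' : eLpNorm K 2 volume < ∞ := by
    refine hKle.trans_lt (ENNReal.add_lt_top.mpr ⟨ENNReal.ofReal_lt_top, ?_⟩)
    exact ENNReal.sum_lt_top.mpr fun j _ => (hfin j).lt_top
  have hK : MemLp K 2 volume := ⟨hKmeas, hfin'⟩
  refine ⟨𝓕⁻ (hK.toLp K : L2), ?_, ?_⟩
  · apply eq_of_fourier_ae
    have := coeFn_fourier_fmul symB (𝓕⁻ (hK.toLp K : L2))
    rw [fourier_fourierInv_eq] at this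
    filter_upwards [this, hK.coeFn_toLp] with ξ h1 h2
    rw [opB, h1, h2, symB_apply]
    change _ * ((Real.sqrt (1 + ‖ξ‖ ^ 2) : ℂ) * _) = _
    rw [← mul_assoc, ← Complex.ofReal_mul, Real.sqrt_eq_rpow, ← Real.rpow_add (by positivity)]
    norm_num
  · rw [← Lp.norm_fourier_eq, fourier_fourierInv_eq, ofReal_norm_eq_eLpNorm,
      eLpNorm_congr_ae hK.coeFn_toLp]
    exact hKle

/-! ### Sobolev embedding -/

theorem fmul_toLp {σ : R3 →ᵇ ℂ} (hσ : (σ : R3 → ℂ).HasTemperateGrowth) (φ : 𝓢(R3, ℂ)) :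
    fmul σ (φ.toLp 2) = (SchwartzMap.fourierMultiplierCLM ℂ (σ : R3 → ℂ) φ).toLp 2 := by
  apply coe_injective
  rw [coe_fmul hσ, Lp.toTemperedDistribution_toLp_eq, Lp.toTemperedDistribution_toLp_eq,
    fourierMultiplierCLM_toTemperedDistributionCLM_eq hσ]

theorem opD_toLp (j : Fin 3) {φ f : 𝓢(R3, ℂ)} (h : opB (φ.toLp 2) = f.toLp 2) :
    opD j (φ.toLp 2) = (∂_{(EuclideanSpace.single j 1 : R3)} f : 𝓢(R3, ℂ)).toLp 2 := by
  apply coe_injective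
  rw [coe_opD, h, Lp.toTemperedDistribution_toLp_eq, Lp.toTemperedDistribution_toLp_eq,
    lineDerivOp_toTemperedDistributionCLM_eq]

theorem norm_fderiv_le_sum (f : R3 → ℂ) (x : R3) :
    ‖fderiv ℝ f x‖ ≤ ∑ j : Fin 3, ‖fderiv ℝ f x (EuclideanSpace.single j 1)‖ := by
  refine ContinuousLinearMap.opNorm_le_bound _ (Finset.sum_nonneg fun _ _ => norm_nonneg _) ?_
  intro v
  have hv : v = ∑ j : Fin 3, v j • (EuclideanSpace.single j (1 : ℝ) : R3) := by
    ext i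
    simp [Finset.sum_apply, Pi.single_apply]
  conv_lhs => rw [hv, map_sum]
  refine (norm_sum_le _ _).trans ?_
  rw [Finset.sum_mul]
  refine Finset.sum_le_sum fun j _ => ?_
  rw [map_smul, norm_smul, mul_comm]
  gcongr
  exact PiLp.norm_apply_le v j

theorem norm_opD_le (j : Fin 3) (k : L2) : ‖opD j k‖ ≤ 2 * Real.pi * ‖k‖ := by
  apply norm_fmul_le
  intro ξ
  have h2 : ‖(2 * Real.pi * Complex.I : ℂ)‖ = 2 * Real.pi := by simp [abs_of_pos Real.pi_pos]
  rw [symD_apply, norm_mul, norm_mul, h2, mul_assoc, Complex.norm_real]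
  refine mul_le_of_le_one_right (by positivity) ?_
  have h3 : ‖ξ‖ * ‖symB ξ‖ ≤ 1 := by
    rw [← sq_le_one_iff₀ (by positivity), mul_pow, norm_symB_sq, ← div_eq_mul_inv,
      div_le_one (one_le_bracket ξ)]
    linarith
  exact (mul_le_mul_of_nonneg_right (PiLp.norm_apply_le ξ j) (norm_nonneg _)).trans h3

theorem eLpNorm_schwartz_toLp (f : 𝓢(R3, ℂ)) :
    eLpNorm (f : R3 → ℂ) 2 (volume : Measure R3) =
      ENNReal.ofReal ‖(f.toLp 2 (volume : Measure R3) : L2)‖ := by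
  rw [ofReal_norm_eq_eLpNorm]
  exact (eLpNorm_congr_ae (f.coeFn_toLp 2 (volume : Measure R3))).symm

theorem eLpNorm_fderiv_schwartz_le {φ f : 𝓢(R3, ℂ)} (h : opB (φ.toLp 2) = f.toLp 2) :
    eLpNorm (fderiv ℝ f) 2 volume ≤ ENNReal.ofReal (6 * Real.pi * ‖φ.toLp 2‖) := by
  have h1 : eLpNorm (fderiv ℝ f) 2 volume ≤ eLpNorm (fun x => ∑ j : Fin 3,
      ‖(∂_{(EuclideanSpace.single j 1 : R3)} f : 𝓢(R3, ℂ)) x‖) 2 volume := by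
    refine eLpNorm_mono fun x => ?_
    rw [Real.norm_eq_abs, abs_of_nonneg (Finset.sum_nonneg fun _ _ => norm_nonneg _)]
    exact norm_fderiv_le_sum f x
  refine h1.trans ?_
  have h2 := eLpNorm_sum_le (p := 2) (μ := (volume : Measure R3)) (s := Finset.univ)
    (f := fun (j : Fin 3) (x : R3) => ‖(∂_{(EuclideanSpace.single j 1 : R3)} f : 𝓢(R3, ℂ)) x‖)
    (fun j _ => (SchwartzMap.continuous _).norm.aestronglyMeasurable) (by norm_num)
  have e : (∑ j : Fin 3, fun x : R3 => ‖(∂_{(EuclideanSpace.single j 1 : R3)} f : 𝓢(R3, ℂ)) x‖) =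
      fun x : R3 => ∑ j : Fin 3, ‖(∂_{(EuclideanSpace.single j 1 : R3)} f : 𝓢(R3, ℂ)) x‖ := by
    ext x; rw [Finset.sum_apply]
  rw [e] at h2
  refine h2.trans ?_
  have h3 : ∀ j : Fin 3,
      eLpNorm (fun x : R3 => ‖(∂_{(EuclideanSpace.single j 1 : R3)} f : 𝓢(R3, ℂ)) x‖) 2 volume ≤
      ENNReal.ofReal (2 * Real.pi * ‖φ.toLp 2‖) := by
    intro j
    rw [eLpNorm_norm, eLpNorm_schwartz_toLp, ← opD_toLp j h]
    exact ENNReal.ofReal_le_ofReal (norm_opD_le j _)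
  refine (Finset.sum_le_sum fun j _ => h3 j).trans_eq ?_
  rw [Finset.sum_const, Finset.card_univ, Fintype.card_fin, ← ENNReal.ofReal_nsmul]
  congr 1
  simp only [nsmul_eq_mul]
  push_cast
  ring

/-- The Gagliardo–Nirenberg–Sobolev inequality is applied to the compactly supported cutoffs `η_n
f`, and Fatou removes the cutoff. The gradient of `η_n` need only stay bounded, since `‖f‖₂` is
controlled as well. -/
theorem exists_sobolev_schwartz : ∃ C : ℝ, 0 < C ∧ ∀ φ f : 𝓢(R3, ℂ), opB (φ.toLp 2) = f.toLp 2 →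
    eLpNorm f 6 volume ≤ ENNReal.ofReal (C * ‖φ.toLp 2‖) := by
  let ρ : ContDiffBump (0 : R3) := ⟨1, 2, one_pos, one_lt_two⟩
  obtain ⟨M, hM⟩ : ∃ M, ∀ x, ‖fderiv ℝ ρ x‖ ≤ M := by
    have hc : Continuous (fderiv ℝ ρ) := (ρ.contDiff (n := 1)).continuous_fderiv (by norm_num)
    exact hc.bounded_above_of_compact_support (ρ.hasCompactSupport.fderiv ℝ)
  have hM0 : 0 ≤ M := (norm_nonneg _).trans (hM 0)
  set C₀ : NNReal := SNormLESNormFDerivOfEqConst ℂ (volume : Measure R3) 2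
  -- The constant `6π = 3 · 2π` bounds the gradient through its three partial derivatives, `M`
  -- accounts for the gradient of the cutoff, and the final `1` makes the constant positive.
  refine ⟨C₀ * (6 * Real.pi + M) + 1, by positivity, fun φ f hφf => ?_⟩
  let η : ℕ → R3 → ℝ := fun n x => ρ (((n : ℝ) + 1)⁻¹ • x)
  have hηd : ∀ n, ContDiff ℝ 1 (η n) := fun n => ρ.contDiff.comp (contDiff_const_smul _)
  have hη1 : ∀ n x, |η n x| ≤ 1 := fun n x => by
    rw [abs_of_nonneg ρ.nonneg]; exact ρ.le_one
  have hηf : ∀ n x, ‖fderiv ℝ (η n) x‖ ≤ M := by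
    intro n x
    have : fderiv ℝ (η n) x = ((n : ℝ) + 1)⁻¹ • fderiv ℝ ρ (((n : ℝ) + 1)⁻¹ • x) :=
      fderiv_comp_smul _
    rw [this, norm_smul]
    have h1 : ‖((n : ℝ) + 1)⁻¹‖ ≤ 1 := by
      rw [norm_inv, Real.norm_eq_abs, abs_of_pos (by positivity)]
      exact inv_le_one_of_one_le₀ (by linarith [(Nat.cast_nonneg n : (0 : ℝ) ≤ n)])
    calc _ ≤ 1 * M := mul_le_mul h1 (hM _) (norm_nonneg _) zero_le_one
      _ = M := one_mul _
  have hηc : ∀ n, HasCompactSupport (η n) := fun n =>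
    ρ.hasCompactSupport.comp_smul (by positivity)
  have hfd : ContDiff ℝ 1 f := f.smooth 1
  have hbound : ∀ n, eLpNorm (fun x => η n x • f x) 6 volume ≤
      ENNReal.ofReal ((C₀ * (6 * Real.pi + M) + 1) * ‖φ.toLp 2‖) := by
    intro n
    have h1 := eLpNorm_le_eLpNorm_fderiv_of_eq (μ := (volume : Measure R3)) (F := ℂ)
      (u := fun x => η n x • f x) (p := 2) (p' := 6) ((hηd n).smul hfd) ((hηc n).smul_right)
      (by norm_num) (by simp) (by simp; norm_num)
    have h2 : eLpNorm (fderiv ℝ fun x => η n x • f x) 2 volume ≤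
        ENNReal.ofReal (6 * Real.pi * ‖φ.toLp 2‖) + ENNReal.ofReal (M * ‖φ.toLp 2‖) := by
      have h3 : eLpNorm (fderiv ℝ fun x => η n x • f x) 2 volume ≤
          eLpNorm (fun x => ‖fderiv ℝ f x‖ + M * ‖f x‖) 2 volume := by
        refine eLpNorm_mono fun x => ?_
        have e : fderiv ℝ (fun x => η n x • f x) x =
            η n x • fderiv ℝ f x + (fderiv ℝ (η n) x).smulRight (f x) :=
          fderiv_fun_smul ((hηd n).differentiable one_ne_zero x)
            (hfd.differentiable one_ne_zero x)
        rw [e, Real.norm_eq_abs, abs_of_nonneg (by positivity)]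
        refine (norm_add_le _ _).trans (add_le_add ?_ ?_)
        · rw [norm_smul]
          exact mul_le_of_le_one_left (norm_nonneg _) (hη1 n x)
        · rw [ContinuousLinearMap.norm_smulRight_apply]
          exact mul_le_mul_of_nonneg_right (hηf n x) (norm_nonneg _)
      refine h3.trans ((eLpNorm_add_le ?_ ?_ (by norm_num)).trans (add_le_add ?_ ?_))
      · exact (hfd.continuous_fderiv one_ne_zero).norm.aestronglyMeasurable
      · exact (continuous_const.mul f.continuous.norm).aestronglyMeasurable
      · rw [eLpNorm_norm]
        exact eLpNorm_fderiv_schwartz_le hφf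
      · have e2 : (fun x => M * ‖f x‖) = M • fun x => ‖f x‖ := rfl
        rw [e2, eLpNorm_const_smul, eLpNorm_norm, eLpNorm_schwartz_toLp, ← hφf,
          ENNReal.ofReal_mul hM0, Real.enorm_eq_ofReal hM0]
        gcongr
        exact norm_opB_le _
    have e6 : ((6 : NNReal) : ℝ≥0∞) = 6 := by norm_num
    have e2 : ((2 : NNReal) : ℝ≥0∞) = 2 := by norm_num
    rw [e6, e2] at h1
    refine h1.trans ((mul_le_mul_right h2 _).trans ?_)
    rw [← ENNReal.ofReal_add (by positivity) (by positivity), ← ENNReal.ofReal_coe_nnreal,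
      ← ENNReal.ofReal_mul (by positivity)]
    apply ENNReal.ofReal_le_ofReal
    have : 0 ≤ ‖φ.toLp (E := R3) 2‖ := norm_nonneg _
    change (C₀ : ℝ) * _ ≤ _
    nlinarith
  refine (Lp.eLpNorm_lim_le_liminf_eLpNorm (fun n => ((hηd n).continuous.smul
    f.continuous).aestronglyMeasurable) f (Eventually.of_forall fun x => ?_)).trans
    (liminf_le_of_le (by isBoundedDefault) fun b hb => ?_)
  · have : ∀ᶠ n : ℕ in atTop, η n x • f x = f x := by
      have ht : Tendsto (fun n : ℕ => ((n : ℝ) + 1)⁻¹ • x) atTop (𝓝 0) := by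
        have := (tendsto_one_div_add_atTop_nhds_zero_nat (𝕜 := ℝ)).smul_const x
        simpa using this
      have hev := ht.eventually (Metric.closedBall_mem_nhds (0 : R3) one_pos)
      filter_upwards [hev] with n hn
      have : η n x = 1 := ρ.one_of_mem_closedBall hn
      rw [this, one_smul]
    exact (tendsto_congr' this).mpr tendsto_const_nhds
  · obtain ⟨n, hn⟩ := hb.exists
    exact hn.trans (hbound n)

/-- The estimate survives `L²` limits of `k`: a subsequence of the functions `⟨D⟩⁻¹ k` converges
almost everywhere, and Fatou applies in `L⁶`. -/
theorem exists_sobolev_six : ∃ C : ℝ, 0 < C ∧ ∀ k : L2,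
    eLpNorm (opB k) 6 volume ≤ ENNReal.ofReal (C * ‖k‖) := by
  obtain ⟨C, hC, h⟩ := exists_sobolev_schwartz
  refine ⟨C, hC, ?_⟩
  apply schwartz_dense
  · apply IsSeqClosed.isClosed
    intro u k hu huk
    have h1 : Tendsto (fun n => opB (u n)) atTop (𝓝 (opB k)) :=
      (opB.continuous.tendsto k).comp huk
    obtain ⟨ns, hns, hae⟩ := (tendstoInMeasure_of_tendsto_Lp h1).exists_seq_tendsto_ae
    refine (Lp.eLpNorm_lim_le_liminf_eLpNorm (fun n => Lp.aestronglyMeasurable _) _ hae).trans ?_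
    have h2 : Tendsto (fun n => ENNReal.ofReal (C * ‖u (ns n)‖)) atTop
        (𝓝 (ENNReal.ofReal (C * ‖k‖))) :=
      ENNReal.tendsto_ofReal (((huk.comp hns.tendsto_atTop).norm).const_mul C)
    rw [← h2.liminf_eq]
    exact liminf_le_liminf (Eventually.of_forall fun n => hu (ns n))
  · intro φ
    have e := fmul_toLp symB_tg φ
    rw [opB, e, eLpNorm_congr_ae (SchwartzMap.coeFn_toLp _ 2 volume)]
    exact h φ _ e

/-- The constant of the embedding of `H¹` in `L⁶`. -/
def sobC : ℝ := exists_sobolev_six.choose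

theorem sobC_pos : 0 < sobC := exists_sobolev_six.choose_spec.1

theorem eLpNorm_six_le (k : L2) : eLpNorm (opB k) 6 volume ≤ ENNReal.ofReal (sobC * ‖k‖) :=
  exists_sobolev_six.choose_spec.2 k

theorem memLp_six (k : L2) : MemLp (opB k) 6 volume :=
  ⟨Lp.aestronglyMeasurable _, (eLpNorm_six_le k).trans_lt ENNReal.ofReal_lt_top⟩

theorem lintegral_pow_of_eLpNorm (f : R3 → ℂ) (n : ℕ) (hn : n ≠ 0) :
    ∫⁻ x, ‖f x‖ₑ ^ n = eLpNorm f n volume ^ n := by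
  have h := eLpNorm_nnreal_pow_eq_lintegral (μ := (volume : Measure R3)) (f := f)
    (p := (n : NNReal)) (by exact_mod_cast hn)
  simp only [NNReal.coe_natCast, ENNReal.rpow_natCast, ENNReal.coe_natCast] at h
  exact h.symm

theorem eLpNorm_four_pow_le (k : L2) :
    eLpNorm (opB k) 4 volume ^ 4 ≤ ENNReal.ofReal ((1 + sobC ^ 6) * ‖k‖ ^ 4) := by
  by_cases hk : k = 0
  · have : eLpNorm (opB k) 4 volume = 0 := by
      rw [hk, map_zero, eLpNorm_congr_ae (Lp.coeFn_zero _ _ _), eLpNorm_zero]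
    rw [this]; simp
  have hN : 0 < ‖k‖ := norm_pos_iff.mpr hk
  have h4 := lintegral_pow_of_eLpNorm (opB k) 4 (by norm_num)
  have h2 := lintegral_pow_of_eLpNorm (opB k) 2 (by norm_num)
  have h6 := lintegral_pow_of_eLpNorm (opB k) 6 (by norm_num)
  norm_num only [Nat.cast_ofNat] at h4 h2 h6
  rw [← h4]
  -- Interpolation of `L⁴` between `L²` and `L⁶` by a pointwise Young inequality `a⁴ ≤ N²a² +
  -- N⁻²a⁶`. The weight `N = ‖k‖` makes the integrated bound homogeneous of degree four.
  have hpt : ∀ x, ‖opB k x‖ₑ ^ 4 ≤ ENNReal.ofReal (‖k‖ ^ 2) * ‖opB k x‖ₑ ^ 2 +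
      ENNReal.ofReal ((‖k‖ ^ 2)⁻¹) * ‖opB k x‖ₑ ^ 6 := by
    intro x
    rw [← ofReal_norm, ← ENNReal.ofReal_pow (norm_nonneg _), ← ENNReal.ofReal_pow (norm_nonneg _),
      ← ENNReal.ofReal_pow (norm_nonneg _), ← ENNReal.ofReal_mul (by positivity),
      ← ENNReal.ofReal_mul (by positivity), ← ENNReal.ofReal_add (by positivity) (by positivity)]
    apply ENNReal.ofReal_le_ofReal
    set a := ‖opB k x‖
    set N := ‖k‖
    have e : N ^ 2 * a ^ 2 + (N ^ 2)⁻¹ * a ^ 6 - a ^ 4 =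
        (N ^ 2)⁻¹ * a ^ 2 * ((N ^ 2 - a ^ 2 / 2) ^ 2 + 3 / 4 * a ^ 4) := by
      field_simp
      ring
    have : 0 ≤ (N ^ 2)⁻¹ * a ^ 2 * ((N ^ 2 - a ^ 2 / 2) ^ 2 + 3 / 4 * a ^ 4) := by positivity
    linarith
  have hm : AEMeasurable (fun x => ‖opB k x‖ₑ) volume := (Lp.aestronglyMeasurable _).enorm
  refine (lintegral_mono hpt).trans ?_
  rw [lintegral_add_left' ((hm.pow_const 2).const_mul _), lintegral_const_mul'' _ (hm.pow_const 2),
    lintegral_const_mul'' _ (hm.pow_const 6), h2, h6, ← ofReal_norm_eq_eLpNorm]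
  have h7 : ENNReal.ofReal ‖opB k‖ ≤ ENNReal.ofReal ‖k‖ := ENNReal.ofReal_le_ofReal (norm_opB_le k)
  refine (add_le_add (mul_le_mul_right (pow_le_pow_left₀ (by positivity) h7 2) _)
    (mul_le_mul_right (pow_le_pow_left₀ (by positivity) (eLpNorm_six_le k) 6) _)).trans ?_
  have hs := sobC_pos
  rw [← ENNReal.ofReal_pow (by positivity), ← ENNReal.ofReal_pow (by positivity),
    ← ENNReal.ofReal_mul (by positivity), ← ENNReal.ofReal_mul (by positivity),
    ← ENNReal.ofReal_add (by positivity) (by positivity)]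
  apply ENNReal.ofReal_le_ofReal
  apply le_of_eq
  field_simp

/-- The constant of the embedding of `H¹` in `L⁴`. -/
def sobC4 : ℝ := 1 + sobC ^ 6

theorem sobC4_pos : 0 < sobC4 := by
  have := sobC_pos
  unfold sobC4
  positivity

theorem eLpNorm_four_le (k : L2) : eLpNorm (opB k) 4 volume ≤ ENNReal.ofReal (sobC4 * ‖k‖) := by
  have h := eLpNorm_four_pow_le k
  have hs := sobC_pos
  have h1 : (1 + sobC ^ 6) * ‖k‖ ^ 4 ≤ (sobC4 * ‖k‖) ^ 4 := by
    rw [mul_pow]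
    gcongr
    exact le_self_pow₀ (by linarith [pow_pos hs 6]) (by norm_num)
  have h2 := h.trans (ENNReal.ofReal_le_ofReal h1)
  rw [ENNReal.ofReal_pow (mul_nonneg sobC4_pos.le (norm_nonneg _))] at h2
  exact (ENNReal.pow_le_pow_left_iff (by norm_num)).mp h2

theorem memLp_four (k : L2) : MemLp (opB k) 4 volume :=
  ⟨Lp.aestronglyMeasurable _, (eLpNorm_four_le k).trans_lt ENNReal.ofReal_lt_top⟩

/-- The `L⁴` norm of `⟨D⟩⁻¹ k`. -/
def n4 (k : L2) : ℝ := (eLpNorm (opB k) 4 volume).toReal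

theorem ofReal_n4 (k : L2) : ENNReal.ofReal (n4 k) = eLpNorm (opB k) 4 volume :=
  ENNReal.ofReal_toReal (memLp_four k).2.ne

theorem n4_nonneg (k : L2) : 0 ≤ n4 k := ENNReal.toReal_nonneg

theorem n4_le (k : L2) : n4 k ≤ sobC4 * ‖k‖ :=
  ENNReal.toReal_le_of_le_ofReal (mul_nonneg sobC4_pos.le (norm_nonneg _)) (eLpNorm_four_le k)

theorem n4_add_le (k l : L2) : n4 (k + l) ≤ n4 k + n4 l := by
  unfold n4
  rw [← ENNReal.toReal_add (memLp_four k).2.ne (memLp_four l).2.ne, map_add,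
    eLpNorm_congr_ae (Lp.coeFn_add _ _)]
  refine ENNReal.toReal_mono (ENNReal.add_ne_top.mpr ⟨(memLp_four k).2.ne, (memLp_four l).2.ne⟩) ?_
  exact eLpNorm_add_le (memLp_four k).1 (memLp_four l).1 (by norm_num)

theorem n4_smul (c : ℂ) (k : L2) : n4 (c • k) = ‖c‖ * n4 k := by
  unfold n4
  rw [map_smul, eLpNorm_congr_ae (Lp.coeFn_smul _ _), eLpNorm_const_smul, ENNReal.toReal_mul]
  simp

theorem n4_neg (k : L2) : n4 (-k) = n4 k := by
  simpa using n4_smul (-1) k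

theorem n4_sub_le (k l : L2) : n4 (k - l) ≤ n4 k + n4 l := by
  rw [sub_eq_add_neg]
  simpa [n4_neg] using n4_add_le k (-l)

theorem abs_n4_sub_le (k l : L2) : |n4 k - n4 l| ≤ sobC4 * ‖k - l‖ := by
  have h1 := n4_add_le (k - l) l
  have h2 := n4_add_le (l - k) k
  rw [sub_add_cancel] at h1 h2
  have h3 : n4 (l - k) = n4 (k - l) := by rw [← neg_sub, n4_neg]
  have h4 := n4_le (k - l)
  rw [abs_le]
  constructor <;> linarith

theorem continuous_n4 : Continuous n4 := by
  have : LipschitzWith (Real.toNNReal sobC4) n4 := LipschitzWith.of_dist_le_mul fun k l => by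
    rw [Real.dist_eq, dist_eq_norm, Real.coe_toNNReal _ sobC4_pos.le]
    exact abs_n4_sub_le k l
  exact this.continuous

theorem n4_pos {k : L2} (hk : k ≠ 0) : 0 < n4 k := by
  refine lt_of_le_of_ne (n4_nonneg k) fun h => hk ?_
  have h0 : eLpNorm (opB k) 4 volume = 0 := by rw [← ofReal_n4, ← h, ENNReal.ofReal_zero]
  rw [eLpNorm_eq_zero_iff (Lp.aestronglyMeasurable _) (by norm_num)] at h0
  apply opB_injective
  rw [map_zero]
  exact (Lp.eq_zero_iff_ae_eq_zero).mpr h0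

theorem n4_opT (h : R3) (k : L2) : n4 (opT h k) = n4 k := by
  unfold n4
  rw [← opT_opB, eLpNorm_congr_ae (coeFn_opT h _)]
  congr 1
  exact eLpNorm_comp_measurePreserving (Lp.aestronglyMeasurable _)
    (measurePreserving_add_right volume h)

/-! ### Bounded functions: the embedding of `W^{1,4}` in `L^∞` -/

/-- Hölder on the unit ball costs `|B|^{3/4}`, and rescaling the `L⁴` norm costs `s^{-3/4}`. The
exponent `3/4 < 1` is integrable at `s = 0`; here `4 > 3` enters Morrey's inequality. -/
theorem lintegral_ball_comp_smul_le {g : R3 → ℝ≥0∞} (hg : Measurable g) (x : R3) {s : ℝ}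
    (hs : 0 < s) :
    ∫⁻ y in Metric.ball (0 : R3) 1, g (x + s • y) ≤
      eLpNorm g 4 volume * ENNReal.ofReal (s ^ (-(3 / 4) : ℝ)) *
        volume (Metric.ball (0 : R3) 1) ^ (3 / 4 : ℝ) := by
  have hm : Measurable fun y : R3 => g (x + s • y) := by fun_prop
  have h1 := eLpNorm_le_eLpNorm_mul_rpow_measure_univ
    (μ := volume.restrict (Metric.ball (0 : R3) 1)) (p := 1) (q := 4) (by norm_num)
    hm.aestronglyMeasurable
  rw [eLpNorm_one_eq_lintegral_enorm] at h1
  simp only [enorm_eq_self, Measure.restrict_apply_univ] at h1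
  have e0 : (1 / (1 : ℝ≥0∞).toReal - 1 / (4 : ℝ≥0∞).toReal : ℝ) = 3 / 4 := by norm_num
  rw [e0] at h1
  refine h1.trans (mul_le_mul_left ?_ _)
  refine (eLpNorm_mono_measure _ Measure.restrict_le_self).trans ?_
  have h4 : eLpNorm (fun y : R3 => g (x + s • y)) 4 volume ^ 4 =
      (eLpNorm g 4 volume * ENNReal.ofReal (s ^ (-(3 / 4) : ℝ))) ^ 4 := by
    have e1 := eLpNorm_nnreal_pow_eq_lintegral (μ := (volume : Measure R3))
      (f := fun y : R3 => g (x + s • y)) (p := 4) (by norm_num)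
    have e2 := eLpNorm_nnreal_pow_eq_lintegral (μ := (volume : Measure R3))
      (f := g) (p := 4) (by norm_num)
    have e4 : ((4 : NNReal) : ℝ≥0∞) = 4 := by norm_num
    simp only [e4, NNReal.coe_ofNat, ENNReal.rpow_ofNat, enorm_eq_self] at e1 e2
    rw [mul_pow, e1, e2]
    have e3 : ∫⁻ y : R3, g (x + s • y) ^ 4 = ∫⁻ y : R3, g (s • y) ^ 4 := by
      have := lintegral_add_left_eq_self (μ := (volume : Measure R3))
        (fun y => g (s • y) ^ 4) (s⁻¹ • x)
      rw [← this]
      congr 1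
      ext y
      rw [smul_add, smul_inv_smul₀ hs.ne']
    rw [e3, ← lintegral_map (f := fun y => g y ^ 4) (hg.pow_const 4) (measurable_const_smul s),
      Measure.map_addHaar_smul _ hs.ne', lintegral_smul_measure, smul_eq_mul, mul_comm,
      ← ENNReal.ofReal_pow (by positivity)]
    congr 2
    rw [finrank_euclideanSpace_fin, abs_of_pos (by positivity), ← Real.rpow_natCast (s ^ _),
      ← Real.rpow_mul hs.le, ← Real.rpow_natCast s 3, ← Real.rpow_neg hs.le]
    norm_num
  exact ((ENNReal.pow_le_pow_left_iff (by norm_num)).mp h4.le)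

theorem enorm_le_add_lintegral_fderiv {f : R3 → ℂ} (hf : ContDiff ℝ 1 f) (x y : R3) :
    ‖f x‖ₑ ≤ ‖f (x + y)‖ₑ + ∫⁻ s in Ioc (0 : ℝ) 1, ‖fderiv ℝ f (x + s • y)‖ₑ * ‖y‖ₑ := by
  have hd : ∀ s : ℝ, HasDerivAt (fun s : ℝ => f (x + s • y)) (fderiv ℝ f (x + s • y) y) s := by
    intro s
    have h1 : HasDerivAt (fun s : ℝ => x + s • y) y s := by
      simpa using ((hasDerivAt_id s).smul_const y).const_add x
    exact ((hf.differentiable one_ne_zero _).hasFDerivAt.comp_hasDerivAt s h1)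
  have hc : Continuous fun s : ℝ => fderiv ℝ f (x + s • y) y := by
    have := hf.continuous_fderiv one_ne_zero
    fun_prop
  have hint := intervalIntegral.integral_eq_sub_of_hasDerivAt (a := 0) (b := 1)
    (fun s _ => hd s) (hc.intervalIntegrable _ _)
  simp only [one_smul, zero_smul, add_zero] at hint
  have e : f x = f (x + y) - ∫ s in (0 : ℝ)..1, fderiv ℝ f (x + s • y) y := by
    rw [hint]; ring
  calc ‖f x‖ₑ = ‖f (x + y) - ∫ s in (0 : ℝ)..1, fderiv ℝ f (x + s • y) y‖ₑ := by rw [← e]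
    _ ≤ ‖f (x + y)‖ₑ + ‖∫ s in (0 : ℝ)..1, fderiv ℝ f (x + s • y) y‖ₑ := enorm_sub_le
    _ ≤ _ := by
      gcongr
      rw [intervalIntegral.integral_of_le zero_le_one]
      refine (enorm_integral_le_lintegral_enorm _).trans (lintegral_mono fun s => ?_)
      exact ContinuousLinearMap.le_opENorm _ _

theorem lintegral_rpow_neg_three_quarters :
    ∫⁻ s in Ioc (0 : ℝ) 1, ENNReal.ofReal (s ^ (-(3 / 4) : ℝ)) = ENNReal.ofReal 4 := by
  have hi : IntegrableOn (fun s : ℝ => s ^ (-(3 / 4) : ℝ)) (Ioc 0 1) :=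
    (intervalIntegrable_iff_integrableOn_Ioc_of_le zero_le_one).mp
      (intervalIntegral.intervalIntegrable_rpow' (by norm_num))
  rw [← ofReal_integral_eq_lintegral_ofReal hi ?_, ← intervalIntegral.integral_of_le zero_le_one,
    integral_rpow (by norm_num)]
  · norm_num
  · filter_upwards [ae_restrict_mem measurableSet_Ioc] with s hs
    exact Real.rpow_nonneg hs.1.le _

/-- The constant of Morrey's inequality. -/
def ballC : ℝ≥0∞ := (volume (Metric.ball (0 : R3) 1))⁻¹ *
  (volume (Metric.ball (0 : R3) 1) ^ (3 / 4 : ℝ) * 4)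

theorem ballC_ne_top : ballC ≠ ∞ := by
  unfold ballC
  have h0 : volume (Metric.ball (0 : R3) 1) ≠ 0 := (Metric.measure_ball_pos _ _ one_pos).ne'
  have h1 : volume (Metric.ball (0 : R3) 1) ≠ ∞ := measure_ball_lt_top.ne
  exact ENNReal.mul_ne_top (ENNReal.inv_ne_top.mpr h0)
    (ENNReal.mul_ne_top (ENNReal.rpow_ne_top_of_nonneg (by norm_num) h1) (by norm_num))

/-- Morrey's inequality in the form `‖f‖_∞ ≲ ‖f‖_4 + ‖∇f‖_4`. -/
theorem enorm_le_of_contDiff {f : R3 → ℂ} (hf : ContDiff ℝ 1 f) (x : R3) :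
    ‖f x‖ₑ ≤ ballC * (eLpNorm f 4 volume + eLpNorm (fderiv ℝ f) 4 volume) := by
  set B : Set R3 := Metric.ball (0 : R3) 1
  set V := volume B
  have h0 : V ≠ 0 := (Metric.measure_ball_pos _ _ one_pos).ne'
  have h1 : V ≠ ∞ := measure_ball_lt_top.ne
  have hfc : Measurable fun y => ‖f y‖ₑ := hf.continuous.enorm.measurable
  have hdc : Measurable fun y => ‖fderiv ℝ f y‖ₑ :=
    (hf.continuous_fderiv one_ne_zero).enorm.measurable
  -- The fundamental theorem of calculus on the segment from `x` to `x + y` is averaged over `y` in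
  -- the unit ball.
  have hI : V * ‖f x‖ₑ ≤ (∫⁻ y in B, ‖f (x + y)‖ₑ) +
      ∫⁻ y in B, ∫⁻ s in Ioc (0 : ℝ) 1, ‖fderiv ℝ f (x + s • y)‖ₑ := by
    have hfx : Measurable fun y => ‖f (x + y)‖ₑ :=
      (hf.continuous.comp (continuous_const.add continuous_id)).enorm.measurable
    rw [← lintegral_add_left hfx]
    have : V * ‖f x‖ₑ = ∫⁻ _ in B, ‖f x‖ₑ := by
      rw [setLIntegral_const, mul_comm]
    rw [this]
    refine setLIntegral_mono' measurableSet_ball fun y hy => ?_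
    refine (enorm_le_add_lintegral_fderiv hf x y).trans ?_
    gcongr with s
    have hy1 : ‖y‖ₑ ≤ 1 := by
      rw [← ofReal_norm, ENNReal.ofReal_le_one]
      exact (mem_ball_zero_iff.mp hy).le
    exact mul_le_of_le_one_right' hy1
  have hA : ∫⁻ y in B, ‖f (x + y)‖ₑ ≤ V ^ (3 / 4 : ℝ) * 4 * eLpNorm f 4 volume := by
    have := lintegral_ball_comp_smul_le hfc x one_pos
    simp only [one_smul, Real.one_rpow, ENNReal.ofReal_one, mul_one] at this
    rw [eLpNorm_enorm] at this
    refine this.trans ?_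
    rw [mul_comm]
    gcongr
    exact le_mul_of_one_le_right' (by norm_num)
  have hD : ∫⁻ y in B, ∫⁻ s in Ioc (0 : ℝ) 1, ‖fderiv ℝ f (x + s • y)‖ₑ ≤
      V ^ (3 / 4 : ℝ) * 4 * eLpNorm (fderiv ℝ f) 4 volume := by
    have hj : Continuous fun p : R3 × ℝ => ‖fderiv ℝ f (x + p.2 • p.1)‖ₑ := by
      have := hf.continuous_fderiv one_ne_zero
      fun_prop
    rw [lintegral_lintegral_swap hj.measurable.aemeasurable]
    have : ∫⁻ s in Ioc (0 : ℝ) 1, ∫⁻ y in B, ‖fderiv ℝ f (x + s • y)‖ₑ ≤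
        ∫⁻ s in Ioc (0 : ℝ) 1, (eLpNorm (fderiv ℝ f) 4 volume * V ^ (3 / 4 : ℝ)) *
          ENNReal.ofReal (s ^ (-(3 / 4) : ℝ)) := by
      refine setLIntegral_mono' measurableSet_Ioc fun s hs => ?_
      refine (lintegral_ball_comp_smul_le hdc x hs.1).trans_eq ?_
      rw [eLpNorm_enorm]
      ring
    refine this.trans_eq ?_
    rw [lintegral_const_mul _ (by fun_prop), lintegral_rpow_neg_three_quarters]
    rw [ENNReal.ofReal_ofNat]
    ring
  calc ‖f x‖ₑ = V⁻¹ * (V * ‖f x‖ₑ) := by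
        rw [← mul_assoc, ENNReal.inv_mul_cancel h0 h1, one_mul]
    _ ≤ V⁻¹ * (V ^ (3 / 4 : ℝ) * 4 * eLpNorm f 4 volume +
          V ^ (3 / 4 : ℝ) * 4 * eLpNorm (fderiv ℝ f) 4 volume) := by
        gcongr
        exact hI.trans (add_le_add hA hD)
    _ = _ := by unfold ballC; ring

open scoped Convolution

/-- Mollification does not increase the `L⁴` norm. -/
theorem eLpNorm_convolution_normed_le (φ : ContDiffBump (0 : R3)) {g : R3 → ℂ}
    (hg : AEStronglyMeasurable g volume) :
    eLpNorm ((φ.normed volume) ⋆[ContinuousLinearMap.lsmul ℝ ℝ, volume] g) 4 volume ≤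
      eLpNorm g 4 volume := by
  wlog hgm : StronglyMeasurable g generalizing g
  · have h1 := this hg.stronglyMeasurable_mk.aestronglyMeasurable hg.stronglyMeasurable_mk
    have h2 : ((φ.normed volume) ⋆[ContinuousLinearMap.lsmul ℝ ℝ, volume] g) =
        ((φ.normed volume) ⋆[ContinuousLinearMap.lsmul ℝ ℝ, volume] hg.mk g) :=
      convolution_congr _ (ae_eq_refl _) hg.ae_eq_mk
    rw [h2, eLpNorm_congr_ae hg.ae_eq_mk]
    exact h1
  set ψ : R3 → ℝ≥0∞ := fun y => ENNReal.ofReal (φ.normed volume y)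
  have hψ : Measurable ψ := by
    have := (φ.contDiff_normed (μ := (volume : Measure R3)) (n := 0)).continuous
    exact (ENNReal.continuous_ofReal.comp this).measurable
  have hψ1 : ∫⁻ y, ψ y = 1 := by
    rw [← ofReal_integral_eq_lintegral_ofReal φ.integrable_normed
      (Eventually.of_forall fun y => φ.nonneg_normed y), φ.integral_normed, ENNReal.ofReal_one]
  -- With the mollifier as density of a probability measure, Jensen's inequality becomes
  -- monotonicity of `L^p` norms in `p`; Tonelli and translation invariance finish the proof.
  let ν : Measure R3 := volume.withDensity ψ
  have hν : IsProbabilityMeasure ν := ⟨by rw [withDensity_apply _ .univ, setLIntegral_univ, hψ1]⟩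
  have hgm' : Measurable fun y => ‖g y‖ₑ := hgm.enorm
  have hpt : ∀ x, ‖((φ.normed volume) ⋆[ContinuousLinearMap.lsmul ℝ ℝ, volume] g) x‖ₑ ^ 4 ≤
      ∫⁻ y, ψ y * ‖g (x - y)‖ₑ ^ 4 := by
    intro x
    have hm : Measurable fun y => ‖g (x - y)‖ₑ := by fun_prop
    have h1 : ‖((φ.normed volume) ⋆[ContinuousLinearMap.lsmul ℝ ℝ, volume] g) x‖ₑ ≤
        ∫⁻ y, ‖g (x - y)‖ₑ ∂ν := by
      rw [convolution_def]
      refine (enorm_integral_le_lintegral_enorm _).trans_eq ?_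
      rw [lintegral_withDensity_eq_lintegral_mul _ hψ hm]
      refine lintegral_congr fun y => ?_
      rw [ContinuousLinearMap.lsmul_apply, enorm_smul, Pi.mul_apply,
        Real.enorm_eq_ofReal (φ.nonneg_normed y)]
    have h2 := eLpNorm_le_eLpNorm_of_exponent_le (μ := ν) (p := 1) (q := 4) (by norm_num)
      hm.aestronglyMeasurable
    rw [eLpNorm_one_eq_lintegral_enorm] at h2
    simp only [enorm_eq_self] at h2
    have e2 := eLpNorm_nnreal_pow_eq_lintegral (μ := ν)
      (f := fun y => ‖g (x - y)‖ₑ) (p := 4) (by norm_num)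
    have e4 : ((4 : NNReal) : ℝ≥0∞) = 4 := by norm_num
    simp only [e4, NNReal.coe_ofNat, ENNReal.rpow_ofNat, enorm_eq_self] at e2
    refine (pow_le_pow_left₀ (by positivity) (h1.trans h2) 4).trans_eq ?_
    rw [e2, lintegral_withDensity_eq_lintegral_mul _ hψ (hm.pow_const 4)]
    rfl
  have e1 := lintegral_pow_of_eLpNorm
    ((φ.normed volume) ⋆[ContinuousLinearMap.lsmul ℝ ℝ, volume] g) 4 (by norm_num)
  have e2 := lintegral_pow_of_eLpNorm g 4 (by norm_num)
  norm_num only [Nat.cast_ofNat] at e1 e2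
  rw [← ENNReal.pow_le_pow_left_iff (n := 4) (by norm_num), ← e1, ← e2]
  refine (lintegral_mono hpt).trans_eq ?_
  have hjm : Measurable (Function.uncurry fun x y : R3 => ψ y * ‖g (x - y)‖ₑ ^ 4) := by
    have : Measurable fun p : R3 × R3 => ψ p.2 := hψ.comp measurable_snd
    have h3 : Measurable fun p : R3 × R3 => ‖g (p.1 - p.2)‖ₑ :=
      hgm'.comp (measurable_fst.sub measurable_snd)
    exact this.mul (h3.pow_const 4)
  rw [lintegral_lintegral_swap hjm.aemeasurable]
  have e3 : ∀ y, ∫⁻ x, ψ y * ‖g (x - y)‖ₑ ^ 4 = ψ y * ∫⁻ x, ‖g x‖ₑ ^ 4 := by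
    intro y
    rw [lintegral_const_mul _ (by fun_prop)]
    congr 1
    exact lintegral_sub_right_eq_self (fun x => ‖g x‖ₑ ^ 4) y
  simp_rw [e3]
  rw [lintegral_mul_const _ hψ, hψ1, one_mul]

/-- The `L⁴` difference quotient of `⟨D⟩⁻¹ k` in the direction `e_j`. -/
def dq4 (j : Fin 3) (n : ℕ) (k : L2) : ℝ≥0∞ :=
  ENNReal.ofReal (((n : ℝ) + 1) * n4 (opT (step j n) k - k))

theorem step_eq_smul (j : Fin 3) (n : ℕ) :
    step j n = (1 / ((n : ℝ) + 1)) • (EuclideanSpace.single j 1 : R3) := by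
  ext i
  simp [step]

/-- A difference quotient of the mollified function is the mollification of the difference quotient,
whose `L⁴` norm is no larger. Fatou passes to the derivative, uniformly in the mollifier. -/
theorem eLpNorm_fderiv_convolution_le (φ : ContDiffBump (0 : R3)) (k : L2) (j : Fin 3) :
    eLpNorm (fun x => fderiv ℝ ((φ.normed volume) ⋆[ContinuousLinearMap.lsmul ℝ ℝ, volume]
      (opB k : R3 → ℂ)) x (EuclideanSpace.single j 1)) 4 volume ≤
      liminf (fun n => dq4 j n k) atTop := by
  set F := (φ.normed volume) ⋆[ContinuousLinearMap.lsmul ℝ ℝ, volume] (opB k : R3 → ℂ)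
  have hloc : LocallyIntegrable (opB k : R3 → ℂ) volume :=
    (Lp.memLp (opB k)).locallyIntegrable (by norm_num)
  have hF : ContDiff ℝ 1 F := φ.hasCompactSupport_normed.contDiff_convolution_left _
    (n := 1) φ.contDiff_normed hloc
  have hex : ∀ (g : R3 → ℂ), LocallyIntegrable g volume → ConvolutionExists (φ.normed volume) g
      (ContinuousLinearMap.lsmul ℝ ℝ) volume := fun g hg =>
    φ.hasCompactSupport_normed.convolutionExists_left _
      (φ.contDiff_normed (n := 0)).continuous hg
  have hdiff : ∀ n x, F (x + step j n) - F x = ((φ.normed volume)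
      ⋆[ContinuousLinearMap.lsmul ℝ ℝ, volume] fun z => opB k (z + step j n) - opB k z) x := by
    intro n x
    have hl2 : LocallyIntegrable (fun z => opB k (z + step j n)) volume := by
      have h1 : LocallyIntegrable (opT (step j n) (opB k) : R3 → ℂ) volume :=
        (Lp.memLp _).locallyIntegrable (by norm_num)
      exact h1.congr (coeFn_opT _ _)
    have i1 := hex _ hl2 x
    have i2 := hex _ hloc x
    change (∫ t, _) - (∫ t, _) = ∫ t, _
    have e : ∀ t, x + step j n - t = x - t + step j n := fun t => by abel
    simp only [e]
    rw [← integral_sub i1 i2]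
    refine integral_congr_ae (Eventually.of_forall fun t => ?_)
    simp only [ContinuousLinearMap.lsmul_apply, smul_sub]
  have hle : ∀ n : ℕ, eLpNorm (fun x => ((n : ℝ) + 1) • (F (x + step j n) - F x)) 4 volume ≤
      dq4 j n k := by
    intro n
    have e1 : (fun x => ((n : ℝ) + 1) • (F (x + step j n) - F x)) = ((n : ℝ) + 1) •
      ((φ.normed volume) ⋆[ContinuousLinearMap.lsmul ℝ ℝ, volume]
        fun z => opB k (z + step j n) - opB k z) := by
      ext x
      rw [hdiff]
      rfl
    have e2 : (fun z => opB k (z + step j n) - opB k z) =ᵐ[volume]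
        (opB (opT (step j n) k - k) : R3 → ℂ) := by
      rw [map_sub, ← opT_opB]
      filter_upwards [Lp.coeFn_sub (opT (step j n) (opB k)) (opB k),
        coeFn_opT (step j n) (opB k)] with z h1 h2
      rw [h1, Pi.sub_apply, h2]
    rw [e1, eLpNorm_const_smul, dq4, ENNReal.ofReal_mul (by positivity), ofReal_n4,
      Real.enorm_eq_ofReal (by positivity), ← eLpNorm_congr_ae e2]
    gcongr
    exact eLpNorm_convolution_normed_le φ ((Lp.aestronglyMeasurable _).congr e2.symm)
  refine (Lp.eLpNorm_lim_le_liminf_eLpNorm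
    (f := fun (n : ℕ) x => ((n : ℝ) + 1) • (F (x + step j n) - F x)) (fun n => ?_) _
    (Eventually.of_forall fun x => ?_)).trans (liminf_le_liminf (Eventually.of_forall hle))
  · have := hF.continuous
    exact Continuous.aestronglyMeasurable (by fun_prop)
  · have hd : HasDerivAt (fun s : ℝ => F (x + s • (EuclideanSpace.single j 1 : R3)))
        (fderiv ℝ F x (EuclideanSpace.single j 1)) 0 := by
      have h1 : HasDerivAt (fun s : ℝ => x + s • (EuclideanSpace.single j 1 : R3))
          (EuclideanSpace.single j 1) 0 := by
        simpa using ((hasDerivAt_id (0 : ℝ)).smul_const (EuclideanSpace.single j 1 : R3)).const_add x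
      have h2 : HasFDerivAt F (fderiv ℝ F x) (x + (0 : ℝ) • (EuclideanSpace.single j 1 : R3)) := by
        simpa using (hF.differentiable one_ne_zero x).hasFDerivAt
      exact h2.comp_hasDerivAt (0 : ℝ) h1
    have hn : Tendsto (fun n : ℕ => 1 / ((n : ℝ) + 1)) atTop (𝓝[≠] 0) := by
      rw [tendsto_nhdsWithin_iff]
      exact ⟨tendsto_one_div_add_atTop_nhds_zero_nat,
        Eventually.of_forall fun n => by simp only [mem_compl_iff, mem_singleton_iff]; positivity⟩
    refine (hd.tendsto_slope_zero.comp hn).congr fun n => ?_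
    simp only [Function.comp_apply, zero_add, zero_smul, add_zero]
    rw [← step_eq_smul, one_div, inv_inv]

/-- `‖⟨D⟩⁻¹ k‖_∞` is controlled by the `L⁴` norm and the `L⁴` difference quotients. -/
theorem eLpNorm_top_le (k : L2) :
    eLpNorm (opB k) ∞ volume ≤
      ballC * (ENNReal.ofReal (n4 k) + ∑ j, liminf (fun n => dq4 j n k) atTop) := by
  let φ : ℕ → ContDiffBump (0 : R3) := fun m =>
    ⟨1 / ((m : ℝ) + 1), 2 * (1 / ((m : ℝ) + 1)), by positivity, by
      have : (0 : ℝ) < 1 / ((m : ℝ) + 1) := by positivity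
      linarith⟩
  have hloc : LocallyIntegrable (opB k : R3 → ℂ) volume :=
    (Lp.memLp (opB k)).locallyIntegrable (by norm_num)
  -- Lebesgue differentiation: as the radii shrink, with outer radius at most twice the inner one,
  -- the mollifications converge almost everywhere, so uniform pointwise bounds for them bound the
  -- essential supremum.
  have hae := ContDiffBump.ae_convolution_tendsto_right_of_locallyIntegrable
    (μ := (volume : Measure R3)) (φ := φ) (l := atTop) (K := 2) (by
      have := (tendsto_one_div_add_atTop_nhds_zero_nat (𝕜 := ℝ)).const_mul 2
      simpa [φ] using this) (Eventually.of_forall fun m => le_rfl) hloc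
  rw [eLpNorm_exponent_top]
  refine eLpNormEssSup_le_of_ae_enorm_bound ?_
  filter_upwards [hae] with x hx
  refine le_of_tendsto' hx.enorm fun m => ?_
  have hF : ContDiff ℝ 1 (((φ m).normed volume) ⋆[ContinuousLinearMap.lsmul ℝ ℝ, volume]
      (opB k : R3 → ℂ)) := (φ m).hasCompactSupport_normed.contDiff_convolution_left _
    (n := 1) (φ m).contDiff_normed hloc
  refine (enorm_le_of_contDiff hF x).trans ?_
  gcongr
  · rw [ofReal_n4]
    exact eLpNorm_convolution_normed_le _ (Lp.aestronglyMeasurable _)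
  · refine (eLpNorm_mono (g := fun x => ∑ j : Fin 3, ‖fderiv ℝ (((φ m).normed volume)
      ⋆[ContinuousLinearMap.lsmul ℝ ℝ, volume] (opB k : R3 → ℂ)) x
      (EuclideanSpace.single j 1)‖) fun x => ?_).trans ?_
    · rw [Real.norm_eq_abs, abs_of_nonneg (Finset.sum_nonneg fun _ _ => norm_nonneg _)]
      exact norm_fderiv_le_sum _ x
    · have h2 := eLpNorm_sum_le (p := 4) (μ := (volume : Measure R3)) (s := Finset.univ)
        (f := fun (j : Fin 3) (x : R3) => ‖fderiv ℝ (((φ m).normed volume)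
          ⋆[ContinuousLinearMap.lsmul ℝ ℝ, volume] (opB k : R3 → ℂ)) x
          (EuclideanSpace.single j 1)‖)
        (fun j _ => (((hF.continuous_fderiv one_ne_zero).clm_apply
          continuous_const).norm.aestronglyMeasurable)) (by norm_num)
      rw [Finset.sum_fn] at h2
      refine h2.trans (Finset.sum_le_sum fun j _ => ?_)
      rw [eLpNorm_norm]
      exact eLpNorm_fderiv_convolution_le (φ m) k j

/-! ### The dispersive estimate -/

/-- The Gaussian symbol `exp(-ε|ξ|²)`. -/
def symG (n : ℕ) : R3 →ᵇ ℂ :=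
  BoundedContinuousFunction.ofNormedAddCommGroup
    (fun ξ => ((Real.exp (-(1 / ((n : ℝ) + 1)) * ‖ξ‖ ^ 2) : ℝ) : ℂ)) (by fun_prop) 1 (fun ξ => by
      rw [Complex.norm_real, Real.norm_eq_abs, Real.abs_exp, Real.exp_le_one_iff]
      have : (0 : ℝ) < 1 / ((n : ℝ) + 1) := by positivity
      nlinarith [sq_nonneg ‖ξ‖])

theorem symG_apply (n : ℕ) (ξ : R3) :
    symG n ξ = ((Real.exp (-(1 / ((n : ℝ) + 1)) * ‖ξ‖ ^ 2) : ℝ) : ℂ) := rfl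

theorem norm_symG_le (n : ℕ) (ξ : R3) : ‖symG n ξ‖ ≤ 1 := by
  rw [symG_apply, Complex.norm_real, Real.norm_eq_abs, Real.abs_exp, Real.exp_le_one_iff]
  have : (0 : ℝ) < 1 / ((n : ℝ) + 1) := by positivity
  nlinarith [sq_nonneg ‖ξ‖]

/-- The complex Gaussian parameter of the regularized propagator. -/
def gaussB (n : ℕ) (t : ℝ) : ℂ := ⟨1 / ((n : ℝ) + 1), 4 * Real.pi ^ 2 * t⟩

theorem gaussB_re_pos (n : ℕ) (t : ℝ) : 0 < (gaussB n t).re := by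
  change (0 : ℝ) < 1 / ((n : ℝ) + 1)
  positivity

theorem symGU_apply (n : ℕ) (t : ℝ) (ξ : R3) :
    (symG n * symU t) ξ = Complex.exp (-(gaussB n t) * ‖ξ‖ ^ 2) := by
  rw [BoundedContinuousFunction.mul_apply, symG_apply, symU_apply, freeSymbol, Complex.ofReal_exp,
    ← Complex.exp_add]
  congr 1
  have : gaussB n t = ((1 / ((n : ℝ) + 1) : ℝ) : ℂ) + ((4 * Real.pi ^ 2 * t : ℝ) : ℂ) * Complex.I := by
    rw [gaussB]
    exact Complex.mk_eq_add_mul_I _ _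
  rw [this]
  push_cast
  ring

/-- The transform of a complex Gaussian is explicit, and its exponential has modulus at most `1`
because `Re(1/b) > 0`. -/
theorem norm_fourier_gaussian_le {b : ℂ} (hb : 0 < b.re) (x w : R3) :
    ‖(𝓕 (fun v : R3 => Complex.exp (-b * ‖v‖ ^ 2 + 2 * Real.pi * Complex.I * inner ℝ x v)) : R3 → ℂ) w‖ ≤
      (Real.pi / ‖b‖) ^ (3 / 2 : ℝ) := by
  rw [fourier_gaussian_innerProductSpace' hb, norm_mul, finrank_euclideanSpace_fin]
  have e : ((3 : ℕ) / 2 : ℂ) = ((3 / 2 : ℝ) : ℂ) := by push_cast; ring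
  rw [e, Complex.norm_cpow_real, norm_div, Complex.norm_real, Real.norm_eq_abs,
    abs_of_pos Real.pi_pos]
  refine mul_le_of_le_one_right (by positivity) ?_
  rw [Complex.norm_exp, Real.exp_le_one_iff]
  have e2 : (-(Real.pi : ℂ) ^ 2 * (‖x - w‖ : ℂ) ^ 2 / b) =
      ((-(Real.pi ^ 2 * ‖x - w‖ ^ 2) : ℝ) : ℂ) * b⁻¹ := by
    push_cast; ring
  rw [e2, Complex.re_ofReal_mul, Complex.inv_re]
  have h1 : 0 ≤ b.re / Complex.normSq b := div_nonneg hb.le (Complex.normSq_nonneg b)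
  have h2 : 0 ≤ Real.pi ^ 2 * ‖x - w‖ ^ 2 := by positivity
  nlinarith [mul_nonneg h2 h1]

theorem integrable_gaussian {b : ℂ} (hb : 0 < b.re) :
    Integrable fun v : R3 => Complex.exp (-b * ‖v‖ ^ 2) := by
  simpa using GaussianFourier.integrable_cexp_neg_mul_sq_norm_add (V := R3) hb 0 0

theorem integrable_mul_fourier {m : R3 → ℂ} (hm : Integrable m) {g : R3 → ℂ} (hg : Integrable g) :
    Integrable fun ξ => m ξ * (𝓕 g : R3 → ℂ) ξ :=
  hm.mul_bdd (c := ∫ v, ‖g v‖) (continuous_fourier_of_integrable hg).aestronglyMeasurable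
    (Eventually.of_forall fun _ =>
      VectorFourier.norm_fourierIntegral_le_integral_norm _ _ _ _ _)

theorem norm_integral_fourier_mul_gaussian_le {b : ℂ} (hb : 0 < b.re) {g : R3 → ℂ}
    (hg : Integrable g) (x : R3) :
    ‖∫ ξ, (𝓕 g : R3 → ℂ) ξ *
      Complex.exp (-b * ‖ξ‖ ^ 2 + 2 * Real.pi * Complex.I * inner ℝ x ξ)‖ ≤
      (Real.pi / ‖b‖) ^ (3 / 2 : ℝ) * ∫ y, ‖g y‖ := by
  set ψ : R3 → ℂ := fun ξ => Complex.exp (-b * ‖ξ‖ ^ 2 + 2 * Real.pi * Complex.I * inner ℝ x ξ)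
  have hψ : Integrable ψ := GaussianFourier.integrable_cexp_neg_mul_sq_norm_add (V := R3) hb _ x
  have h1 := VectorFourier.integral_fourierIntegral_smul_eq_flip (μ := (volume : Measure R3))
      (ν := (volume : Measure R3)) (L := innerₗ R3) (f := g) (g := ψ)
      Real.continuous_fourierChar (by exact continuous_inner) hg hψ
  rw [flip_innerₗ] at h1
  have h2 : (∫ ξ, (𝓕 g : R3 → ℂ) ξ * ψ ξ) = ∫ y, g y * (𝓕 ψ : R3 → ℂ) y := h1
  rw [h2]
  refine (norm_integral_le_integral_norm _).trans ?_
  rw [← integral_const_mul]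
  refine integral_mono_of_nonneg (Eventually.of_forall fun _ => norm_nonneg _)
    (hg.norm.const_mul _) (Eventually.of_forall fun y => ?_)
  simp only [norm_mul]
  rw [mul_comm]
  exact mul_le_mul_of_nonneg_right (norm_fourier_gaussian_le hb x y) (norm_nonneg _)

/-- The factor `exp(-|ξ|²/(n+1))` makes the propagator's symbol the integrable Gaussian
`exp(-b|ξ|²)`, so all Fourier integrals converge absolutely. The resulting bound does not depend on
`n`. -/
theorem norm_inner_regularized_le (n : ℕ) {t : ℝ} (ht : t ≠ 0) {f g : L2} (hf : Integrable f)
    (hg : Integrable g) :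
    ‖(inner ℂ g (fmul (symG n * symU t) f) : ℂ)‖ ≤
      |t| ^ (-(3 / 2) : ℝ) * (∫ x, ‖f x‖) * ∫ x, ‖g x‖ := by
  set b := gaussB n t
  have hb : 0 < b.re := gaussB_re_pos n t
  set Φ : R3 → ℂ := fun ξ => Complex.exp (-b * ‖ξ‖ ^ 2) * starRingEnd ℂ ((𝓕 (g : R3 → ℂ) : R3 → ℂ) ξ)
  have hΦ : Integrable Φ := by
    have h1 := integrable_mul_fourier (m := fun ξ => starRingEnd ℂ (Complex.exp (-b * ‖ξ‖ ^ 2)))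
      ((LinearIsometryEquiv.integrable_comp_iff Complex.conjLIE).mpr (integrable_gaussian hb)) hg
    have h2 := (LinearIsometryEquiv.integrable_comp_iff Complex.conjLIE).mpr h1
    refine h2.congr (Eventually.of_forall fun ξ => ?_)
    simp only [Complex.conjLIE_apply, map_mul, Complex.conj_conj, Φ]
  have e1 : (inner ℂ g (fmul (symG n * symU t) f) : ℂ) =
      ∫ ξ, (𝓕 (f : R3 → ℂ) : R3 → ℂ) ξ * Φ ξ := by
    rw [← Lp.inner_fourier_eq, L2.inner_def]
    apply integral_congr_ae
    filter_upwards [coeFn_fourier_fmul (symG n * symU t) f, fourier_ae_of_integrable hf,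
      fourier_ae_of_integrable hg] with ξ h1 h2 h3
    rw [h1, h2, h3, RCLike.inner_apply, symGU_apply]
    simp only [Φ]
    ring
  have h1 := VectorFourier.integral_fourierIntegral_smul_eq_flip (μ := (volume : Measure R3))
      (ν := (volume : Measure R3)) (L := innerₗ R3) (f := (f : R3 → ℂ)) (g := Φ)
      Real.continuous_fourierChar (by exact continuous_inner) hf hΦ
  rw [flip_innerₗ] at h1
  have h2 : (∫ ξ, (𝓕 (f : R3 → ℂ) : R3 → ℂ) ξ * Φ ξ) = ∫ x, f x * (𝓕 Φ : R3 → ℂ) x := h1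
  -- Here `|b| ≥ |Im b| = 4π²|t|` and `π ≤ 4π²`, so the constant in the dispersive estimate can be
  -- taken to be `1`.
  have hbn : (Real.pi / ‖b‖) ^ (3 / 2 : ℝ) ≤ |t| ^ (-(3 / 2) : ℝ) := by
    have ht0 : 0 < |t| := abs_pos.mpr ht
    have hb1 : 4 * Real.pi ^ 2 * |t| ≤ ‖b‖ := by
      refine le_trans (le_of_eq ?_) (Complex.abs_im_le_norm b)
      change _ = |4 * Real.pi ^ 2 * t|
      rw [abs_mul, abs_of_pos (show (0 : ℝ) < 4 * Real.pi ^ 2 by positivity)]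
    rw [Real.rpow_neg ht0.le, ← Real.inv_rpow ht0.le]
    apply Real.rpow_le_rpow (by positivity) _ (by norm_num)
    rw [div_le_iff₀ (lt_of_lt_of_le (by positivity) hb1)]
    calc Real.pi ≤ |t|⁻¹ * (4 * Real.pi ^ 2 * |t|) := by
          rw [show |t|⁻¹ * (4 * Real.pi ^ 2 * |t|) = 4 * Real.pi ^ 2 * (|t|⁻¹ * |t|) by ring,
            inv_mul_cancel₀ ht0.ne']
          nlinarith [Real.pi_gt_three]
      _ ≤ _ := by gcongr
  -- The inner product conjugates the transform of `g`, so `𝓕Φ` is the conjugate of a Gaussian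
  -- integral for `g` with parameter `b̄`.
  have h3 : ∀ x, ‖(𝓕 Φ : R3 → ℂ) x‖ ≤ |t| ^ (-(3 / 2) : ℝ) * ∫ y, ‖g y‖ := by
    intro x
    have hb' : 0 < (starRingEnd ℂ b).re := by simpa using hb
    have h4 := norm_integral_fourier_mul_gaussian_le hb' hg x
    rw [← RCLike.norm_conj (K := ℂ), ← integral_conj] at h4
    rw [RCLike.norm_conj] at h4
    have e3 : (𝓕 Φ : R3 → ℂ) x = ∫ ξ, (starRingEnd ℂ) ((𝓕 (g : R3 → ℂ) : R3 → ℂ) ξ *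
        Complex.exp (-(starRingEnd ℂ b) * ‖ξ‖ ^ 2 + 2 * Real.pi * Complex.I * inner ℝ x ξ)) := by
      rw [Real.fourier_eq']
      congr 1
      ext ξ
      simp only [Φ, map_mul, ← Complex.exp_conj, smul_eq_mul]
      rw [mul_comm ((starRingEnd ℂ) _), ← mul_assoc, ← Complex.exp_add]
      congr 2
      simp only [map_add, map_mul, map_neg, Complex.conj_conj, map_pow, Complex.conj_ofReal,
        Complex.conj_I, map_ofNat, real_inner_comm x ξ]
      push_cast
      ring
    rw [e3]
    refine h4.trans ?_
    exact mul_le_mul_of_nonneg_right hbn (integral_nonneg fun _ => norm_nonneg _)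
  rw [e1, h2]
  refine (norm_integral_le_integral_norm _).trans ?_
  calc ∫ x, ‖f x * (𝓕 Φ : R3 → ℂ) x‖ ≤ ∫ x, ‖f x‖ * (|t| ^ (-(3 / 2) : ℝ) * ∫ y, ‖g y‖) := by
        refine integral_mono_of_nonneg (Eventually.of_forall fun _ => norm_nonneg _)
          (hf.norm.mul_const _) (Eventually.of_forall fun y => ?_)
        simp only [norm_mul]
        exact mul_le_mul_of_nonneg_left (h3 y) (norm_nonneg _)
    _ = _ := by rw [integral_mul_const]; ring

/-- The dispersive estimate `L¹ → L^∞`, tested against `L¹` functions. -/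
theorem norm_inner_opU_le_L1 {t : ℝ} (ht : t ≠ 0) {f g : L2} (hf : Integrable f)
    (hg : Integrable g) :
    ‖(inner ℂ g (opU t f) : ℂ)‖ ≤ |t| ^ (-(3 / 2) : ℝ) * (∫ x, ‖f x‖) * ∫ x, ‖g x‖ := by
  have hlim : Tendsto (fun n => fmul (symG n * symU t) f) atTop (𝓝 (opU t f)) := by
    refine tendsto_fmul (C := 1) (fun n ξ => ?_) (fun ξ => ?_) f
    · rw [BoundedContinuousFunction.mul_apply, norm_mul, norm_symU, mul_one]
      exact norm_symG_le n ξ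
    · simp only [BoundedContinuousFunction.mul_apply]
      have h0 : Tendsto (fun n : ℕ => -(1 / ((n : ℝ) + 1)) * ‖ξ‖ ^ 2) atTop (𝓝 0) := by
        have := (tendsto_one_div_add_atTop_nhds_zero_nat (𝕜 := ℝ)).neg.mul_const (‖ξ‖ ^ 2)
        simpa using this
      have h1 : Tendsto (fun n => symG n ξ) atTop (𝓝 1) := by
        have := (Complex.continuous_ofReal.tendsto _).comp ((Real.continuous_exp.tendsto 0).comp h0)
        simpa [symG_apply, Function.comp_def] using this
      simpa using h1.mul_const (symU t ξ)
  have h2 : Tendsto (fun n => ‖(inner ℂ g (fmul (symG n * symU t) f) : ℂ)‖) atTop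
      (𝓝 ‖(inner ℂ g (opU t f) : ℂ)‖) := (tendsto_const_nhds.inner hlim).norm
  exact le_of_tendsto' h2 fun n => norm_inner_regularized_le n ht hf hg

/-! ### Interpolation between `L²` and `L¹` -/

/-- The analytic family used in the interpolation argument. -/
def interpCoeff (a z : ℂ) : ℂ :=
  if a = 0 then 0 else (a / ‖a‖) * (‖a‖ : ℂ) ^ ((2 / 3 : ℂ) * (1 + z))

theorem differentiable_interpCoeff (a : ℂ) : Differentiable ℂ (interpCoeff a) := by
  unfold interpCoeff
  by_cases ha : a = 0
  · simp [ha]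
  · simp only [ha, if_false]
    have : (‖a‖ : ℂ) ≠ 0 := by simpa using ha
    exact (differentiable_const _).mul
      (Differentiable.const_cpow (by fun_prop) (Or.inl this))

/-- The exponent `(2/3)(1 + z)` has real part `2/3` on `Re z = 0` and `4/3` on `Re z = 1`, and
equals `1` at `z = 1/2`. So a function in `L^{4/3}` is joined to `L²` and to `L¹` on the two
boundary lines. -/
theorem norm_interpCoeff (a z : ℂ) :
    ‖interpCoeff a z‖ = if a = 0 then 0 else ‖a‖ ^ ((2 / 3 : ℝ) * (1 + z.re)) := by
  unfold interpCoeff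
  split_ifs with ha
  · simp
  · have h : 0 < ‖a‖ := norm_pos_iff.mpr ha
    rw [norm_mul, norm_div, Complex.norm_real, norm_norm, div_self h.ne', one_mul,
      Complex.norm_cpow_eq_rpow_re_of_pos h]
    congr 1
    have : (2 / 3 : ℂ) = ((2 / 3 : ℝ) : ℂ) := by push_cast; ring
    rw [this, Complex.re_ofReal_mul]
    simp

theorem interpCoeff_half (a : ℂ) : interpCoeff a (1 / 2) = a := by
  unfold interpCoeff
  split_ifs with ha
  · exact ha.symm
  · have h : (‖a‖ : ℂ) ≠ 0 := by simpa using ha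
    have : (2 / 3 : ℂ) * (1 + 1 / 2) = 1 := by norm_num
    rw [this, Complex.cpow_one, div_mul_cancel₀ _ h]

theorem conj_interpCoeff (a z : ℂ) :
    starRingEnd ℂ (interpCoeff a z) = interpCoeff (starRingEnd ℂ a) (starRingEnd ℂ z) := by
  unfold interpCoeff
  by_cases ha : a = 0
  · simp [ha]
  · have ha' : starRingEnd ℂ a ≠ 0 := by simpa using ha
    have harg : (‖a‖ : ℂ).arg ≠ Real.pi := by
      rw [Complex.arg_ofReal_of_nonneg (norm_nonneg _)]
      exact Real.pi_pos.ne
    have e := Complex.cpow_conj (‖a‖ : ℂ) ((2 / 3 : ℂ) * (1 + z)) harg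
    rw [Complex.conj_ofReal] at e
    rw [if_neg ha, if_neg ha', map_mul, map_div₀, Complex.conj_ofReal, RCLike.norm_conj, ← e]
    simp [map_ofNat]

theorem norm_interpCoeff_le {a z : ℂ} (h0 : 0 ≤ z.re) (h1 : z.re ≤ 1) :
    ‖interpCoeff a z‖ ≤ (1 + ‖a‖) ^ (4 / 3 : ℝ) := by
  rw [norm_interpCoeff]
  split_ifs with ha
  · positivity
  · calc ‖a‖ ^ ((2 / 3 : ℝ) * (1 + z.re)) ≤ (1 + ‖a‖) ^ ((2 / 3 : ℝ) * (1 + z.re)) :=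
        Real.rpow_le_rpow (norm_nonneg _) (by linarith) (by linarith)
      _ ≤ _ := Real.rpow_le_rpow_of_exponent_le (by linarith [norm_nonneg a]) (by linarith)

/-- The indicator function of a level set of a simple function, in `L²`. -/
def levelInd (s : SimpleFunc R3 ℂ) (a : ℂ) : L2 :=
  if h : volume (s ⁻¹' {a}) ≠ ∞ then indicatorConstLp 2 (s.measurableSet_fiber a) h 1 else 0

/-- The analytic family through a simple function. -/
def interpFamily (s : SimpleFunc R3 ℂ) (z : ℂ) : L2 :=
  ∑ a ∈ s.range, interpCoeff a z • levelInd s a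

theorem coeFn_finset_sum {ι : Type*} (t : Finset ι) (f : ι → L2) :
    (∑ i ∈ t, f i : L2) =ᵐ[volume] fun x => ∑ i ∈ t, f i x := by
  classical
  induction t using Finset.induction_on with
  | empty =>
    filter_upwards [Lp.coeFn_zero ℂ 2 (volume : Measure R3)] with x _
    simp
  | insert a t ha ih =>
    rw [Finset.sum_insert ha]
    filter_upwards [Lp.coeFn_add (f a) (∑ i ∈ t, f i), ih] with x h1 h2
    rw [h1, Pi.add_apply, h2, Finset.sum_insert ha]

theorem coeFn_interpFamily {s : SimpleFunc R3 ℂ} (hs : MemLp s 2 volume) (z : ℂ) :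
    interpFamily s z =ᵐ[volume] fun x => interpCoeff (s x) z := by
  have hfin : ∀ a, a ≠ 0 → volume (s ⁻¹' {a}) ≠ ∞ := fun a ha =>
    ((SimpleFunc.memLp_iff (p := 2) (by norm_num) (by norm_num)).mp hs a ha).ne
  have h1 : ∀ a ∈ s.range, (interpCoeff a z • levelInd s a : L2) =ᵐ[volume]
      fun x => (s ⁻¹' {a}).indicator (fun _ => interpCoeff a z) x := by
    intro a _
    -- Only the level set of `0` can have infinite measure, where `levelInd` defaults to `0`; the
    -- coefficient vanishes there anyway.
    by_cases ha : a = 0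
    · have : interpCoeff a z = 0 := by simp [interpCoeff, ha]
      rw [this, zero_smul]
      filter_upwards [Lp.coeFn_zero ℂ 2 (volume : Measure R3)] with x hx
      rw [hx]
      simp
    · have h := hfin a ha
      filter_upwards [Lp.coeFn_smul (interpCoeff a z) (levelInd s a),
        indicatorConstLp_coeFn (p := 2) (hs := s.measurableSet_fiber a) (hμs := h) (c := (1 : ℂ))]
        with x h2 h3
      rw [h2, Pi.smul_apply, levelInd, dif_pos h, h3]
      by_cases hx : x ∈ s ⁻¹' {a}
      · simp [Set.indicator_of_mem hx]
      · simp [Set.indicator_of_notMem hx]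
  have h2 : ∀ᵐ x, ∀ a ∈ s.range, (interpCoeff a z • levelInd s a : L2) x =
      (s ⁻¹' {a}).indicator (fun _ => interpCoeff a z) x :=
    (Filter.eventually_all_finset s.range).mpr h1
  filter_upwards [coeFn_finset_sum s.range fun a => interpCoeff a z • levelInd s a, h2] with x hx hx2
  rw [interpFamily, hx, Finset.sum_congr rfl hx2]
  have e : ∀ a, (s ⁻¹' {a}).indicator (fun _ => interpCoeff a z) x =
      if s x = a then interpCoeff a z else 0 := fun a => by
    by_cases hx : s x = a
    · rw [if_pos hx, Set.indicator_of_mem (by exact hx)]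
    · rw [if_neg hx, Set.indicator_of_notMem (by exact hx)]
  simp_rw [e]
  rw [Finset.sum_ite_eq]
  simp

/-- The integral `∫ |s|^{4/3}`. -/
def int43 (s : R3 → ℂ) : ℝ := ∫ x, ‖s x‖ ^ (4 / 3 : ℝ)

theorem norm_interpFamily_sq {s : SimpleFunc R3 ℂ} (hs : MemLp s 2 volume) {z : ℂ}
    (hz : z.re = 0) : ‖interpFamily s z‖ ^ 2 = int43 s := by
  rw [← integral_norm_sq_eq, int43]
  apply integral_congr_ae
  filter_upwards [coeFn_interpFamily hs z] with x hx
  rw [hx, norm_interpCoeff, hz]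
  split_ifs with h
  · rw [h]
    simp
  · rw [← Real.rpow_natCast, ← Real.rpow_mul (norm_nonneg _)]
    norm_num

theorem norm_interpFamily_one {s : SimpleFunc R3 ℂ} (hs : MemLp s 2 volume) {z : ℂ}
    (hz : z.re = 1) : (fun x => ‖interpFamily s z x‖) =ᵐ[volume] fun x => ‖s x‖ ^ (4 / 3 : ℝ) := by
  filter_upwards [coeFn_interpFamily hs z] with x hx
  rw [hx, norm_interpCoeff, hz]
  split_ifs with h
  · rw [h]
    simp
  · norm_num

theorem integrable_int43 {s : SimpleFunc R3 ℂ} (hs : MemLp s 2 volume) :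
    Integrable fun x => ‖s x‖ ^ (4 / 3 : ℝ) := by
  have h1 : MemLp (s.map fun a => ‖a‖ ^ (4 / 3 : ℝ)) 1 volume := by
    rw [SimpleFunc.memLp_iff_finMeasSupp (by norm_num) (by norm_num)]
    exact ((SimpleFunc.memLp_iff_finMeasSupp (p := 2) (by norm_num) (by norm_num)).mp hs).map
      (by simp)
  exact memLp_one_iff_integrable.mp h1

/-- Riesz–Thorin at the midpoint: the three lines theorem is applied to the pairing of analytic
families, bounded by `L²` contractivity on one edge and by the `L¹` hypothesis on the other. -/
theorem interpolation_simpleFunc {T : L2 →L[ℂ] L2} (hT : ∀ f, ‖T f‖ ≤ ‖f‖) {A : ℝ} (hA : 0 ≤ A)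
    (h1 : ∀ f g : L2, Integrable f → Integrable g →
      ‖(inner ℂ g (T f) : ℂ)‖ ≤ A * (∫ x, ‖f x‖) * ∫ x, ‖g x‖)
    {s r : SimpleFunc R3 ℂ} (hs : MemLp s 2 volume) (hr : MemLp r 2 volume) :
    ‖(inner ℂ (hr.toLp r : L2) (T (hs.toLp s)) : ℂ)‖ ≤
      A ^ (1 / 2 : ℝ) * (int43 s ^ (3 / 4 : ℝ) * int43 r ^ (3 / 4 : ℝ)) := by
  have hs0 : 0 ≤ int43 s := integral_nonneg fun x => by positivity
  have hr0 : 0 ≤ int43 r := integral_nonneg fun x => by positivity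
  -- The inner product is conjugate linear on the left, so the family through `r` is evaluated at
  -- `z̄`; this keeps `F` entire.
  let F : ℂ → ℂ := fun z => ∑ b ∈ r.range, ∑ a ∈ s.range,
    interpCoeff (starRingEnd ℂ b) z * (interpCoeff a z * inner ℂ (levelInd r b) (T (levelInd s a)))
  have hF : ∀ z, F z = inner ℂ (interpFamily r (starRingEnd ℂ z)) (T (interpFamily s z)) := by
    intro z
    rw [interpFamily, sum_inner]
    refine Finset.sum_congr rfl fun b _ => ?_
    rw [interpFamily, map_sum, inner_sum]
    refine Finset.sum_congr rfl fun a _ => ?_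
    rw [map_smul, inner_smul_left, inner_smul_right, conj_interpCoeff, Complex.conj_conj]
  have hd : Differentiable ℂ F := by
    refine Differentiable.fun_sum fun b _ => Differentiable.fun_sum fun a _ => ?_
    exact (differentiable_interpCoeff _).mul ((differentiable_interpCoeff _).mul_const _)
  have hbdd : BddAbove ((norm ∘ F) '' Complex.HadamardThreeLines.verticalClosedStrip 0 1) := by
    refine ⟨∑ b ∈ r.range, ∑ a ∈ s.range, (1 + ‖starRingEnd ℂ b‖) ^ (4 / 3 : ℝ) *
      ((1 + ‖a‖) ^ (4 / 3 : ℝ) * ‖(inner ℂ (levelInd r b) (T (levelInd s a)) : ℂ)‖), ?_⟩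
    rintro _ ⟨z, hz, rfl⟩
    have hz' : 0 ≤ z.re ∧ z.re ≤ 1 := hz
    refine (norm_sum_le _ _).trans (Finset.sum_le_sum fun b _ => ?_)
    refine (norm_sum_le _ _).trans (Finset.sum_le_sum fun a _ => ?_)
    rw [norm_mul, norm_mul]
    gcongr
    · exact norm_interpCoeff_le hz'.1 hz'.2
    · exact norm_interpCoeff_le hz'.1 hz'.2
  have hz0 : ∀ z ∈ Complex.re ⁻¹' {(0 : ℝ)}, ‖F z‖ ≤ int43 s ^ (1 / 2 : ℝ) * int43 r ^ (1 / 2 : ℝ) := by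
    intro z hz
    have hz : z.re = 0 := hz
    rw [hF]
    refine (norm_inner_le_norm _ _).trans ?_
    have e1 : ‖interpFamily r (starRingEnd ℂ z)‖ = int43 r ^ (1 / 2 : ℝ) := by
      rw [← norm_interpFamily_sq hr (z := starRingEnd ℂ z) (by simpa using hz),
        ← Real.rpow_natCast, ← Real.rpow_mul (norm_nonneg _)]
      norm_num
    have e2 : ‖interpFamily s z‖ = int43 s ^ (1 / 2 : ℝ) := by
      rw [← norm_interpFamily_sq hs hz, ← Real.rpow_natCast, ← Real.rpow_mul (norm_nonneg _)]
      norm_num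
    rw [e1, mul_comm, ← e2]
    exact mul_le_mul_of_nonneg_right (hT _) (by positivity)
  have hz1 : ∀ z ∈ Complex.re ⁻¹' {(1 : ℝ)}, ‖F z‖ ≤ A * int43 s * int43 r := by
    intro z hz
    have hz : z.re = 1 := hz
    have hz' : (starRingEnd ℂ z).re = 1 := by simpa using hz
    have i1 : Integrable (interpFamily s z) := (integrable_norm_iff
      (Lp.aestronglyMeasurable _)).mp ((integrable_int43 hs).congr (norm_interpFamily_one hs hz).symm)
    have i2 : Integrable (interpFamily r (starRingEnd ℂ z)) := (integrable_norm_iff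
      (Lp.aestronglyMeasurable _)).mp ((integrable_int43 hr).congr (norm_interpFamily_one hr hz').symm)
    rw [hF]
    refine (h1 _ _ i1 i2).trans_eq ?_
    rw [integral_congr_ae (norm_interpFamily_one hs hz),
      integral_congr_ae (norm_interpFamily_one hr hz')]
    rfl
  have key := Complex.HadamardThreeLines.norm_le_interp_of_mem_verticalClosedStrip₀₁' F
    (z := (1 / 2 : ℂ)) (by simp [Complex.HadamardThreeLines.verticalClosedStrip]; norm_num)
    hd.diffContOnCl hbdd hz0 hz1
  have e1 : interpFamily s (1 / 2) = hs.toLp s := by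
    apply Lp.ext
    filter_upwards [coeFn_interpFamily hs (1 / 2), hs.coeFn_toLp] with x h2 h3
    rw [h2, h3, interpCoeff_half]
  have e2 : interpFamily r (starRingEnd ℂ (1 / 2)) = hr.toLp r := by
    have : starRingEnd ℂ (1 / 2 : ℂ) = 1 / 2 := by simp [map_ofNat]
    rw [this]
    apply Lp.ext
    filter_upwards [coeFn_interpFamily hr (1 / 2), hr.coeFn_toLp] with x h2 h3
    rw [h2, h3, interpCoeff_half]
  rw [hF, e1, e2] at key
  refine key.trans_eq ?_
  have hre : (1 / 2 : ℂ).re = 1 / 2 := by norm_num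
  rw [hre, mul_assoc A, Real.mul_rpow hA (by positivity), ← Real.mul_rpow hs0 hr0,
    ← Real.mul_rpow hs0 hr0, ← Real.rpow_mul (by positivity)]
  have hq : 0 ≤ int43 s * int43 r := mul_nonneg hs0 hr0
  -- The boundary powers `1/2` and `1` of `int43` average to `3/4`, which is the exponent of the
  -- `L^{4/3}` norm.
  rw [mul_left_comm, ← Real.rpow_add_of_nonneg hq (by norm_num) (by norm_num)]
  norm_num

theorem int43_rpow (s : SimpleFunc R3 ℂ) (hs : MemLp s 2 volume) :
    int43 s ^ (3 / 4 : ℝ) = (eLpNorm s (4 / 3) volume).toReal := by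
  have e : (4 / 3 : ℝ≥0∞).toReal = 4 / 3 := by norm_num
  have h43 : (4 / 3 : ℝ≥0∞) ≠ ∞ := ENNReal.div_ne_top (by norm_num) (by norm_num)
  rw [eLpNorm_eq_lintegral_rpow_enorm_toReal (by norm_num) h43, e, int43,
    integral_eq_lintegral_of_nonneg_ae (Eventually.of_forall fun x => by positivity)
      (integrable_int43 hs).1, ← ENNReal.toReal_rpow]
  norm_num only
  congr 2
  refine lintegral_congr fun x => ?_
  rw [← ofReal_norm, ENNReal.ofReal_rpow_of_nonneg (norm_nonneg _) (by norm_num)]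

/-- Interpolation at the midpoint between `L² → L²` and `L¹ → L^∞`. -/
theorem interpolation {T : L2 →L[ℂ] L2} (hT : ∀ f, ‖T f‖ ≤ ‖f‖) {A : ℝ} (hA : 0 ≤ A)
    (h1 : ∀ f g : L2, Integrable f → Integrable g →
      ‖(inner ℂ g (T f) : ℂ)‖ ≤ A * (∫ x, ‖f x‖) * ∫ x, ‖g x‖)
    {f g : L2} (hf : MemLp f (4 / 3) volume) (hg : MemLp g (4 / 3) volume) :
    ‖(inner ℂ g (T f) : ℂ)‖ ≤ A ^ (1 / 2 : ℝ) *
      ((eLpNorm f (4 / 3) volume).toReal * (eLpNorm g (4 / 3) volume).toReal) := by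
  have h43 : (4 / 3 : ℝ≥0∞) ≠ ∞ := ENNReal.div_ne_top (by norm_num) (by norm_num)
  have h143 : (1 : ℝ≥0∞) ≤ 4 / 3 := by
    rw [ENNReal.le_div_iff_mul_le (by norm_num) (by norm_num)]; norm_num
  -- A single sequence of simple functions converges in `L²` and in `L^{4/3}` at once, so both sides
  -- of the estimate pass to the limit.
  have approx : ∀ f : L2, MemLp f (4 / 3) volume → ∃ (s : ℕ → SimpleFunc R3 ℂ)
      (hs : ∀ n, MemLp (s n) 2 volume), Tendsto (fun n => ((hs n).toLp (s n) : L2)) atTop (𝓝 f) ∧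
      Tendsto (fun n => (eLpNorm (s n) (4 / 3) volume).toReal) atTop
        (𝓝 (eLpNorm f (4 / 3) volume).toReal) := by
    intro f hf
    have hfm : Measurable f := (Lp.stronglyMeasurable f).measurable
    let s : ℕ → SimpleFunc R3 ℂ := fun n =>
      SimpleFunc.approxOn f hfm (range f ∪ {0}) 0 (by simp) n
    have hs : ∀ n, MemLp (s n) 2 volume := fun n =>
      SimpleFunc.memLp_approxOn_range hfm (Lp.memLp f) n
    have hs' : ∀ n, MemLp (s n) (4 / 3) volume := fun n =>
      SimpleFunc.memLp_approxOn_range hfm hf n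
    have l2 := SimpleFunc.tendsto_approxOn_range_Lp_eLpNorm (p := 2) (by norm_num) hfm
      (Lp.memLp f).2
    have l43 := SimpleFunc.tendsto_approxOn_range_Lp_eLpNorm (p := 4 / 3) h43 hfm hf.2
    refine ⟨s, hs, ?_, ?_⟩
    · rw [Lp.tendsto_Lp_iff_tendsto_eLpNorm']
      refine l2.congr fun n => eLpNorm_congr_ae ?_
      filter_upwards [(hs n).coeFn_toLp] with x hx
      simp only [Pi.sub_apply]
      rw [hx]
    · have l43' := (ENNReal.tendsto_toReal (by simp)).comp l43
      rw [ENNReal.toReal_zero] at l43'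
      refine tendsto_iff_norm_sub_tendsto_zero.mpr (squeeze_zero (fun _ => norm_nonneg _)
        (fun n => ?_) l43')
      have hsub : MemLp (⇑(s n) - ⇑f) (4 / 3) volume := (hs' n).sub hf
      have t1 : (eLpNorm (s n) (4 / 3) volume).toReal ≤
          (eLpNorm (⇑(s n) - ⇑f) (4 / 3) volume).toReal + (eLpNorm f (4 / 3) volume).toReal := by
        rw [← ENNReal.toReal_add hsub.2.ne hf.2.ne]
        refine ENNReal.toReal_mono (ENNReal.add_ne_top.mpr ⟨hsub.2.ne, hf.2.ne⟩) ?_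
        have := eLpNorm_add_le hsub.1 hf.1 h143
        rwa [sub_add_cancel] at this
      have t2 : (eLpNorm f (4 / 3) volume).toReal ≤
          (eLpNorm (⇑(s n) - ⇑f) (4 / 3) volume).toReal + (eLpNorm (s n) (4 / 3) volume).toReal := by
        rw [← ENNReal.toReal_add hsub.2.ne (hs' n).2.ne]
        refine ENNReal.toReal_mono (ENNReal.add_ne_top.mpr ⟨hsub.2.ne, (hs' n).2.ne⟩) ?_
        have := eLpNorm_add_le (hf.sub (hs' n)).1 (hs' n).1 h143
        rw [sub_add_cancel, eLpNorm_sub_comm] at this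
        exact this
      rw [Real.norm_eq_abs, abs_le]
      simp only [Function.comp_apply]
      constructor
      · linarith
      · linarith
  obtain ⟨s, hs, s1, s2⟩ := approx f hf
  obtain ⟨r, hr, r1, r2⟩ := approx g hg
  have L : Tendsto (fun n => ‖(inner ℂ ((hr n).toLp (r n) : L2) (T ((hs n).toLp (s n))) : ℂ)‖) atTop
      (𝓝 ‖(inner ℂ g (T f) : ℂ)‖) := (r1.inner ((T.continuous.tendsto f).comp s1)).norm
  refine le_of_tendsto_of_tendsto' L ((s2.mul r2).const_mul (A ^ (1 / 2 : ℝ))) fun n => ?_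
  have := interpolation_simpleFunc hT hA h1 (hs n) (hr n)
  rwa [int43_rpow _ (hs n), int43_rpow _ (hr n)] at this

/-- The `L^{4/3}` norm. -/
def n43 (f : L2) : ℝ := (eLpNorm f (4 / 3) volume).toReal

/-- The dispersive estimate `L^{4/3} → L⁴`. -/
theorem norm_inner_opU_le {t : ℝ} (ht : t ≠ 0) {f g : L2} (hf : MemLp f (4 / 3) volume)
    (hg : MemLp g (4 / 3) volume) :
    ‖(inner ℂ g (opU t f) : ℂ)‖ ≤ |t| ^ (-(3 / 4) : ℝ) * (n43 f * n43 g) := by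
  have := interpolation (T := opU t) (fun f => (norm_opU t f).le) (A := |t| ^ (-(3 / 2) : ℝ))
    (by positivity) (fun f g hf hg => norm_inner_opU_le_L1 ht hf hg) hf hg
  refine this.trans_eq ?_
  rw [← Real.rpow_mul (abs_nonneg t)]
  norm_num [n43]

/-! ### The cubic nonlinearity -/

/-- The function `a ↦ -|a|² a` on `ℂ`. -/
def cubic (a : ℂ) : ℂ := -((‖a‖ ^ 2 : ℝ) : ℂ) * a

theorem continuous_cubic : Continuous cubic := by
  unfold cubic
  fun_prop

theorem norm_cubic (a : ℂ) : ‖cubic a‖ = ‖a‖ * ‖a‖ * ‖a‖ := by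
  rw [cubic, norm_mul, norm_neg, Complex.norm_real, Real.norm_eq_abs, abs_of_nonneg (by positivity)]
  ring

theorem cubic_zero : cubic 0 = 0 := by simp [cubic]

theorem norm_cubic_sub_le (a b : ℂ) :
    ‖cubic a - cubic b‖ ≤ (‖a‖ + ‖b‖) * (‖a‖ + ‖b‖) * ‖a - b‖ := by
  have e : cubic a - cubic b = -(((‖a‖ ^ 2 : ℝ) : ℂ) * (a - b)) -
      (((‖a‖ - ‖b‖) * (‖a‖ + ‖b‖) : ℝ) : ℂ) * b := by
    simp only [cubic]
    push_cast
    ring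
  rw [e]
  refine (norm_sub_le _ _).trans ?_
  rw [norm_neg, norm_mul, norm_mul, Complex.norm_real, Complex.norm_real, Real.norm_eq_abs,
    Real.norm_eq_abs, abs_mul, abs_of_nonneg (by positivity : (0 : ℝ) ≤ ‖a‖ ^ 2),
    abs_of_nonneg (by positivity : (0 : ℝ) ≤ ‖a‖ + ‖b‖)]
  have h1 := abs_norm_sub_norm_le a b
  have h2 : |‖a‖ - ‖b‖| * (‖a‖ + ‖b‖) * ‖b‖ ≤ ‖a - b‖ * (‖a‖ + ‖b‖) * ‖b‖ := by gcongr
  nlinarith [mul_nonneg (mul_nonneg (norm_nonneg a) (norm_nonneg b)) (norm_nonneg (a - b))]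

theorem holderTriple_of_toReal {p q r : ℝ≥0∞} (hp : p ≠ 0) (hq : q ≠ 0) (hr : r ≠ 0)
    (h : p.toReal⁻¹ + q.toReal⁻¹ = r.toReal⁻¹) : ENNReal.HolderTriple p q r := by
  refine ⟨?_⟩
  rw [← ENNReal.toReal_eq_toReal_iff' (ENNReal.add_ne_top.mpr
    ⟨ENNReal.inv_ne_top.mpr hp, ENNReal.inv_ne_top.mpr hq⟩) (ENNReal.inv_ne_top.mpr hr),
    ENNReal.toReal_add (ENNReal.inv_ne_top.mpr hp) (ENNReal.inv_ne_top.mpr hq),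
    ENNReal.toReal_inv, ENNReal.toReal_inv, ENNReal.toReal_inv, h]

/-- Hölder's inequality with three factors. -/
theorem eLpNorm_le_mul_three {p q t r s : ℝ≥0∞} (h1 : ENNReal.HolderTriple p q t)
    (h2 : ENNReal.HolderTriple t r s) {F : Type*} [NormedAddCommGroup F] {g : R3 → F}
    {f₁ f₂ f₃ : R3 → ℝ} (m₁ : AEStronglyMeasurable f₁ volume)
    (m₂ : AEStronglyMeasurable f₂ volume) (m₃ : AEStronglyMeasurable f₃ volume)
    (h : ∀ᵐ x, ‖g x‖ ≤ f₁ x * f₂ x * f₃ x) :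
    eLpNorm g s volume ≤ eLpNorm f₁ p volume * eLpNorm f₂ q volume * eLpNorm f₃ r volume := by
  have e1 : eLpNorm g s volume ≤ eLpNorm ((f₁ • f₂) • f₃) s volume := by
    refine eLpNorm_mono_ae ?_
    filter_upwards [h] with x hx
    exact hx.trans (le_abs_self _)
  refine e1.trans ((eLpNorm_smul_le_mul_eLpNorm (p := t) (q := r) m₃ (m₁.smul m₂)).trans ?_)
  gcongr
  exact eLpNorm_smul_le_mul_eLpNorm (p := p) (q := q) m₂ m₁

theorem aestronglyMeasurable_norm (f : L2) : AEStronglyMeasurable (fun x => ‖f x‖) volume :=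
  (Lp.aestronglyMeasurable f).norm

theorem aestronglyMeasurable_norm_add (f g : L2) :
    AEStronglyMeasurable (fun x => ‖f x‖ + ‖g x‖) volume :=
  (aestronglyMeasurable_norm f).add (aestronglyMeasurable_norm g)

theorem eLpNorm_norm_add_le {p : ℝ≥0∞} (hp : 1 ≤ p) (f g : L2) :
    eLpNorm (fun x => ‖f x‖ + ‖g x‖) p volume ≤ eLpNorm f p volume + eLpNorm g p volume := by
  have := eLpNorm_add_le (μ := (volume : Measure R3)) (p := p) (aestronglyMeasurable_norm f)
    (aestronglyMeasurable_norm g) hp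
  rwa [eLpNorm_norm, eLpNorm_norm] at this

theorem memLp_cubic (k : L2) : MemLp (fun x => cubic (opB k x)) 2 volume := by
  refine ⟨continuous_cubic.comp_aestronglyMeasurable (Lp.aestronglyMeasurable _), ?_⟩
  have h1 : ENNReal.HolderTriple 6 6 3 := holderTriple_of_toReal (by norm_num) (by norm_num)
    (by norm_num) (by norm_num)
  have h2 : ENNReal.HolderTriple 3 6 2 := holderTriple_of_toReal (by norm_num) (by norm_num)
    (by norm_num) (by norm_num)
  refine (eLpNorm_le_mul_three h1 h2 (aestronglyMeasurable_norm (opB k))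
    (aestronglyMeasurable_norm (opB k)) (aestronglyMeasurable_norm (opB k))
    (Eventually.of_forall fun x => (norm_cubic _).le)).trans_lt ?_
  rw [eLpNorm_norm]
  have := (memLp_six k).2
  exact ENNReal.mul_lt_top (ENNReal.mul_lt_top this this) this

/-- The nonlinearity `F(⟨D⟩⁻¹ k)` as an `L²` function. -/
def nl (k : L2) : L2 := (memLp_cubic k).toLp _

theorem coeFn_nl (k : L2) : nl k =ᵐ[volume] fun x => cubic (opB k x) := (memLp_cubic k).coeFn_toLp

theorem nonlin_coe_opB (k : L2) : nonlin (opB k : Distr) = (nl k : Distr) := by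
  unfold nonlin
  rw [toL2_coe]
  exact dif_pos (memLp_cubic k)

theorem nonlin_eq {v : Distr} (hv : MemH 1 v) : nonlin v = (nl (J 1 v) : Distr) := by
  rw [← nonlin_coe_opB, coe_opB_J hv]

theorem nl_zero : nl 0 = 0 := by
  apply Lp.ext
  filter_upwards [coeFn_nl 0, Lp.coeFn_zero ℂ 2 (volume : Measure R3)] with x h1 h2
  rw [h1, map_zero, h2, Pi.zero_apply, cubic_zero]

theorem norm_nl_sub_pointwise (k l : L2) : ∀ᵐ x, ‖(nl k - nl l : L2) x‖ ≤
    (‖opB k x‖ + ‖opB l x‖) * (‖opB k x‖ + ‖opB l x‖) * ‖opB (k - l) x‖ := by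
  filter_upwards [coeFn_nl k, coeFn_nl l, Lp.coeFn_sub (nl k) (nl l),
    Lp.coeFn_sub (opB k) (opB l)] with x h1 h2 h3 h4
  rw [h3, Pi.sub_apply, h1, h2, map_sub, h4, Pi.sub_apply]
  exact norm_cubic_sub_le _ _

theorem norm_nl_sub_le (k l : L2) :
    ‖nl k - nl l‖ ≤ sobC ^ 3 * (‖k‖ + ‖l‖) ^ 2 * ‖k - l‖ := by
  have h1 : ENNReal.HolderTriple 6 6 3 := holderTriple_of_toReal (by norm_num) (by norm_num)
    (by norm_num) (by norm_num)
  have h2 : ENNReal.HolderTriple 3 6 2 := holderTriple_of_toReal (by norm_num) (by norm_num)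
    (by norm_num) (by norm_num)
  have hs := sobC_pos
  have e : eLpNorm (fun x => ‖opB k x‖ + ‖opB l x‖) 6 volume ≤
      ENNReal.ofReal (sobC * (‖k‖ + ‖l‖)) := by
    refine (eLpNorm_norm_add_le (by norm_num) _ _).trans ?_
    rw [mul_add, ENNReal.ofReal_add (by positivity) (by positivity)]
    exact add_le_add (eLpNorm_six_le k) (eLpNorm_six_le l)
  rw [Lp.norm_def]
  refine ENNReal.toReal_le_of_le_ofReal (by positivity) ?_
  refine (eLpNorm_le_mul_three h1 h2 (aestronglyMeasurable_norm_add _ _)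
    (aestronglyMeasurable_norm_add _ _) (aestronglyMeasurable_norm _)
    (norm_nl_sub_pointwise k l)).trans ?_
  rw [eLpNorm_norm]
  refine (mul_le_mul' (mul_le_mul' e e) (eLpNorm_six_le (k - l))).trans_eq ?_
  rw [← ENNReal.ofReal_mul (by positivity), ← ENNReal.ofReal_mul (by positivity)]
  congr 1
  ring

theorem norm_nl_le (k : L2) : ‖nl k‖ ≤ sobC ^ 3 * ‖k‖ ^ 3 := by
  have := norm_nl_sub_le k 0
  rw [nl_zero, sub_zero, sub_zero, norm_zero, add_zero] at this
  linarith [this, (by ring : sobC ^ 3 * ‖k‖ ^ 2 * ‖k‖ = sobC ^ 3 * ‖k‖ ^ 3)]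

theorem continuous_nl : Continuous nl := by
  rw [continuous_iff_continuousAt]
  intro l
  rw [ContinuousAt, tendsto_iff_norm_sub_tendsto_zero]
  have h : Tendsto (fun k : L2 => sobC ^ 3 * (‖k‖ + ‖l‖) ^ 2 * ‖k - l‖) (𝓝 l) (𝓝 0) := by
    have : Continuous fun k : L2 => sobC ^ 3 * (‖k‖ + ‖l‖) ^ 2 * ‖k - l‖ := by fun_prop
    simpa using this.tendsto l
  exact squeeze_zero (fun _ => norm_nonneg _) (fun k => norm_nl_sub_le k l) h

theorem eLpNorm_four_norm_add_le (k l : L2) :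
    eLpNorm (fun x => ‖opB k x‖ + ‖opB l x‖) 4 volume ≤ ENNReal.ofReal (n4 k + n4 l) := by
  refine (eLpNorm_norm_add_le (by norm_num) _ _).trans ?_
  rw [ENNReal.ofReal_add (n4_nonneg k) (n4_nonneg l), ofReal_n4, ofReal_n4]

/-- Hölder with exponents `4, 4, 4`. The target `4/3` is dual to `4`, so the nonlinearity lands in
the space on which the dispersive estimate acts. -/
theorem eLpNorm_nl_sub_le (k l : L2) : eLpNorm (nl k - nl l : L2) (4 / 3) volume ≤
    ENNReal.ofReal ((n4 k + n4 l) ^ 2 * n4 (k - l)) := by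
  have h1 : ENNReal.HolderTriple 4 4 2 := holderTriple_of_toReal (by norm_num) (by norm_num)
    (by norm_num) (by norm_num)
  have h2 : ENNReal.HolderTriple 2 4 (4 / 3) := holderTriple_of_toReal (by norm_num) (by norm_num)
    (by norm_num) (by norm_num)
  have hk := n4_nonneg k
  have hl := n4_nonneg l
  refine (eLpNorm_le_mul_three h1 h2 (aestronglyMeasurable_norm_add _ _)
    (aestronglyMeasurable_norm_add _ _) (aestronglyMeasurable_norm _)
    (norm_nl_sub_pointwise k l)).trans ?_
  rw [eLpNorm_norm, ← ofReal_n4]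
  refine (mul_le_mul' (mul_le_mul' (eLpNorm_four_norm_add_le k l) (eLpNorm_four_norm_add_le k l))
    le_rfl).trans_eq ?_
  rw [← ENNReal.ofReal_mul (by positivity), ← ENNReal.ofReal_mul (by positivity), sq]

theorem memLp_nl_sub (k l : L2) : MemLp (nl k - nl l : L2) (4 / 3) volume :=
  ⟨Lp.aestronglyMeasurable _, (eLpNorm_nl_sub_le k l).trans_lt ENNReal.ofReal_lt_top⟩

theorem n43_nl_sub_le (k l : L2) : n43 (nl k - nl l) ≤ (n4 k + n4 l) ^ 2 * n4 (k - l) :=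
  ENNReal.toReal_le_of_le_ofReal (mul_nonneg (sq_nonneg _) (n4_nonneg _)) (eLpNorm_nl_sub_le k l)

theorem n4_zero : n4 0 = 0 := by
  have := n4_smul 0 0
  simpa using this

theorem memLp_nl (k : L2) : MemLp (nl k) (4 / 3) volume := by
  simpa [nl_zero] using memLp_nl_sub k 0

theorem n43_nl_le (k : L2) : n43 (nl k) ≤ n4 k ^ 3 := by
  have := n43_nl_sub_le k 0
  rw [nl_zero, n4_zero, sub_zero, sub_zero, add_zero] at this
  linarith [this, (by ring : n4 k ^ 2 * n4 k = n4 k ^ 3)]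

/-- Hölder with exponents `4, 4, 2`. This `L¹` bound feeds the `t^{-3/2}` decay that produces the
asymptotic state. -/
theorem eLpNorm_one_nl_le (k : L2) :
    eLpNorm (nl k) 1 volume ≤ ENNReal.ofReal (sobC4 ^ 2 * ‖k‖ ^ 3) := by
  have h1 : ENNReal.HolderTriple 4 4 2 := holderTriple_of_toReal (by norm_num) (by norm_num)
    (by norm_num) (by norm_num)
  have h2 : ENNReal.HolderTriple 2 2 1 := holderTriple_of_toReal (by norm_num) (by norm_num)
    (by norm_num) (by norm_num)
  have hs := sobC4_pos
  have hp : ∀ᵐ x, ‖nl k x‖ ≤ ‖opB k x‖ * ‖opB k x‖ * ‖opB k x‖ := by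
    filter_upwards [coeFn_nl k] with x hx
    rw [hx, norm_cubic]
  refine (eLpNorm_le_mul_three h1 h2 (aestronglyMeasurable_norm _)
    (aestronglyMeasurable_norm _) (aestronglyMeasurable_norm _) hp).trans ?_
  rw [eLpNorm_norm, eLpNorm_norm, ← ofReal_norm_eq_eLpNorm]
  have e := eLpNorm_four_le k
  refine (mul_le_mul' (mul_le_mul' e e) (ENNReal.ofReal_le_ofReal (norm_opB_le k))).trans_eq ?_
  rw [← ENNReal.ofReal_mul (by positivity), ← ENNReal.ofReal_mul (by positivity)]
  congr 1
  ring

theorem integrable_nl (k : L2) : Integrable (nl k) := memLp_one_iff_integrable.mp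
  ⟨Lp.aestronglyMeasurable _, (eLpNorm_one_nl_le k).trans_lt ENNReal.ofReal_lt_top⟩

theorem integral_norm_nl_le (k : L2) : ∫ x, ‖nl k x‖ ≤ sobC4 ^ 2 * ‖k‖ ^ 3 := by
  have hs := sobC4_pos
  have := ENNReal.toReal_le_of_le_ofReal (by positivity) (eLpNorm_one_nl_le k)
  rwa [eLpNorm_one_eq_lintegral_enorm, ← integral_norm_eq_lintegral_enorm
    (Lp.aestronglyMeasurable _)] at this

theorem integrable_norm_four (k : L2) : Integrable fun x => ‖opB k x‖ ^ 4 :=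
  (memLp_four k).integrable_norm_pow (by norm_num)

theorem n4_pow_four (k : L2) : n4 k ^ 4 = ∫ x, ‖opB k x‖ ^ 4 := by
  rw [integral_eq_lintegral_of_nonneg_ae (Eventually.of_forall fun x => by positivity)
    (integrable_norm_four k).1, n4, ← ENNReal.toReal_pow]
  have := lintegral_pow_of_eLpNorm (opB k) 4 (by norm_num)
  norm_num at this
  rw [← this]
  congr 1
  refine lintegral_congr fun x => ?_
  rw [← ofReal_norm, ENNReal.ofReal_pow (norm_nonneg _)]

/-- The value is real; this gauge invariance is what removes the nonlinearity from the mass balance.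
-/
theorem inner_nl (k : L2) : inner ℂ (nl k) (opB k) = ((-(n4 k ^ 4) : ℝ) : ℂ) := by
  rw [L2.inner_def, n4_pow_four, ← integral_neg, ← integral_complex_ofReal]
  refine integral_congr_ae ?_
  filter_upwards [coeFn_nl k] with x hx
  rw [hx, RCLike.inner_apply, cubic]
  have := Complex.mul_conj' (opB k x)
  simp only [map_mul, map_neg, Complex.conj_ofReal]
  push_cast
  rw [show ((‖opB k x‖ : ℂ)) ^ 4 = (‖opB k x‖ : ℂ) ^ 2 * (‖opB k x‖ : ℂ) ^ 2 by ring]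
  rw [← this]
  ring

theorem inner_nl' (k : L2) : inner ℂ (opB k) (nl k) = ((-(n4 k ^ 4) : ℝ) : ℂ) := by
  rw [← inner_conj_symm, inner_nl, Complex.conj_ofReal]

theorem opT_nl (h : R3) (k : L2) : opT h (nl k) = nl (opT h k) := by
  apply Lp.ext
  have h1 := (measurePreserving_add_right (volume : Measure R3) h).quasiMeasurePreserving.ae
    (coeFn_nl k)
  filter_upwards [coeFn_opT h (nl k), coeFn_nl (opT h k), coeFn_opT h (opB k), h1] with x e1 e2 e3 e4
  rw [e1, e2, e4, ← opT_opB, e3]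

/-! ### Differentiation in time -/

theorem inner_smul_right_real (r : ℝ) (f g : L2) : inner ℂ f (r • g) = (r : ℂ) * inner ℂ f g := by
  rw [RCLike.real_smul_eq_coe_smul (K := ℂ), inner_smul_right]
  rfl

theorem inner_smul_left_real (r : ℝ) (f g : L2) : inner ℂ (r • f) g = (r : ℂ) * inner ℂ f g := by
  rw [RCLike.real_smul_eq_coe_smul (K := ℂ), inner_smul_left]
  simp

/-- The product rule for `⟨p, q⟩_{L²}`, for curves `p, q` which are continuous in `H¹` and
differentiable in `H⁻¹`. -/
theorem hasDerivWithinAt_inner_opB {S : Set ℝ} {t : ℝ} {p q : ℝ → L2} {p' q' : L2}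
    (hq : ContinuousWithinAt q S t)
    (hp' : HasDerivWithinAt (fun s => opB (opB (p s))) p' S t)
    (hq' : HasDerivWithinAt (fun s => opB (opB (q s))) q' S t) :
    HasDerivWithinAt (fun s => (inner ℂ (opB (p s)) (opB (q s)) : ℂ))
      (inner ℂ p' (q t) + inner ℂ (p t) q') S t := by
  rw [hasDerivWithinAt_iff_tendsto_slope] at hp' hq' ⊢
  have hq1 : Tendsto q (𝓝[S \ {t}] t) (𝓝 (q t)) :=
    hq.tendsto.mono_left (nhdsWithin_mono _ sdiff_subset)
  -- The increment of the product is split with `q` at the moving time and `p` frozen at `t`.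
  -- Self-adjointness of `opB` moves both factors `⟨D⟩⁻¹` onto the varying slot, where the
  -- derivative lives.
  have h1 := (hp'.inner (𝕜 := ℂ) hq1).add ((tendsto_const_nhds (x := p t)).inner (𝕜 := ℂ) hq')
  refine h1.congr fun s => ?_
  simp only [slope_def_module, inner_smul_left_real, inner_smul_right_real, inner_sub_left,
    inner_sub_right, Complex.real_smul, inner_opB]
  ring

theorem norm_symU_sub_le (s t : ℝ) (ξ : R3) :
    ‖symU s ξ - symU t ξ‖ ≤ 4 * Real.pi ^ 2 * ‖ξ‖ ^ 2 * |s - t| := by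
  have e : symU s ξ - symU t ξ = symU t ξ *
      (Complex.exp (Complex.I * ((-(4 * Real.pi ^ 2 * (s - t)) * ‖ξ‖ ^ 2 : ℝ) : ℂ)) - 1) := by
    simp only [symU_apply, freeSymbol]
    rw [mul_sub, ← Complex.exp_add, mul_one]
    congr 2
    push_cast
    ring
  rw [e, norm_mul, norm_symU, one_mul]
  refine (Real.norm_exp_I_mul_ofReal_sub_one_le).trans_eq ?_
  rw [Real.norm_eq_abs, abs_mul, abs_neg, abs_mul,
    abs_of_nonneg (by positivity : (0 : ℝ) ≤ ‖ξ‖ ^ 2),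
    abs_of_nonneg (by positivity : (0 : ℝ) ≤ 4 * Real.pi ^ 2)]
  ring

theorem hasDerivAt_symU (t : ℝ) (ξ : R3) :
    HasDerivAt (fun s => symU s ξ)
      (symU t ξ * (((-(4 * Real.pi ^ 2 * ‖ξ‖ ^ 2) : ℝ) : ℂ) * Complex.I)) t := by
  have h1 : HasDerivAt (fun s : ℝ => -(4 * Real.pi ^ 2 * s) * ‖ξ‖ ^ 2)
      (-(4 * Real.pi ^ 2 * ‖ξ‖ ^ 2)) t := by
    have := ((((hasDerivAt_id t).const_mul (4 * Real.pi ^ 2)).neg).mul_const (‖ξ‖ ^ 2))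
    refine this.congr_deriv ?_
    ring
  exact (h1.ofReal_comp.mul_const Complex.I).cexp

/-- The free evolution is differentiable in `H⁻¹` on `H¹`. -/
theorem hasDerivAt_opU (t : ℝ) (χ : L2) :
    HasDerivAt (fun s => opB (opB (opU s χ))) (-Complex.I • opL (opU t χ)) t := by
  rw [hasDerivAt_iff_tendsto_slope]
  let σ : ℝ → R3 →ᵇ ℂ := fun s => (((s - t)⁻¹ : ℝ) : ℂ) •
    (symB * (symB * (symU s + (-1 : ℂ) • symU t)))
  have hσ : ∀ s ξ, σ s ξ = (((s - t)⁻¹ : ℝ) : ℂ) * (symB ξ * symB ξ * (symU s ξ - symU t ξ)) := by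
    intro s ξ
    change (((s - t)⁻¹ : ℝ) : ℂ) * (symB ξ * (symB ξ * (symU s ξ + (-1 : ℂ) * symU t ξ))) = _
    ring
  have e1 : ∀ s, slope (fun s => opB (opB (opU s χ))) t s = fmul (σ s) χ := by
    intro s
    rw [slope_def_module, fmul_smul, fmul_mul, fmul_mul, fmul_add, fmul_smul, neg_one_smul,
      RCLike.real_smul_eq_coe_smul (K := ℂ), ← map_sub, ← map_sub, sub_eq_add_neg (opU s χ)]
    rfl
  have e2 : -Complex.I • opL (opU t χ) = fmul (-Complex.I • (symL * symU t)) χ := by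
    rw [fmul_smul, fmul_mul]
    rfl
  rw [e2]
  refine Tendsto.congr (fun s => (e1 s).symm) ?_
  -- The quotients are uniformly bounded because `|symU s - symU t| ≤ 4π²|ξ|²|s - t|` and the two
  -- factors `⟨ξ⟩⁻¹` absorb `|ξ|²`.
  refine tendsto_fmul (C := 4 * Real.pi ^ 2) (fun s ξ => ?_) (fun ξ => ?_) χ
  · rw [hσ, norm_mul, norm_mul, symB_sq, Complex.norm_real, Complex.norm_real, Real.norm_eq_abs,
      Real.norm_eq_abs, abs_inv, abs_of_nonneg (by positivity : (0 : ℝ) ≤ (1 + ‖ξ‖ ^ 2)⁻¹)]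
    have h0 := one_le_bracket ξ
    calc |s - t|⁻¹ * ((1 + ‖ξ‖ ^ 2)⁻¹ * ‖symU s ξ - symU t ξ‖)
        ≤ |s - t|⁻¹ * ((1 + ‖ξ‖ ^ 2)⁻¹ * (4 * Real.pi ^ 2 * ‖ξ‖ ^ 2 * |s - t|)) := by
          gcongr
          exact norm_symU_sub_le s t ξ
      _ = (|s - t|⁻¹ * |s - t|) * (4 * Real.pi ^ 2 * ((1 + ‖ξ‖ ^ 2)⁻¹ * ‖ξ‖ ^ 2)) := by ring
      _ ≤ 1 * (4 * Real.pi ^ 2 * 1) := by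
          gcongr
          · exact inv_mul_le_one
          · rw [inv_mul_le_iff₀ h0]
            linarith
      _ = _ := by ring
  · have h1 := (hasDerivAt_iff_tendsto_slope.mp (hasDerivAt_symU t ξ)).const_mul (symB ξ * symB ξ)
    have e3 : (-Complex.I • (symL * symU t)) ξ = symB ξ * symB ξ *
        (symU t ξ * (((-(4 * Real.pi ^ 2 * ‖ξ‖ ^ 2) : ℝ) : ℂ) * Complex.I)) := by
      change -Complex.I * (symL ξ * symU t ξ) = _
      rw [symB_sq, symL_apply]
      push_cast
      ring
    rw [e3]
    refine h1.congr fun s => ?_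
    rw [hσ, slope_def_module, Complex.real_smul]
    ring

theorem continuous_opU_comp {X : Type*} [TopologicalSpace X] {θ : X → ℝ} {g : X → L2}
    (hθ : Continuous θ) (hg : Continuous g) : Continuous fun x => opU (θ x) (g x) := by
  rw [continuous_iff_continuousAt]
  intro x₀
  rw [ContinuousAt, tendsto_iff_norm_sub_tendsto_zero]
  have h1 : Tendsto (fun x => ‖g x - g x₀‖ + ‖opU (θ x) (g x₀) - opU (θ x₀) (g x₀)‖) (𝓝 x₀)
      (𝓝 0) := by
    have : Continuous fun x => ‖g x - g x₀‖ + ‖opU (θ x) (g x₀) - opU (θ x₀) (g x₀)‖ :=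
      (hg.sub continuous_const).norm.add
        (((continuous_opU (g x₀)).comp hθ).sub continuous_const).norm
    simpa using this.tendsto x₀
  refine squeeze_zero (fun _ => norm_nonneg _) (fun x => ?_) h1
  have e : opU (θ x) (g x) - opU (θ x₀) (g x₀) =
      opU (θ x) (g x - g x₀) + (opU (θ x) (g x₀) - opU (θ x₀) (g x₀)) := by
    rw [map_sub]
    abel
  rw [e]
  refine (norm_add_le _ _).trans_eq ?_
  rw [norm_opU]

/-! ### The flow -/

/-- A bounded solution of the cubic equation, written for `k = ⟨D⟩ u` and extended to negative times
as a continuous curve. -/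
structure IsFlow (E : ℝ) (k : ℝ → L2) : Prop where
  continuous : Continuous k
  norm_le : ∀ t, ‖k t‖ ≤ E
  deriv : ∀ t, 0 ≤ t → HasDerivWithinAt (fun r => opB (opB (k r)))
    (-Complex.I • (opL (k t) + opB (nl (k t)))) (Ici 0) t

/-- The curve `⟨D⟩ u`. -/
def flowOf (u : ℝ → Distr) (t : ℝ) : L2 := J 1 (u (max t 0))

theorem flowOf_of_nonneg (u : ℝ → Distr) {t : ℝ} (ht : 0 ≤ t) : flowOf u t = J 1 (u t) := by
  rw [flowOf, max_eq_left ht]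

theorem J_deriv_of_nlsDefect {v vt : Distr} (hv : MemH 1 v) (hvt : MemH (-1) vt)
    (h : nlsDefect v vt = 0) :
    J (-1) vt = -Complex.I • (opL (J 1 v) + opB (nl (J 1 v))) := by
  have h1 : Complex.I • vt = nonlin v - Δ v := by
    unfold nlsDefect at h
    rw [← sub_eq_zero, ← h]
    abel
  have hn : MemH (-1) (nonlin v) := by
    rw [nonlin_eq hv]
    exact memH_neg_one_coe _
  have h2 : Complex.I • J (-1) vt = opB (nl (J 1 v)) + opL (J 1 v) := by
    rw [← J_smul _ hvt, h1, J_sub hn (memH_laplacian hv), J_laplacian hv, nonlin_eq hv,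
      J_neg_one_coe, sub_neg_eq_add]
  have h3 : -Complex.I • (Complex.I • J (-1) vt) = J (-1) vt := by
    rw [smul_smul, neg_mul, Complex.I_mul_I, neg_neg, one_smul]
  rw [← h3, h2, add_comm]

/-- Freezing the curve at `u(0)` for negative times makes it continuous and bounded on all of `ℝ`,
which avoids one-sided continuity conditions later. -/
theorem IsSolution.isFlow {u : ℝ → Distr} (hu : IsSolution u) {E : ℝ}
    (hE : ∀ t, 0 ≤ t → normH 1 (u t) ≤ E) : IsFlow E (flowOf u) := by
  refine ⟨?_, fun t => hE _ (le_max_right _ _), fun t ht => ?_⟩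
  · exact hu.continuousOn.comp_continuous (by fun_prop) fun t => mem_Ici.mpr (le_max_right t 0)
  · obtain ⟨ut, ⟨hut, hd⟩, heq⟩ := hu.equation t ht
    rw [J_deriv_of_nlsDefect (hu.memH t ht) hut heq] at hd
    rw [flowOf_of_nonneg u ht]
    refine hd.congr (fun r hr => ?_) ?_
    · rw [flowOf_of_nonneg u hr, J_neg_one (hu.memH r hr)]
    · rw [flowOf_of_nonneg u ht, J_neg_one (hu.memH t ht)]

namespace IsFlow

variable {E : ℝ} {k : ℝ → L2}

theorem nonneg (hk : IsFlow E k) : 0 ≤ E := (norm_nonneg _).trans (hk.norm_le 0)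

/-- The Laplacian contributes nothing because `opL` is symmetric, and the nonlinearity nothing
because its pairing with `u` is real. -/
theorem hasDerivWithinAt_mass (hk : IsFlow E k) {t : ℝ} (ht : 0 ≤ t) :
    HasDerivWithinAt (fun s => (inner ℂ (opB (k s)) (opB (k s)) : ℂ)) 0 (Ici 0) t := by
  refine (hasDerivWithinAt_inner_opB hk.continuous.continuousWithinAt (hk.deriv t ht)
    (hk.deriv t ht)).congr_deriv ?_
  rw [inner_smul_left, inner_smul_right, inner_add_left, inner_add_right, inner_opB,
    ← inner_opB (nl (k t)), ← inner_opL, inner_nl, inner_nl']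
  simp

theorem norm_eq (hk : IsFlow E k) {t : ℝ} (ht : 0 ≤ t) : ‖opB (k t)‖ = ‖opB (k 0)‖ := by
  have h : (inner ℂ (opB (k t)) (opB (k t)) : ℂ) = inner ℂ (opB (k 0)) (opB (k 0)) := by
    have := (convex_Ici (0 : ℝ)).is_const_of_fderivWithin_eq_zero (𝕜 := ℝ)
      (f := fun s => (inner ℂ (opB (k s)) (opB (k s)) : ℂ))
      (fun s hs => (hk.hasDerivWithinAt_mass hs).differentiableWithinAt) (fun s hs => ?_)
      (mem_Ici.mpr ht) (mem_Ici.mpr le_rfl)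
    · exact this
    · have := (hk.hasDerivWithinAt_mass hs).hasFDerivWithinAt.fderivWithin
        (uniqueDiffOn_Ici 0 s hs)
      rw [this]
      ext
      simp
  rw [inner_self_eq_norm_sq_to_K, inner_self_eq_norm_sq_to_K] at h
  have h2 : ‖opB (k t)‖ ^ 2 = ‖opB (k 0)‖ ^ 2 := by exact_mod_cast h
  exact (pow_left_inj₀ (norm_nonneg _) (norm_nonneg _) two_ne_zero).mp h2

/-- In the interaction picture the two Laplacian terms cancel and only the nonlinearity drives the
pairing. -/
theorem hasDerivWithinAt_inner_opU (hk : IsFlow E k) (χ : L2) {t : ℝ} (ht : 0 ≤ t) :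
    HasDerivWithinAt (fun s => (inner ℂ (opB χ) (opU (-s) (opB (k s))) : ℂ))
      (inner ℂ (opB χ) (-Complex.I • opU (-t) (nl (k t)))) (Ici 0) t := by
  have h := hasDerivWithinAt_inner_opB hk.continuous.continuousWithinAt
    (hasDerivAt_opU t χ).hasDerivWithinAt (hk.deriv t ht)
  have e : ∀ s, (inner ℂ (opB (opU s χ)) (opB (k s)) : ℂ) =
      inner ℂ (opB χ) (opU (-s) (opB (k s))) := by
    intro s
    rw [inner_opU, neg_neg, opU_opB]
  simp only [e] at h
  refine h.congr_deriv ?_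
  rw [inner_smul_left, inner_smul_right, inner_smul_right, inner_add_right, inner_opU, neg_neg,
    opU_opB, inner_opB, ← inner_opL]
  simp only [map_neg, Complex.conj_I]
  ring

theorem continuous_integrand (hk : IsFlow E k) : Continuous fun s => opU (-s) (nl (k s)) :=
  continuous_opU_comp continuous_neg (continuous_nl.comp hk.continuous)

theorem continuous_smul_integrand (hk : IsFlow E k) :
    Continuous fun s => -Complex.I • opU (-s) (nl (k s)) :=
  hk.continuous_integrand.const_smul (-Complex.I)

theorem inner_duhamel (hk : IsFlow E k) (χ : L2) {a b : ℝ} (ha : 0 ≤ a) (hab : a ≤ b) :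
    (inner ℂ (opB χ) (opU (-b) (opB (k b)) - opU (-a) (opB (k a))) : ℂ) =
      ∫ s in a..b, (inner ℂ (opB χ) (-Complex.I • opU (-s) (nl (k s))) : ℂ) := by
  rw [inner_sub_right]
  symm
  refine intervalIntegral.integral_eq_sub_of_hasDerivAt_of_le
    (f := fun s => (inner ℂ (opB χ) (opU (-s) (opB (k s))) : ℂ)) hab ?_ (fun s hs => ?_) ?_
  · have : Continuous fun s => opU (-s) (opB (k s)) :=
      continuous_opU_comp continuous_neg (opB.continuous.comp hk.continuous)
    exact (continuous_const.inner this).continuousOn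
  · have hs0 : 0 < s := ha.trans_lt hs.1
    exact (hk.hasDerivWithinAt_inner_opU χ hs0.le).hasDerivAt (Ici_mem_nhds hs0)
  · exact (continuous_const.inner hk.continuous_smul_integrand).intervalIntegrable _ _

/-- Duhamel's formula. -/
theorem duhamel (hk : IsFlow E k) {a b : ℝ} (ha : 0 ≤ a) (hab : a ≤ b) :
    opU (-b) (opB (k b)) = opU (-a) (opB (k a)) +
      ∫ s in a..b, -Complex.I • opU (-s) (nl (k s)) := by
  rw [← sub_eq_iff_eq_add', ← sub_eq_zero]
  have hi : IntervalIntegrable (fun s => -Complex.I • opU (-s) (nl (k s))) volume a b :=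
    hk.continuous_smul_integrand.intervalIntegrable _ _
  -- Since `opB` is injective and self-adjoint, testing against vectors `opB χ`, for which the weak
  -- formula is available, determines the identity in `L²`.
  refine opB_injective ?_
  rw [map_zero]
  refine ext_inner_left ℂ fun χ => ?_
  rw [inner_zero_right, inner_opB, inner_sub_right, hk.inner_duhamel χ ha hab]
  have := ((innerSL ℂ (opB χ)).restrictScalars ℝ).intervalIntegral_comp_comm hi
  have e : (∫ s in a..b, (inner ℂ (opB χ) (-Complex.I • opU (-s) (nl (k s))) : ℂ)) =
      inner ℂ (opB χ) (∫ s in a..b, -Complex.I • opU (-s) (nl (k s))) := this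
  rw [e, sub_self]

end IsFlow

/-! ### Local-in-time Strichartz estimates -/

theorem lintegral_ofReal_eq {F : ℝ → ℝ} (hF : Continuous F) (h0 : ∀ t, 0 ≤ F t) {a b : ℝ}
    (hab : a ≤ b) :
    ∫⁻ t in Ioc a b, ENNReal.ofReal (F t) = ENNReal.ofReal (∫ t in a..b, F t) := by
  rw [intervalIntegral.integral_of_le hab, ofReal_integral_eq_lintegral_ofReal
    (hF.integrableOn_Ioc) (Eventually.of_forall h0)]

/-- The kernel `|r|^{-3/4}`. -/
def ker (r : ℝ) : ℝ := |r| ^ (-(3 / 4) : ℝ)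

theorem ker_nonneg (r : ℝ) : 0 ≤ ker r := Real.rpow_nonneg (abs_nonneg r) _

theorem ker_neg (r : ℝ) : ker (-r) = ker r := by rw [ker, abs_neg, ker]

theorem measurable_ker : Measurable ker := by
  unfold ker
  fun_prop

theorem lintegral_ker_Ioc {ℓ : ℝ} (hℓ : 0 ≤ ℓ) :
    ∫⁻ r in Ioc 0 ℓ, ENNReal.ofReal (ker r) = ENNReal.ofReal (4 * ℓ ^ (1 / 4 : ℝ)) := by
  have e : ∀ r ∈ Ioc (0 : ℝ) ℓ, ENNReal.ofReal (ker r) = ENNReal.ofReal (r ^ (-(3 / 4) : ℝ)) := by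
    intro r hr
    rw [ker, abs_of_pos hr.1]
  rw [setLIntegral_congr_fun measurableSet_Ioc e, ← ofReal_integral_eq_lintegral_ofReal,
    ← intervalIntegral.integral_of_le hℓ, integral_rpow (Or.inl (by norm_num))]
  · congr 1
    norm_num
    ring
  · exact (intervalIntegrable_iff_integrableOn_Ioc_of_le hℓ).mp
      (intervalIntegral.intervalIntegrable_rpow' (by norm_num))
  · filter_upwards [ae_restrict_mem measurableSet_Ioc] with r hr
    exact Real.rpow_nonneg hr.1.le _

/-- The integrable singularity `|r|^{-3/4}` contributes at most `4(b - a)^{1/4}` on either side of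
`t`. The positive power of the length gives smallness on short intervals. -/
theorem lintegral_ker_le {a b t : ℝ} (ht : t ∈ Ioc a b) :
    ∫⁻ s in Ioc a b, ENNReal.ofReal (ker (t - s)) ≤
      ENNReal.ofReal (8 * (b - a) ^ (1 / 4 : ℝ)) := by
  have hab : a ≤ b := ht.1.le.trans ht.2
  have h1 : ∫⁻ s in Ioc t b, ENNReal.ofReal (ker (t - s)) =
      ENNReal.ofReal (4 * (b - t) ^ (1 / 4 : ℝ)) := by
    rw [← lintegral_ker_Ioc (sub_nonneg.mpr ht.2)]
    have := (measurePreserving_sub_right (volume : Measure ℝ) t).setLIntegral_comp_preimage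
      (s := Ioc 0 (b - t)) measurableSet_Ioc (f := fun r => ENNReal.ofReal (ker r))
      measurable_ker.ennreal_ofReal
    rw [← this]
    have e : (fun x => x - t) ⁻¹' Ioc 0 (b - t) = Ioc t b := by
      ext x; simp
    rw [e]
    refine lintegral_congr fun s => ?_
    rw [← ker_neg, neg_sub]
  have h2 : ∫⁻ s in Ico a t, ENNReal.ofReal (ker (t - s)) =
      ENNReal.ofReal (4 * (t - a) ^ (1 / 4 : ℝ)) := by
    rw [← lintegral_ker_Ioc (sub_nonneg.mpr ht.1.le)]
    have := (Measure.measurePreserving_sub_left (volume : Measure ℝ) t).setLIntegral_comp_preimage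
      (s := Ioc 0 (t - a)) measurableSet_Ioc (f := fun r => ENNReal.ofReal (ker r))
      measurable_ker.ennreal_ofReal
    rw [← this]
    congr 2
    ext x
    simp only [mem_Ico, mem_preimage, mem_Ioc]
    constructor
    · rintro ⟨h, h'⟩; constructor <;> linarith
    · rintro ⟨h, h'⟩; constructor <;> linarith
  have h3 : ∫⁻ s in Ioc a t, ENNReal.ofReal (ker (t - s)) =
      ∫⁻ s in Ico a t, ENNReal.ofReal (ker (t - s)) :=
    setLIntegral_congr Ioc_ae_eq_Icc |>.trans (setLIntegral_congr Ico_ae_eq_Icc).symm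
  have hba : 0 ≤ b - a := sub_nonneg.mpr hab
  calc ∫⁻ s in Ioc a b, ENNReal.ofReal (ker (t - s))
      = ∫⁻ s in Ioc a t ∪ Ioc t b, ENNReal.ofReal (ker (t - s)) := by
        rw [Ioc_union_Ioc_eq_Ioc ht.1.le ht.2]
    _ ≤ ENNReal.ofReal (4 * (t - a) ^ (1 / 4 : ℝ)) + ENNReal.ofReal (4 * (b - t) ^ (1 / 4 : ℝ)) := by
        refine (lintegral_union_le _ _ _).trans ?_
        rw [h1, h3, h2]
    _ ≤ ENNReal.ofReal (4 * (b - a) ^ (1 / 4 : ℝ)) + ENNReal.ofReal (4 * (b - a) ^ (1 / 4 : ℝ)) := by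
        have := ht.1.le
        have := ht.2
        gcongr
    _ = _ := by
        rw [← ENNReal.ofReal_add (by positivity) (by positivity)]
        congr 1
        ring

/-- Schur's test for a symmetric kernel: bound `G(t)G(s)` by half the sum of the squares and
integrate out the other variable. -/
theorem lintegral_ker_mul_le {G : ℝ → ℝ} (hG : Continuous G) {a b : ℝ}
    (hab : a ≤ b) :
    ∫⁻ t in Ioc a b, ∫⁻ s in Ioc a b, ENNReal.ofReal (ker (t - s) * (G t * G s)) ≤
      ENNReal.ofReal (8 * (b - a) ^ (1 / 4 : ℝ) * ∫ t in a..b, G t ^ 2) := by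
  have hba : 0 ≤ b - a := sub_nonneg.mpr hab
  let P : ℝ → ℝ≥0∞ := fun t => ENNReal.ofReal (G t ^ 2 / 2)
  let K : ℝ → ℝ → ℝ≥0∞ := fun t s => ENNReal.ofReal (ker (t - s))
  have hP : Measurable P := ((hG.pow 2).div_const 2).measurable.ennreal_ofReal
  have hK : Measurable (Function.uncurry K) := by
    have h1 : Measurable fun z : ℝ × ℝ => ker (z.1 - z.2) :=
      measurable_ker.comp (measurable_fst.sub measurable_snd)
    exact h1.ennreal_ofReal
  have hK1 : ∀ t, Measurable (K t) := fun t => hK.comp measurable_prodMk_left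
  have pt : ∀ t s, ENNReal.ofReal (ker (t - s) * (G t * G s)) ≤ P t * K t s + P s * K t s := by
    intro t s
    have hk := ker_nonneg (t - s)
    rw [← ENNReal.ofReal_mul (by positivity), ← ENNReal.ofReal_mul (by positivity),
      ← ENNReal.ofReal_add (by positivity) (by positivity)]
    refine ENNReal.ofReal_le_ofReal ?_
    nlinarith [mul_nonneg hk (sq_nonneg (G t - G s))]
  have half : ∫⁻ t in Ioc a b, P t * ENNReal.ofReal (8 * (b - a) ^ (1 / 4 : ℝ)) =
      ENNReal.ofReal (8 * (b - a) ^ (1 / 4 : ℝ) * ((∫ t in a..b, G t ^ 2) / 2)) := by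
    rw [lintegral_mul_const _ hP, lintegral_ofReal_eq (by fun_prop) (fun t => by positivity) hab,
      ← ENNReal.ofReal_mul (by
        exact intervalIntegral.integral_nonneg hab fun t _ => by positivity),
      intervalIntegral.integral_div, mul_comm]
  have a1 : ∫⁻ t in Ioc a b, ∫⁻ s in Ioc a b, P t * K t s ≤
      ENNReal.ofReal (8 * (b - a) ^ (1 / 4 : ℝ) * ((∫ t in a..b, G t ^ 2) / 2)) := by
    rw [← half]
    refine setLIntegral_mono (hP.mul_const _) fun t ht => ?_
    rw [lintegral_const_mul _ (hK1 t)]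
    gcongr
    exact lintegral_ker_le ht
  have a2 : ∫⁻ t in Ioc a b, ∫⁻ s in Ioc a b, P s * K t s ≤
      ENNReal.ofReal (8 * (b - a) ^ (1 / 4 : ℝ) * ((∫ t in a..b, G t ^ 2) / 2)) := by
    rw [lintegral_lintegral_swap ((hP.comp measurable_snd).mul hK).aemeasurable]
    refine le_trans (le_of_eq ?_) a1
    refine lintegral_congr fun t => lintegral_congr fun s => ?_
    simp only [K]
    rw [← ker_neg, neg_sub]
  calc ∫⁻ t in Ioc a b, ∫⁻ s in Ioc a b, ENNReal.ofReal (ker (t - s) * (G t * G s))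
      ≤ ∫⁻ t in Ioc a b, ∫⁻ s in Ioc a b, (P t * K t s + P s * K t s) :=
        lintegral_mono fun t => lintegral_mono fun s => pt t s
    _ = (∫⁻ t in Ioc a b, ∫⁻ s in Ioc a b, P t * K t s) +
        ∫⁻ t in Ioc a b, ∫⁻ s in Ioc a b, P s * K t s := by
        rw [← lintegral_add_left]
        · refine lintegral_congr fun t => ?_
          rw [lintegral_add_left ((hK1 t).const_mul _)]
        · exact Measurable.lintegral_prod_right' (f := fun z : ℝ × ℝ => P z.1 * K z.1 z.2)
            ((hP.comp measurable_fst).mul hK)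
    _ ≤ _ := by
        refine (add_le_add a1 a2).trans_eq ?_
        have : 0 ≤ ∫ t in a..b, G t ^ 2 :=
          intervalIntegral.integral_nonneg hab fun t _ => by positivity
        rw [← ENNReal.ofReal_add (by positivity) (by positivity)]
        congr 1
        ring

theorem n43_nonneg (f : L2) : 0 ≤ n43 f := ENNReal.toReal_nonneg

theorem ae_ne_restrict (t : ℝ) (S : Set ℝ) : ∀ᵐ s ∂(volume.restrict S), s ≠ t :=
  ae_restrict_of_ae (Measure.ae_ne volume t)

theorem enorm_inner_opU_opU_le {f g : L2} (hf : MemLp f (4 / 3) volume)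
    (hg : MemLp g (4 / 3) volume) {s t : ℝ} (h : s ≠ t) :
    ‖(inner ℂ (opU (-t) g) (opU (-s) f) : ℂ)‖ₑ ≤
      ENNReal.ofReal (ker (t - s) * (n43 g * n43 f)) := by
  rw [← ofReal_norm]
  refine ENNReal.ofReal_le_ofReal ?_
  have e : (inner ℂ (opU (-t) g) (opU (-s) f) : ℂ) = inner ℂ g (opU (t - s) f) := by
    rw [← inner_opU, ← opU_add, sub_eq_add_neg]
  rw [e, mul_comm (n43 g)]
  exact norm_inner_opU_le (sub_ne_zero.mpr h.symm) hf hg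

theorem integral_inner_left {a b : ℝ} {φ : ℝ → L2} (hφ : Continuous φ) (x : L2) :
    (inner ℂ x (∫ s in Ioc a b, φ s) : ℂ) = ∫ s in Ioc a b, inner ℂ x (φ s) :=
  (integral_inner (𝕜 := ℂ) hφ.integrableOn_Ioc x).symm

/-- The dual Strichartz estimate. -/
theorem norm_integral_opU_sq_le {φ : ℝ → L2} (hφ : Continuous φ)
    (hm : ∀ t, MemLp (φ t) (4 / 3) volume) {G : ℝ → ℝ} (hG : Continuous G)
    (hφG : ∀ t, n43 (φ t) ≤ G t) {a b : ℝ} (hab : a ≤ b) :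
    ‖∫ s in Ioc a b, opU (-s) (φ s)‖ ^ 2 ≤
      8 * (b - a) ^ (1 / 4 : ℝ) * ∫ t in a..b, G t ^ 2 := by
  have h0 : ∀ t, 0 ≤ G t := fun t => (n43_nonneg _).trans (hφG t)
  have hc : Continuous fun s => opU (-s) (φ s) := continuous_opU_comp continuous_neg hφ
  set Φ := ∫ s in Ioc a b, opU (-s) (φ s)
  have hba : 0 ≤ b - a := sub_nonneg.mpr hab
  have hX : 0 ≤ ∫ t in a..b, G t ^ 2 :=
    intervalIntegral.integral_nonneg hab fun t _ => by positivity
  -- The `TT*` argument: the squared norm becomes a double time integral of pairings at times `t`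
  -- and `s`, each controlled by the dispersive kernel `|t - s|^{-3/4}`.
  have e1 : ‖Φ‖ ^ 2 = ‖(inner ℂ Φ Φ : ℂ)‖ := by
    rw [inner_self_eq_norm_sq_to_K]
    simp
  rw [e1, ← ENNReal.ofReal_le_ofReal_iff (by positivity), ofReal_norm]
  refine le_trans ?_ (lintegral_ker_mul_le hG hab)
  rw [show (inner ℂ Φ Φ : ℂ) = ∫ t in Ioc a b, inner ℂ Φ (opU (-t) (φ t)) from
    integral_inner_left hc Φ]
  refine (enorm_integral_le_lintegral_enorm _).trans (lintegral_mono fun t => ?_)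
  have e2 : ‖(inner ℂ Φ (opU (-t) (φ t)) : ℂ)‖ₑ =
      ‖∫ s in Ioc a b, (inner ℂ (opU (-t) (φ t)) (opU (-s) (φ s)) : ℂ)‖ₑ := by
    rw [← integral_inner_left hc, ← ofReal_norm, ← ofReal_norm, norm_inner_symm]
  rw [e2]
  refine (enorm_integral_le_lintegral_enorm _).trans (lintegral_mono_ae ?_)
  filter_upwards [ae_ne_restrict t (Ioc a b)] with s hs
  refine (enorm_inner_opU_opU_le (hm s) (hm t) hs).trans (ENNReal.ofReal_le_ofReal ?_)
  have := ker_nonneg (t - s)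
  have := n43_nonneg (φ s)
  have := h0 t
  gcongr
  · exact hφG t
  · exact hφG s

/-- The normalized dual function `|v|²v / ‖v‖₄²` of `v = ⟨D⟩⁻¹ k`. -/
def dualFun (k : L2) : L2 := (-(((n4 k ^ 2)⁻¹ : ℝ) : ℂ)) • nl k

theorem memLp_dualFun (k : L2) : MemLp (dualFun k) (4 / 3) volume :=
  (memLp_congr_ae (Lp.coeFn_smul _ _)).mpr ((memLp_nl k).const_smul _)

theorem n43_smul (c : ℂ) (f : L2) : n43 (c • f) = ‖c‖ * n43 f := by
  rw [n43, eLpNorm_congr_ae (Lp.coeFn_smul c f), eLpNorm_const_smul, ENNReal.toReal_mul, n43]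
  simp

/-- Together with `inner_dualFun` this realizes the `L⁴` norm by duality: the dual function has
`L^{4/3}` norm at most `‖v‖₄` and pairs with `v` to `‖v‖₄²`. The minus sign in its definition
cancels the focusing sign. -/
theorem n43_dualFun_le (k : L2) : n43 (dualFun k) ≤ n4 k := by
  have h0 := n4_nonneg k
  rw [dualFun, n43_smul, norm_neg, Complex.norm_real, Real.norm_eq_abs,
    abs_of_nonneg (by positivity)]
  rcases h0.eq_or_lt with h | h
  · rw [← h]
    simp
  · calc (n4 k ^ 2)⁻¹ * n43 (nl k) ≤ (n4 k ^ 2)⁻¹ * n4 k ^ 3 := by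
          gcongr
          exact n43_nl_le k
      _ = n4 k := by field_simp

theorem inner_dualFun (k : L2) : inner ℂ (dualFun k) (opB k) = ((n4 k ^ 2 : ℝ) : ℂ) := by
  rw [dualFun, inner_smul_left, inner_nl, map_neg, Complex.conj_ofReal, ← Complex.ofReal_neg,
    ← Complex.ofReal_mul]
  congr 1
  rcases (n4_nonneg k).eq_or_lt with h | h
  · rw [← h]
    norm_num
  · field_simp

theorem continuous_dualFun_comp {v : ℝ → L2} (hv : Continuous v) (h0 : ∀ t, v t ≠ 0) :
    Continuous fun t => dualFun (v t) := by
  unfold dualFun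
  have h1 : Continuous fun t => (n4 (v t) ^ 2)⁻¹ :=
    ((continuous_n4.comp hv).pow 2).inv₀ fun t => (pow_pos (n4_pos (h0 t)) 2).ne'
  exact (Complex.continuous_ofReal.comp h1).neg.smul (continuous_nl.comp hv)

/-- The local-in-time Strichartz estimate. -/
theorem integral_n4_opU_sq_le (k : L2) {a b : ℝ} (hab : a ≤ b) :
    ∫ t in a..b, n4 (opU t k) ^ 2 ≤ 8 * (b - a) ^ (1 / 4 : ℝ) * ‖opB k‖ ^ 2 := by
  by_cases hk : k = 0
  · simp [hk, n4_zero]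
  have hba : 0 ≤ b - a := sub_nonneg.mpr hab
  -- The normalized dual function is continuous only away from zero; the free flow is isometric, so
  -- a nonzero datum never reaches it.
  have hk' : ∀ t, opU t k ≠ 0 := fun t h => hk (by
    rw [← norm_eq_zero, ← norm_opU t k, h, norm_zero])
  have hg : Continuous fun t => n4 (opU t k) := continuous_n4.comp (continuous_opU k)
  have hφ : Continuous fun t => dualFun (opU t k) := continuous_dualFun_comp (continuous_opU k) hk'
  have key := norm_integral_opU_sq_le hφ (fun t => memLp_dualFun _) hg
    (fun t => n43_dualFun_le _) hab
  set X := ∫ t in a..b, n4 (opU t k) ^ 2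
  have hX : 0 ≤ X := intervalIntegral.integral_nonneg hab fun t _ => by positivity
  set Φ := ∫ s in Ioc a b, opU (-s) (dualFun (opU s k))
  -- Duality: testing the datum on this superposition of dual functions reproduces the space-time
  -- norm, so `X² ≤ ‖opB k‖² · 8(b-a)^{1/4} X` and one factor `X` can be cancelled.
  have e1 : (inner ℂ (opB k) Φ : ℂ) = (X : ℂ) := by
    rw [integral_inner_left (continuous_opU_comp continuous_neg hφ)]
    have : ∀ s, (inner ℂ (opB k) (opU (-s) (dualFun (opU s k))) : ℂ) =
        ((n4 (opU s k) ^ 2 : ℝ) : ℂ) := by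
      intro s
      rw [inner_opU, neg_neg, opU_opB, ← inner_conj_symm, inner_dualFun, Complex.conj_ofReal]
    simp only [this]
    rw [integral_complex_ofReal, ← intervalIntegral.integral_of_le hab]
  have e2 : X ≤ ‖opB k‖ * ‖Φ‖ := by
    have := norm_inner_le_norm (𝕜 := ℂ) (opB k) Φ
    rwa [e1, Complex.norm_real, Real.norm_eq_abs, abs_of_nonneg hX] at this
  rcases hX.eq_or_lt with h | h
  · rw [← h]
    positivity
  · have h2 : X ^ 2 ≤ ‖opB k‖ ^ 2 * (8 * (b - a) ^ (1 / 4 : ℝ) * X) := by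
      calc X ^ 2 ≤ (‖opB k‖ * ‖Φ‖) ^ 2 := by gcongr
        _ = ‖opB k‖ ^ 2 * ‖Φ‖ ^ 2 := by ring
        _ ≤ _ := by gcongr
    have h3 : X * X ≤ (8 * (b - a) ^ (1 / 4 : ℝ) * ‖opB k‖ ^ 2) * X := by linarith
    exact le_of_mul_le_mul_right h3 h

theorem norm_inner_le_n43_mul_n4 {f : L2} (hf : MemLp f (4 / 3) volume) (k : L2) :
    ‖(inner ℂ f (opB k) : ℂ)‖ ≤ n43 f * n4 k := by
  have h1 : ENNReal.HolderTriple (4 / 3) 4 1 := holderTriple_of_toReal (by norm_num) (by norm_num)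
    (by norm_num) (by norm_num)
  have h2 : eLpNorm (fun x => (inner ℂ (f x) (opB k x) : ℂ)) 1 volume ≤
      eLpNorm f (4 / 3) volume * eLpNorm (opB k) 4 volume := by
    have := eLpNorm_smul_le_mul_eLpNorm (p := 4 / 3) (q := 4) (r := 1) (μ := (volume : Measure R3))
      (aestronglyMeasurable_norm (opB k)) (aestronglyMeasurable_norm f)
    rw [eLpNorm_norm, eLpNorm_norm] at this
    refine (eLpNorm_mono fun x => ?_).trans this
    rw [Pi.smul_apply', smul_eq_mul, norm_mul, norm_norm, norm_norm]
    exact norm_inner_le_norm _ _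
  rw [L2.inner_def]
  refine (norm_integral_le_lintegral_norm _).trans ?_
  rw [n43, n4, ← ENNReal.toReal_mul]
  refine ENNReal.toReal_mono (ENNReal.mul_ne_top hf.2.ne (memLp_four k).2.ne) ?_
  simp_rw [ofReal_norm]
  rwa [← eLpNorm_one_eq_lintegral_enorm]

/-! ### Stability of the flow in `L²_t L⁴_x` -/

namespace IsFlow

variable {E : ℝ} {k l : ℝ → L2}

theorem translate (hk : IsFlow E k) (h : R3) : IsFlow E fun t => opT h (k t) := by
  refine ⟨(opT h).continuous.comp hk.continuous, fun t => (norm_opT h _).trans_le (hk.norm_le t),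
    fun t ht => ?_⟩
  have h1 := ((opT h).restrictScalars ℝ).hasFDerivAt.comp_hasDerivWithinAt t (hk.deriv t ht)
  have e : opT h (opL (k t)) = opL (opT h (k t)) := fmul_comm _ _ _
  have h2 : (opT h).restrictScalars ℝ (-Complex.I • (opL (k t) + opB (nl (k t)))) =
      -Complex.I • (opL (opT h (k t)) + opB (nl (opT h (k t)))) := by
    rw [ContinuousLinearMap.coe_restrictScalars', map_smul, map_add, opT_opB, opT_nl, e]
  rw [h2] at h1
  refine h1.congr (fun r _ => ?_) ?_ <;>
  · simp only [Function.comp_apply, ContinuousLinearMap.coe_restrictScalars', opT_opB]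

theorem n4_le_bound (hk : IsFlow E k) (t : ℝ) : n4 (k t) ≤ sobC4 * E :=
  (n4_le _).trans (mul_le_mul_of_nonneg_left (hk.norm_le t) sobC4_pos.le)

theorem duhamel_sub (hk : IsFlow E k) (hl : IsFlow E l) {a t : ℝ} (ha : 0 ≤ a) (hat : a ≤ t) :
    opU (-t) (opB (k t - l t)) = opU (-a) (opB (k a - l a)) +
      ∫ s in Ioc a t, opU (-s) (-Complex.I • (nl (k s) - nl (l s))) := by
  have e : (∫ s in Ioc a t, opU (-s) (-Complex.I • (nl (k s) - nl (l s)))) =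
      (∫ s in a..t, -Complex.I • opU (-s) (nl (k s))) -
        ∫ s in a..t, -Complex.I • opU (-s) (nl (l s)) := by
    rw [← intervalIntegral.integral_sub (hk.continuous_smul_integrand.intervalIntegrable _ _)
      (hl.continuous_smul_integrand.intervalIntegrable _ _), intervalIntegral.integral_of_le hat]
    congr 1
    ext1 s
    rw [map_smul, map_sub, smul_sub]
  rw [e, map_sub, map_sub, map_sub, map_sub, hk.duhamel ha hat, hl.duhamel ha hat]
  abel

end IsFlow

/-- The length of the time intervals on which the stability estimate is proved. -/
def stepLen (E : ℝ) : ℝ := (1 / (32 * (2 * (sobC4 * E)) ^ 2 + 1)) ^ 4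

theorem stepLen_pos (E : ℝ) : 0 < stepLen E := by
  unfold stepLen
  positivity

/-- The step length is chosen so that the Schur factor `8ℓ^{1/4}` times the nonlinear factor `(2 ·
sobC4 · E)²` is at most `1/4`. -/
theorem rpow_le_of_le_stepLen {E ℓ : ℝ} (h0 : 0 ≤ ℓ) (h : ℓ ≤ stepLen E) :
    ℓ ^ (1 / 4 : ℝ) ≤ 1 / (32 * (2 * (sobC4 * E)) ^ 2 + 1) := by
  refine (Real.rpow_le_rpow h0 h (by norm_num)).trans_eq ?_
  rw [stepLen, ← Real.rpow_natCast, ← Real.rpow_mul (by positivity)]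
  norm_num

namespace IsFlow

variable {E : ℝ} {k l : ℝ → L2}

/-- Duhamel for the difference is paired with its dual function at time `t`. Thus the Strichartz
argument only ever handles scalar integrals and never needs an `L⁴`-valued one. -/
theorem n4_sub_sq_le (hk : IsFlow E k) (hl : IsFlow E l) {a b t : ℝ} (ha : 0 ≤ a)
    (ht : t ∈ Ioc a b) :
    ENNReal.ofReal (n4 (k t - l t) ^ 2) ≤
      ENNReal.ofReal (n4 (k t - l t) * n4 (opU (t - a) (k a - l a))) +
        ENNReal.ofReal ((2 * (sobC4 * E)) ^ 2) * ∫⁻ s in Ioc a b,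
          ENNReal.ofReal (ker (t - s) * (n4 (k t - l t) * n4 (k s - l s))) := by
  set ψ := dualFun (k t - l t)
  have hψ := memLp_dualFun (k t - l t)
  have hψ' := n43_dualFun_le (k t - l t)
  have hat := ht.1.le
  have hc : Continuous fun s => opU (-s) (-Complex.I • (nl (k s) - nl (l s))) :=
    continuous_opU_comp continuous_neg (((continuous_nl.comp hk.continuous).sub
      (continuous_nl.comp hl.continuous)).const_smul (-Complex.I))
  have e1 : ((n4 (k t - l t) ^ 2 : ℝ) : ℂ) = inner ℂ ψ (opB (opU (t - a) (k a - l a))) +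
      ∫ s in Ioc a t, inner ℂ (opU (-t) ψ) (opU (-s) (-Complex.I • (nl (k s) - nl (l s)))) := by
    rw [← inner_dualFun, ← integral_inner_left hc,
      ← opU_opB, show t - a = t + -a by ring, opU_add, inner_opU, ← inner_add_right,
      ← hk.duhamel_sub hl ha hat, ← inner_opU, opU_opU_neg]
  have hn := n4_nonneg (k t - l t)
  rw [show ENNReal.ofReal (n4 (k t - l t) ^ 2) = ‖((n4 (k t - l t) ^ 2 : ℝ) : ℂ)‖ₑ by
    rw [← ofReal_norm, Complex.norm_real, Real.norm_eq_abs, abs_of_nonneg (by positivity)], e1]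
  refine (enorm_add_le _ _).trans (add_le_add ?_ ?_)
  · rw [← ofReal_norm]
    refine ENNReal.ofReal_le_ofReal ((norm_inner_le_n43_mul_n4 hψ _).trans ?_)
    exact mul_le_mul_of_nonneg_right hψ' (n4_nonneg _)
  · refine (enorm_integral_le_lintegral_enorm _).trans ?_
    refine (lintegral_mono_set (Ioc_subset_Ioc_right ht.2)).trans ?_
    rw [← lintegral_const_mul' _ _ ENNReal.ofReal_ne_top]
    refine lintegral_mono_ae ?_
    filter_upwards [ae_ne_restrict t (Ioc a b)] with s hs
    have hm : MemLp (-Complex.I • (nl (k s) - nl (l s)) : L2) (4 / 3) volume :=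
      (memLp_congr_ae (Lp.coeFn_smul _ _)).mpr ((memLp_nl_sub _ _).const_smul _)
    refine (enorm_inner_opU_opU_le hm hψ hs).trans ?_
    rw [← ENNReal.ofReal_mul (by positivity)]
    refine ENNReal.ofReal_le_ofReal ?_
    have h1 : n43 (-Complex.I • (nl (k s) - nl (l s))) ≤
        (2 * (sobC4 * E)) ^ 2 * n4 (k s - l s) := by
      rw [n43_smul, norm_neg, Complex.norm_I, one_mul]
      refine (n43_nl_sub_le _ _).trans ?_
      have h2 := hk.n4_le_bound s
      have h3 := hl.n4_le_bound s
      have h4 := n4_nonneg (k s)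
      have h5 := n4_nonneg (l s)
      have h6 := n4_nonneg (k s - l s)
      gcongr
      linarith
    have hker := ker_nonneg (t - s)
    calc ker (t - s) * (n43 ψ * n43 (-Complex.I • (nl (k s) - nl (l s))))
        ≤ ker (t - s) * (n4 (k t - l t) * ((2 * (sobC4 * E)) ^ 2 * n4 (k s - l s))) := by
          gcongr
          exact n43_nonneg _
      _ = _ := by ring

/-- Two bounded solutions stay close in `L²_t L⁴_x` on short time intervals. -/
theorem integral_n4_sub_sq_le (hk : IsFlow E k) (hl : IsFlow E l) {a b : ℝ} (ha : 0 ≤ a)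
    (hab : a ≤ b) (hb : b - a ≤ stepLen E) :
    ∫ t in a..b, n4 (k t - l t) ^ 2 ≤ 16 * ‖opB (k a - l a)‖ ^ 2 := by
  set g : ℝ → ℝ := fun t => n4 (k t - l t)
  set g₀ : ℝ → ℝ := fun t => n4 (opU (t - a) (k a - l a))
  have hg : Continuous g := continuous_n4.comp (hk.continuous.sub hl.continuous)
  have hg₀ : Continuous g₀ := continuous_n4.comp
    ((continuous_opU (k a - l a)).comp (continuous_id.sub continuous_const))
  have gn : ∀ t, 0 ≤ g t := fun t => n4_nonneg _
  have gn₀ : ∀ t, 0 ≤ g₀ t := fun t => n4_nonneg _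
  set A : ℝ := (2 * (sobC4 * E)) ^ 2
  have hA : 0 ≤ A := sq_nonneg _
  set X := ∫ t in a..b, g t ^ 2
  have hba : 0 ≤ b - a := sub_nonneg.mpr hab
  have hX : 0 ≤ X := intervalIntegral.integral_nonneg hab fun t _ => by positivity
  have hr := rpow_le_of_le_stepLen hba hb
  have hr0 : 0 ≤ (b - a) ^ (1 / 4 : ℝ) := by positivity
  have hX₀ : ∫ t in a..b, g₀ t ^ 2 ≤ 8 * (b - a) ^ (1 / 4 : ℝ) * ‖opB (k a - l a)‖ ^ 2 := by
    have h1 := integral_n4_opU_sq_le (opU (-a) (k a - l a)) hab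
    have e : ∀ t, opU t (opU (-a) (k a - l a)) = opU (t - a) (k a - l a) := fun t => by
      rw [← opU_add, ← sub_eq_add_neg]
    simp only [e] at h1
    rwa [← opU_opB, norm_opU] at h1
  have h1 : ENNReal.ofReal X ≤ ENNReal.ofReal (∫ t in a..b, g t * g₀ t) +
      ENNReal.ofReal A * ENNReal.ofReal (8 * (b - a) ^ (1 / 4 : ℝ) * X) := by
    rw [← lintegral_ofReal_eq (F := fun t => g t ^ 2) (hg.pow 2) (fun t => sq_nonneg (g t)) hab,
      ← lintegral_ofReal_eq (F := fun t => g t * g₀ t) (hg.mul hg₀)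
        (fun t => mul_nonneg (gn t) (gn₀ t)) hab]
    refine le_trans ?_ (add_le_add le_rfl (mul_le_mul' le_rfl (lintegral_ker_mul_le hg hab)))
    have hm : Measurable fun t => ENNReal.ofReal (g t * g₀ t) :=
      (hg.mul hg₀).measurable.ennreal_ofReal
    rw [← lintegral_const_mul' _ _ ENNReal.ofReal_ne_top, ← lintegral_add_left hm]
    exact setLIntegral_mono' measurableSet_Ioc fun t ht => hk.n4_sub_sq_le hl ha ht
  have hgg : 0 ≤ ∫ t in a..b, g t * g₀ t :=
    intervalIntegral.integral_nonneg hab fun t _ => mul_nonneg (gn t) (gn₀ t)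
  rw [← ENNReal.ofReal_mul hA, ← ENNReal.ofReal_add hgg (by positivity),
    ENNReal.ofReal_le_ofReal_iff (by positivity)] at h1
  -- Young absorbs a quarter of `X`, and the short interval gives another quarter from the nonlinear
  -- term. Hence `X ≤ 2 ∫ g₀²`, and Strichartz supplies the factor `8`.
  have h2 : ∫ t in a..b, g t * g₀ t ≤ X / 4 + ∫ t in a..b, g₀ t ^ 2 := by
    have c1 : Continuous fun t => g t ^ 2 / 4 := by fun_prop
    have c2 : Continuous fun t => g₀ t ^ 2 := by fun_prop
    rw [← intervalIntegral.integral_div, ← intervalIntegral.integral_add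
      (c1.intervalIntegrable _ _) (c2.intervalIntegrable _ _)]
    refine intervalIntegral.integral_mono hab ((hg.mul hg₀).intervalIntegrable _ _)
      ((c1.add c2).intervalIntegrable _ _) fun t => ?_
    change g t * g₀ t ≤ g t ^ 2 / 4 + g₀ t ^ 2
    nlinarith [sq_nonneg (g t / 2 - g₀ t)]
  have h3 : A * (8 * (b - a) ^ (1 / 4 : ℝ)) ≤ 1 / 4 := by
    have hp : (0 : ℝ) < 32 * A + 1 := by positivity
    calc A * (8 * (b - a) ^ (1 / 4 : ℝ)) ≤ A * (8 * (1 / (32 * A + 1))) := by gcongr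
      _ ≤ 1 / 4 := by
        rw [show A * (8 * (1 / (32 * A + 1))) = 8 * A / (32 * A + 1) by ring, div_le_iff₀ hp]
        linarith
  have h4 : A * (8 * (b - a) ^ (1 / 4 : ℝ) * X) ≤ 1 / 4 * X := by
    rw [← mul_assoc]
    gcongr
  have h5 : (b - a) ^ (1 / 4 : ℝ) ≤ 1 := by
    refine hr.trans ?_
    rw [div_le_one (by positivity)]
    linarith
  have h6 : 8 * (b - a) ^ (1 / 4 : ℝ) * ‖opB (k a - l a)‖ ^ 2 ≤ 8 * 1 * ‖opB (k a - l a)‖ ^ 2 := by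
    gcongr
  linarith

/-- The constant in the bound for translation differences. -/
def _root_.CubicNLS.transC (E τ : ℝ) : ℝ :=
  ⌈τ / stepLen E⌉₊ * (16 * (2 * Real.pi * E) ^ 2)

theorem _root_.CubicNLS.transC_nonneg (E τ : ℝ) : 0 ≤ transC E τ := by
  unfold transC
  positivity

/-- Persistence of regularity: the bound for the differences of a solution and its translates. -/
theorem integral_n4_translate_le (hk : IsFlow E k) (h : R3) {a τ : ℝ} (ha : 0 ≤ a) (hτ : 0 ≤ τ) :
    ∫ t in a..(a + τ), n4 (opT h (k t) - k t) ^ 2 ≤ transC E τ * ‖h‖ ^ 2 := by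
  have hs := stepLen_pos E
  have hE := hk.nonneg
  have hc : Continuous fun t => n4 (opT h (k t) - k t) ^ 2 :=
    (continuous_n4.comp ((hk.translate h).continuous.sub hk.continuous)).pow 2
  have hb : ∀ t, ‖opB (opT h (k t) - k t)‖ ^ 2 ≤ (2 * Real.pi * E) ^ 2 * ‖h‖ ^ 2 := by
    intro t
    rw [← mul_pow]
    refine pow_le_pow_left₀ (norm_nonneg _) ((norm_opT_sub_opB_le h _).trans ?_) 2
    have := hk.norm_le t
    calc 2 * Real.pi * ‖h‖ * ‖k t‖ ≤ 2 * Real.pi * ‖h‖ * E := by gcongr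
      _ = _ := by ring
  -- Each short interval restarts from the a priori `H¹` bound rather than from the end of the
  -- previous one, so the constant grows linearly in the number of intervals.
  have step : ∀ n : ℕ, ∫ t in a..(a + n * stepLen E), n4 (opT h (k t) - k t) ^ 2 ≤
      n * (16 * (2 * Real.pi * E) ^ 2) * ‖h‖ ^ 2 := by
    intro n
    induction n with
    | zero => simp
    | succ n ih =>
      have h1 : 0 ≤ a + n * stepLen E := by positivity
      have h2 := (hk.translate h).integral_n4_sub_sq_le hk h1
        (b := a + (n + 1 : ℕ) * stepLen E) (by push_cast; linarith)
        (by push_cast; linarith)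
      rw [← intervalIntegral.integral_add_adjacent_intervals (hc.intervalIntegrable _ _)
        (hc.intervalIntegrable _ _)]
      have h3 := hb (a + n * stepLen E)
      push_cast at h2 ⊢
      linarith
  refine le_trans ?_ (step ⌈τ / stepLen E⌉₊)
  refine intervalIntegral.integral_mono_interval le_rfl (by linarith) ?_
    (Eventually.of_forall fun t => by positivity) (hc.intervalIntegrable _ _)
  have := (div_le_iff₀ hs).mp (Nat.le_ceil (τ / stepLen E))
  linarith

end IsFlow

/-! ### The sup norm -/

/-- A majorant of the sup norm of `⟨D⟩⁻¹ k`. -/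
def supB (k : L2) : ℝ≥0∞ :=
  ballC * (ENNReal.ofReal (n4 k) + ∑ j, liminf (fun n => dq4 j n k) atTop)

theorem eLpNorm_top_le_supB (k : L2) : eLpNorm (opB k) ∞ volume ≤ supB k := eLpNorm_top_le k

theorem continuous_dq4_comp {j : Fin 3} {n : ℕ} {k : ℝ → L2} (hk : Continuous k) :
    Continuous fun t => dq4 j n (k t) :=
  ENNReal.continuous_ofReal.comp (continuous_const.mul
    (continuous_n4.comp (((opT _).continuous.comp hk).sub hk)))

theorem measurable_supB_comp {k : ℝ → L2} (hk : Continuous k) : Measurable fun t => supB (k t) := by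
  have h1 : Measurable fun t => ENNReal.ofReal (n4 (k t)) :=
    (continuous_n4.comp hk).measurable.ennreal_ofReal
  have h2 : Measurable fun t => ∑ j, liminf (fun n => dq4 j n (k t)) atTop :=
    Finset.measurable_fun_sum _ fun j _ =>
      Measurable.liminf fun n => (continuous_dq4_comp hk).measurable
  exact (h1.add h2).const_mul ballC

/-- Fatou in time; it turns bounds for the difference quotients, uniform in the step, into a bound
for their lower limit. -/
theorem lintegral_liminf_sq_le {f : ℕ → ℝ → ℝ≥0∞} (hf : ∀ n, Measurable (f n)) (S : Set ℝ)
    {C : ℝ≥0∞} (hC : ∀ n, ∫⁻ t in S, f n t ^ 2 ≤ C) :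
    ∫⁻ t in S, (liminf (fun n => f n t) atTop) ^ 2 ≤ C := by
  have e : ∀ t, (liminf (fun n => f n t) atTop) ^ 2 = liminf (fun n => f n t ^ 2) atTop := fun t =>
    Monotone.map_liminf_of_continuousAt (f := fun x : ℝ≥0∞ => x ^ 2)
      (fun x y h => pow_le_pow_left' h 2) _ (ENNReal.continuous_pow 2).continuousAt
  simp only [e]
  refine (lintegral_liminf_le fun n => (hf n).pow_const 2).trans ?_
  exact liminf_le_of_le (by isBoundedDefault) fun b hb => by
    obtain ⟨n, hn⟩ := hb.exists
    exact hn.trans (hC n)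

theorem lintegral_dq4_sq_le {k : ℝ → L2} (hk : Continuous k) {a b P : ℝ} (hab : a ≤ b)
    (hP : ∀ h, ∫ t in a..b, n4 (opT h (k t) - k t) ^ 2 ≤ P * ‖h‖ ^ 2) (j : Fin 3) (n : ℕ) :
    ∫⁻ t in Ioc a b, dq4 j n (k t) ^ 2 ≤ ENNReal.ofReal P := by
  have hc : Continuous fun t => n4 (opT (step j n) (k t) - k t) :=
    continuous_n4.comp (((opT _).continuous.comp hk).sub hk)
  have e : ∀ t, dq4 j n (k t) ^ 2 =
      ENNReal.ofReal (((n : ℝ) + 1) ^ 2 * n4 (opT (step j n) (k t) - k t) ^ 2) := by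
    intro t
    have := n4_nonneg (opT (step j n) (k t) - k t)
    rw [dq4, ← ENNReal.ofReal_pow (by positivity), mul_pow]
  simp only [e]
  rw [lintegral_ofReal_eq (by fun_prop) (fun t => by positivity) hab,
    intervalIntegral.integral_const_mul]
  refine ENNReal.ofReal_le_ofReal ?_
  have h1 := hP (step j n)
  rw [norm_step] at h1
  calc ((n : ℝ) + 1) ^ 2 * ∫ t in a..b, n4 (opT (step j n) (k t) - k t) ^ 2
      ≤ ((n : ℝ) + 1) ^ 2 * (P * (1 / ((n : ℝ) + 1)) ^ 2) := by gcongr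
    _ = P := by
      have : (n : ℝ) + 1 ≠ 0 := by positivity
      field_simp

/-- Square integrability in time of the sup norm, from Morrey's inequality and the translation
bounds. -/
theorem lintegral_supB_sq_lt_top {k : ℝ → L2} (hk : Continuous k) {a b P M : ℝ} (hab : a ≤ b)
    (hM : ∀ t, n4 (k t) ≤ M)
    (hP : ∀ h, ∫ t in a..b, n4 (opT h (k t) - k t) ^ 2 ≤ P * ‖h‖ ^ 2) :
    ∫⁻ t in Ioc a b, supB (k t) ^ 2 ≤
      ballC ^ 2 * (4 * (ENNReal.ofReal (M ^ 2) * ENNReal.ofReal (b - a) +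
        3 * ENNReal.ofReal P)) := by
  have m1 : ∀ j, Measurable fun t => liminf (fun n => dq4 j n (k t)) atTop := fun j =>
    Measurable.liminf fun n => (continuous_dq4_comp hk).measurable
  have pt : ∀ t, supB (k t) ^ 2 ≤ ballC ^ 2 * (4 * (ENNReal.ofReal (M ^ 2) +
      ∑ j, (liminf (fun n => dq4 j n (k t)) atTop) ^ 2)) := by
    intro t
    rw [supB, mul_pow]
    gcongr
    -- Cauchy–Schwarz for four terms: the `L⁴` norm and the three directions.
    have h4 : ∀ x y z w : ℝ≥0∞, (x + (y + z + w)) ^ 2 ≤ 4 * (x ^ 2 + (y ^ 2 + z ^ 2 + w ^ 2)) := by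
      intro x y z w
      have h := ENNReal.inner_le_Lp_mul_Lq Finset.univ (fun _ : Fin 4 => (1 : ℝ≥0∞)) ![x, y, z, w]
        Real.HolderConjugate.two_two
      simp only [Fin.sum_univ_four, one_mul, ENNReal.one_rpow, Matrix.cons_val] at h
      have h' := pow_le_pow_left' h 2
      rw [mul_pow, ← ENNReal.rpow_natCast, ← ENNReal.rpow_natCast, ← ENNReal.rpow_natCast,
        ← ENNReal.rpow_mul, ← ENNReal.rpow_mul] at h'
      norm_num at h'
      rw [show x + (y + z + w) = x + y + z + w by ring]
      refine h'.trans_eq ?_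
      ring
    rw [Fin.sum_univ_three, Fin.sum_univ_three]
    refine (h4 _ _ _ _).trans ?_
    gcongr
    rw [← ENNReal.ofReal_pow (n4_nonneg _)]
    have := n4_nonneg (k t)
    have := hM t
    gcongr
  refine (lintegral_mono pt).trans ?_
  have hb2 : ballC ^ 2 ≠ ∞ := ENNReal.pow_ne_top ballC_ne_top
  rw [lintegral_const_mul' _ _ hb2, lintegral_const_mul' _ _ (by norm_num), lintegral_add_left
    measurable_const, lintegral_finsetSum _ (fun j _ => (m1 j).pow_const 2)]
  gcongr
  · simp
  · refine (Finset.sum_le_card_nsmul _ _ (ENNReal.ofReal P) fun j _ => ?_).trans_eq (by simp)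
    exact lintegral_liminf_sq_le (fun n => (continuous_dq4_comp hk).measurable) _
      fun n => lintegral_dq4_sq_le hk hab hP j n

/-! ### Decay of the free evolution -/

/-- Maps that are Lipschitz in `k` with a common constant converge to zero on a closed set of `k`,
so checking a dense set is enough. -/
theorem tendsto_zero_of_dense {ι : Type*} {ℱ : Filter ι} {V : Type*} [NormedAddCommGroup V]
    {F : ι → L2 → V} {C : ℝ} (hF : ∀ i k l, ‖F i k - F i l‖ ≤ C * ‖k - l‖) :
    IsClosed {k | Tendsto (fun i => F i k) ℱ (𝓝 0)} := by
  refine isClosed_of_closure_subset fun k hk => ?_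
  have hC : 0 ≤ |C| := abs_nonneg C
  change Tendsto (fun i => F i k) ℱ (𝓝 0)
  rw [Metric.tendsto_nhds]
  intro ε hε
  obtain ⟨l, hl, hd⟩ := Metric.mem_closure_iff.mp hk (ε / (2 * (|C| + 1))) (by positivity)
  have hl' : Tendsto (fun i => F i l) ℱ (𝓝 0) := hl
  filter_upwards [Metric.tendsto_nhds.mp hl' (ε / 2) (by positivity)] with i hi
  rw [dist_zero_right] at hi ⊢
  rw [dist_eq_norm] at hd
  have h1 : ‖F i k - F i l‖ ≤ ε / 2 := by
    refine (hF i k l).trans ?_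
    calc C * ‖k - l‖ ≤ (|C| + 1) * ‖k - l‖ := by
          gcongr
          linarith [le_abs_self C]
      _ ≤ (|C| + 1) * (ε / (2 * (|C| + 1))) := by gcongr
      _ = ε / 2 := by field_simp
  calc ‖F i k‖ = ‖(F i k - F i l) + F i l‖ := by rw [sub_add_cancel]
    _ ≤ _ := norm_add_le _ _
    _ < ε := by linarith

theorem n4_opU_le {k : L2} (hk : MemLp (opB k) (4 / 3) volume) {t : ℝ} (ht : t ≠ 0) :
    n4 (opU t k) ≤ |t| ^ (-(3 / 4) : ℝ) * n43 (opB k) := by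
  rcases (n4_nonneg (opU t k)).eq_or_lt with h | h
  · rw [← h]
    exact mul_nonneg (by positivity) (n43_nonneg _)
  · have h1 : n4 (opU t k) ^ 2 ≤ |t| ^ (-(3 / 4) : ℝ) * (n43 (opB k) * n43 (dualFun (opU t k))) := by
      have h2 := norm_inner_opU_le ht hk (memLp_dualFun (opU t k))
      rwa [opU_opB, inner_dualFun, Complex.norm_real, Real.norm_eq_abs,
        abs_of_nonneg (by positivity)] at h2
    have h3 : n4 (opU t k) ^ 2 ≤ |t| ^ (-(3 / 4) : ℝ) * (n43 (opB k) * n4 (opU t k)) := by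
      refine h1.trans ?_
      have := n43_nonneg (opB k)
      gcongr
      exact n43_dualFun_le _
    refine le_of_mul_le_mul_right ?_ h
    linarith

theorem memLp_opB_schwartz (φ : 𝓢(R3, ℂ)) (p : ℝ≥0∞) : MemLp (opB (φ.toLp 2)) p volume := by
  have e : opB (φ.toLp 2) = (SchwartzMap.fourierMultiplierCLM ℂ (symB : R3 → ℂ) φ).toLp 2 :=
    fmul_toLp symB_tg φ
  rw [e]
  exact (memLp_congr_ae (SchwartzMap.coeFn_toLp _ 2 volume)).mpr (SchwartzMap.memLp _ p volume)

theorem tendsto_rpow_neg_atTop_abs {r : ℝ} (hr : 0 < r) :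
    Tendsto (fun t : ℝ => |t| ^ (-r)) atTop (𝓝 0) :=
  (tendsto_rpow_neg_atTop hr).comp tendsto_abs_atTop_atTop

/-- Schwartz data decay like `t^{-3/4}` by the dispersive estimate. The general case follows by
density, the `L⁴` norm being Lipschitz and the flow isometric in `H¹`. -/
theorem tendsto_n4_opU (k : L2) : Tendsto (fun t => n4 (opU t k)) atTop (𝓝 0) := by
  refine schwartz_dense (p := fun k => Tendsto (fun t => n4 (opU t k)) atTop (𝓝 0))
    (tendsto_zero_of_dense (C := sobC4) fun t k l => ?_) (fun φ => ?_) k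
  · rw [Real.norm_eq_abs]
    refine (abs_n4_sub_le _ _).trans_eq ?_
    rw [← map_sub, norm_opU]
  · have h := (tendsto_rpow_neg_atTop_abs (r := 3 / 4) (by norm_num)).mul_const
      (n43 (opB (φ.toLp 2)))
    rw [zero_mul] at h
    refine squeeze_zero' (Eventually.of_forall fun t => n4_nonneg _) ?_ h
    filter_upwards [eventually_gt_atTop 0] with t ht
    exact n4_opU_le (memLp_opB_schwartz φ _) ht.ne'

/-! ### Difference quotients of free solutions. -/

theorem opT_add (h h' : R3) (g : L2) : opT (h + h') g = opT h (opT h' g) := by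
  have e : symT (h + h') = symT h * symT h' := by
    ext ξ
    rw [BoundedContinuousFunction.mul_apply, symT_apply, symT_apply, symT_apply, inner_add_left,
      AddChar.map_add_eq_mul, Circle.coe_mul]
  rw [opT, e, fmul_mul]
  rfl

/-- Telescoping along the translates, whose `L⁴` norms agree; it lets a long step be compared with
arbitrarily short ones. -/
theorem n4_opT_nsmul_sub_le (h : R3) (x : L2) (m : ℕ) :
    n4 (opT ((m : ℝ) • h) x - x) ≤ m * n4 (opT h x - x) := by
  induction m with
  | zero =>
    have e : opT (0 : R3) x = x := by
      have : symT 0 = 1 := by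
        ext ξ
        rw [symT_apply, inner_zero_left, AddChar.map_zero_eq_one]
        rfl
      rw [opT, this, fmul_one]
    simp [e, n4_zero]
  | succ m ih =>
    have e : opT (((m + 1 : ℕ) : ℝ) • h) x - x =
        opT h (opT ((m : ℝ) • h) x - x) + (opT h x - x) := by
      rw [show ((m + 1 : ℕ) : ℝ) • h = h + (m : ℝ) • h by push_cast; module, opT_add, map_sub]
      abel
    rw [e]
    refine (n4_add_le _ _).trans ?_
    rw [n4_opT]
    push_cast
    linarith

theorem tendsto_difference_quotient (j : Fin 3) (l : L2) :
    Tendsto (fun n : ℕ => ((((n : ℝ) + 1 : ℝ)) : ℂ) • (opT (step j n) (opB l) - opB l)) atTop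
      (𝓝 (opD j l)) := by
  let σ : ℕ → R3 →ᵇ ℂ := fun n =>
    ((((n : ℝ) + 1 : ℝ)) : ℂ) • ((symT (step j n) + (-1 : ℂ) • 1) * symB)
  have hσ : ∀ n ξ, σ n ξ = ((((n : ℝ) + 1 : ℝ)) : ℂ) * ((symT (step j n) ξ - 1) * symB ξ) := by
    intro n ξ
    change ((((n : ℝ) + 1 : ℝ)) : ℂ) * ((symT (step j n) ξ + (-1 : ℂ) * 1) * symB ξ) = _
    ring
  have e1 : ∀ n : ℕ, ((((n : ℝ) + 1 : ℝ)) : ℂ) • (opT (step j n) (opB l) - opB l) =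
      fmul (σ n) l := by
    intro n
    rw [fmul_smul, fmul_mul, fmul_add, fmul_smul, fmul_one, neg_one_smul, sub_eq_add_neg]
    rfl
  simp only [e1]
  have hin : ∀ n ξ, (inner ℝ (step j n) ξ : ℝ) = 1 / ((n : ℝ) + 1) * ξ j := by
    intro n ξ
    rw [step, EuclideanSpace.inner_single_left]
    simp
  refine tendsto_fmul (C := 2 * Real.pi) (fun n ξ => ?_) (fun ξ => ?_) l
  · rw [hσ, norm_mul, norm_mul, Complex.norm_real, Real.norm_eq_abs,
      abs_of_pos (by positivity : (0 : ℝ) < (n : ℝ) + 1)]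
    have h1 := norm_symT_sub_one_le (step j n) ξ
    rw [hin, abs_mul, abs_of_pos (by positivity : (0 : ℝ) < 1 / ((n : ℝ) + 1))] at h1
    have h2 : |ξ j| * ‖symB ξ‖ ≤ 1 := by
      have hs := norm_symB_sq ξ
      have h3 : |ξ j| ≤ ‖ξ‖ := by
        simpa using PiLp.norm_apply_le ξ j
      have h4 : (|ξ j| * ‖symB ξ‖) ^ 2 ≤ 1 := by
        rw [mul_pow, hs]
        calc |ξ j| ^ 2 * (1 + ‖ξ‖ ^ 2)⁻¹ ≤ ‖ξ‖ ^ 2 * (1 + ‖ξ‖ ^ 2)⁻¹ := by gcongr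
          _ ≤ 1 := by
            rw [mul_inv_le_iff₀ (one_le_bracket ξ)]
            linarith
      exact (sq_le_one_iff₀ (by positivity)).mp h4
    calc ((n : ℝ) + 1) * (‖symT (step j n) ξ - 1‖ * ‖symB ξ‖)
        ≤ ((n : ℝ) + 1) * (2 * Real.pi * (1 / ((n : ℝ) + 1) * |ξ j|) * ‖symB ξ‖) := by gcongr
      _ = 2 * Real.pi * (|ξ j| * ‖symB ξ‖) := by
        have : (n : ℝ) + 1 ≠ 0 := by positivity
        field_simp
      _ ≤ 2 * Real.pi * 1 := by gcongr
      _ = _ := mul_one _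
  · have hd : HasDerivAt (fun s : ℝ => (Real.fourierChar (s * ξ j) : ℂ))
        ((2 * Real.pi * ξ j : ℝ) * Complex.I) 0 := by
      simp only [Real.fourierChar_apply]
      have h1 : HasDerivAt (fun s : ℝ => ((2 * Real.pi * (s * ξ j) : ℝ) : ℂ) * Complex.I)
          ((2 * Real.pi * ξ j : ℝ) * Complex.I) 0 := by
        have h0 : HasDerivAt (fun s : ℝ => 2 * Real.pi * (s * ξ j)) (2 * Real.pi * ξ j) 0 := by
          simpa using ((hasDerivAt_id (0 : ℝ)).mul_const (ξ j)).const_mul (2 * Real.pi)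
        exact h0.ofReal_comp.mul_const Complex.I
      simpa using h1.cexp
    have hn : Tendsto (fun n : ℕ => 1 / ((n : ℝ) + 1)) atTop (𝓝[≠] 0) := by
      rw [tendsto_nhdsWithin_iff]
      exact ⟨tendsto_one_div_add_atTop_nhds_zero_nat,
        Eventually.of_forall fun n => by simp only [mem_compl_iff, mem_singleton_iff]; positivity⟩
    have h2 := (hd.tendsto_slope_zero.comp hn).mul_const (symB ξ)
    have e2 : symD j ξ = (2 * Real.pi * ξ j : ℝ) * Complex.I * symB ξ := by
      rw [symD_apply]
      push_cast
      ring
    rw [e2]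
    refine h2.congr fun n => ?_
    simp only [Function.comp_apply, zero_add, zero_mul, AddChar.map_zero_eq_one, Circle.coe_one]
    rw [hσ, symT_apply, hin, one_div, inv_inv, Complex.real_smul]
    ring

/-- The `L⁴` difference quotient is bounded by the derivative. -/
theorem n4_difference_quotient_le (j : Fin 3) (n : ℕ) (l : L2) :
    ((n : ℝ) + 1) * n4 (opT (step j n) (opB l) - opB l) ≤ n4 (opD j l) := by
  -- With `q m + 1 = (m+1)(n+1)` the step `1/(n+1)` consists of `m+1` steps of length `1/(q m + 1)`.
  -- Letting `m → ∞` replaces the short quotient by the derivative.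
  let q : ℕ → ℕ := fun m => (m + 1) * (n + 1) - 1
  have hq : ∀ m, ((q m : ℕ) : ℝ) + 1 = ((m : ℝ) + 1) * ((n : ℝ) + 1) := by
    intro m
    have : q m + 1 = (m + 1) * (n + 1) := Nat.sub_add_cancel (by nlinarith [m.zero_le, n.zero_le])
    exact_mod_cast this
  have hqt : Tendsto q atTop atTop := by
    refine tendsto_atTop_mono (fun m => ?_) tendsto_id
    have h1 : m + 1 ≤ (m + 1) * (n + 1) := Nat.le_mul_of_pos_right _ (Nat.succ_pos n)
    simp only [q, id]
    omega
  have h1 := (continuous_n4.tendsto _).comp ((tendsto_difference_quotient j l).comp hqt)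
  refine ge_of_tendsto' h1 fun m => ?_
  simp only [Function.comp_apply]
  have hp : (0 : ℝ) < (q m : ℝ) + 1 := by positivity
  rw [n4_smul, Complex.norm_real, Real.norm_eq_abs, abs_of_pos hp, hq]
  have e : step j n = ((m + 1 : ℕ) : ℝ) • step j (q m) := by
    rw [step_eq_smul, step_eq_smul, smul_smul, hq]
    congr 1
    push_cast
    field_simp
  have h2 := n4_opT_nsmul_sub_le (step j (q m)) (opB l) (m + 1)
  rw [← e] at h2
  calc ((n : ℝ) + 1) * n4 (opT (step j n) (opB l) - opB l)
      ≤ ((n : ℝ) + 1) * (((m + 1 : ℕ) : ℝ) * n4 (opT (step j (q m)) (opB l) - opB l)) := by gcongr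
    _ = _ := by push_cast; ring

theorem integral_n4_opU_translate_le (k : L2) (h : R3) {a b : ℝ} (hab : a ≤ b) :
    ∫ t in a..b, n4 (opT h (opU t k) - opU t k) ^ 2 ≤
      8 * (b - a) ^ (1 / 4 : ℝ) * (2 * Real.pi * ‖k‖) ^ 2 * ‖h‖ ^ 2 := by
  have hba : 0 ≤ b - a := sub_nonneg.mpr hab
  have h1 := integral_n4_opU_sq_le (opT h k - k) hab
  have e : ∀ t, opU t (opT h k - k) = opT h (opU t k) - opU t k := fun t => by
    rw [map_sub, opT_opU]
  simp only [e] at h1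
  refine h1.trans ?_
  rw [mul_assoc _ _ (‖h‖ ^ 2), ← mul_pow]
  have := norm_opT_sub_opB_le h k
  gcongr
  linarith

/-- For a self-adjoint operator the orthogonal complement of the range is the kernel, which is
trivial here. -/
theorem dense_range_opB : Dense (range opB) := by
  have h : (opB.range : Submodule ℂ L2).topologicalClosure = ⊤ := by
    rw [Submodule.topologicalClosure_eq_top_iff, Submodule.eq_bot_iff]
    intro v hv
    refine opB_injective ?_
    rw [map_zero]
    refine ext_inner_left ℂ fun l => ?_
    rw [inner_opB, inner_zero_right]
    exact (Submodule.mem_orthogonal _ _).mp hv _ ⟨l, rfl⟩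
  exact Submodule.dense_iff_topologicalClosure_eq_top.mpr h

theorem opB_induction {p : L2 → Prop} (hp : IsClosed {g | p g}) (h : ∀ l, p (opB l)) (g : L2) :
    p g := by
  have hs : closure (range opB) ⊆ {g | p g} := hp.closure_subset_iff.mpr (by
    rintro _ ⟨l, rfl⟩
    exact h l)
  exact hs (dense_range_opB g)

/-- The difference quotients of a free solution tend to zero in `L²_t L⁴_x([T, T + τ])`, uniformly
in the step. -/
theorem eventually_integral_n4_opU_dq_le (k : L2) {τ : ℝ} (hτ : 0 ≤ τ) {ε : ℝ} (hε : 0 < ε) :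
    ∀ᶠ T in atTop, ∀ (j : Fin 3) (n : ℕ), ∫ t in T..(T + τ),
      (((n : ℝ) + 1) * n4 (opT (step j n) (opU t k) - opU t k)) ^ 2 ≤ ε := by
  set Q : ℝ := 2 * (8 * τ ^ (1 / 4 : ℝ) * (2 * Real.pi) ^ 2) + 1
  have hQ : 0 < Q := by positivity
  -- Split `k` into a smoother part `opB l` and a small rest. For the first, quotients are bounded
  -- by a derivative whose `L⁴` norm decays in time; for the rest, Strichartz is uniform in `T`.
  -- Neither bound depends on the step.
  obtain ⟨l, hl⟩ : ∃ l, ‖k - opB l‖ ^ 2 ≤ ε / (2 * Q) := by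
    obtain ⟨_, ⟨l, rfl⟩, hl⟩ := Metric.mem_closure_iff.mp (dense_range_opB k)
      (Real.sqrt (ε / (2 * Q))) (by positivity)
    rw [dist_eq_norm] at hl
    exact ⟨l, (Real.le_sqrt (norm_nonneg _) (by positivity)).mp hl.le⟩
  set δ : ℝ := ε / (4 * (τ + 1))
  have hδ : 0 < δ := by positivity
  have hsmall : ∀ᶠ t in atTop, ∀ j, n4 (opU t (opD j l)) ^ 2 ≤ δ := by
    rw [eventually_all]
    intro j
    have := (tendsto_n4_opU (opD j l)).pow 2
    rw [zero_pow two_ne_zero] at this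
    exact this.eventually (eventually_le_nhds hδ)
  obtain ⟨T₀, hT₀⟩ := eventually_atTop.mp hsmall
  filter_upwards [eventually_ge_atTop T₀] with T hT j n
  have hTτ : T ≤ T + τ := by linarith
  set h := step j n
  have hN : (0 : ℝ) < (n : ℝ) + 1 := by positivity
  have c : ∀ x : L2, Continuous fun t => (((n : ℝ) + 1) * n4 (opT h (opU t x) - opU t x)) ^ 2 :=
    fun x => (continuous_const.mul (continuous_n4.comp (((opT h).continuous.comp
      (continuous_opU x)).sub (continuous_opU x)))).pow 2
  have e2 : ∫ t in T..(T + τ), (((n : ℝ) + 1) *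
      n4 (opT h (opU t (k - opB l)) - opU t (k - opB l))) ^ 2 ≤ ε / (4 * 1) := by
    have h1 := integral_n4_opU_translate_le (k - opB l) h hTτ
    rw [norm_step, add_sub_cancel_left] at h1
    simp only [mul_pow _ (n4 _)]
    rw [intervalIntegral.integral_const_mul]
    calc ((n : ℝ) + 1) ^ 2 * ∫ t in T..(T + τ),
          n4 (opT h (opU t (k - opB l)) - opU t (k - opB l)) ^ 2
        ≤ ((n : ℝ) + 1) ^ 2 * (8 * τ ^ (1 / 4 : ℝ) * (2 * Real.pi * ‖k - opB l‖) ^ 2 *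
            (1 / ((n : ℝ) + 1)) ^ 2) := by gcongr
      _ = (8 * τ ^ (1 / 4 : ℝ) * (2 * Real.pi) ^ 2) * ‖k - opB l‖ ^ 2 := by
        field_simp
      _ ≤ (Q / 2) * (ε / (2 * Q)) := by
        gcongr
        simp only [Q]
        linarith
      _ = _ := by
        field_simp
        norm_num
  have e1 : ∫ t in T..(T + τ), (((n : ℝ) + 1) *
      n4 (opT h (opU t (opB l)) - opU t (opB l))) ^ 2 ≤ ε / 4 := by
    calc ∫ t in T..(T + τ), (((n : ℝ) + 1) * n4 (opT h (opU t (opB l)) - opU t (opB l))) ^ 2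
        ≤ ∫ _ in T..(T + τ), δ := by
          refine intervalIntegral.integral_mono_on hTτ ((c _).intervalIntegrable _ _)
            (by simp) fun t ht => ?_
          refine le_trans ?_ (hT₀ t (hT.trans ht.1) j)
          refine pow_le_pow_left₀ (mul_nonneg hN.le (n4_nonneg _)) ?_ 2
          have h2 := n4_difference_quotient_le j n (opU t l)
          rw [← opU_opB] at h2
          refine h2.trans_eq ?_
          congr 1
          exact fmul_comm _ _ _
      _ = τ * δ := by simp
      _ ≤ _ := by
        rw [show δ = ε / 4 / (τ + 1) by simp only [δ]; field_simp, mul_div_assoc',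
          div_le_iff₀ (by positivity)]
        nlinarith
  calc ∫ t in T..(T + τ), (((n : ℝ) + 1) * n4 (opT h (opU t k) - opU t k)) ^ 2
      ≤ ∫ t in T..(T + τ), (2 * (((n : ℝ) + 1) * n4 (opT h (opU t (opB l)) - opU t (opB l))) ^ 2 +
        2 * (((n : ℝ) + 1) * n4 (opT h (opU t (k - opB l)) - opU t (k - opB l))) ^ 2) := by
        refine intervalIntegral.integral_mono hTτ ((c _).intervalIntegrable _ _)
          ((((c _).const_mul 2).add ((c _).const_mul 2)).intervalIntegrable _ _) fun t => ?_
        have e : opT h (opU t k) - opU t k = (opT h (opU t (opB l)) - opU t (opB l)) +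
            (opT h (opU t (k - opB l)) - opU t (k - opB l)) := by
          simp only [map_sub]
          abel
        have h1 := n4_add_le (opT h (opU t (opB l)) - opU t (opB l))
          (opT h (opU t (k - opB l)) - opU t (k - opB l))
        rw [← e] at h1
        have h0 := n4_nonneg (opT h (opU t k) - opU t k)
        calc (((n : ℝ) + 1) * n4 (opT h (opU t k) - opU t k)) ^ 2
            ≤ (((n : ℝ) + 1) * (n4 (opT h (opU t (opB l)) - opU t (opB l)) +
              n4 (opT h (opU t (k - opB l)) - opU t (k - opB l)))) ^ 2 := by gcongr
          _ ≤ _ := by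
            rw [mul_add]
            exact add_sq_le.trans_eq (by ring)
    _ ≤ ε := by
        rw [intervalIntegral.integral_add (((c _).const_mul 2).intervalIntegrable _ _)
          (((c _).const_mul 2).intervalIntegrable _ _), intervalIntegral.integral_const_mul,
          intervalIntegral.integral_const_mul]
        linarith


/-! ### The asymptotic state -/

theorem opU_neg_inner (t : ℝ) (f g : L2) : inner ℂ f (opU (-t) g) = inner ℂ (opU t f) g := by
  rw [inner_opU, neg_neg]

namespace IsFlow

variable {E : ℝ} {k : ℝ → L2}

theorem norm_inner_integrand_le (hk : IsFlow E k) {χ : L2} (hχ : Integrable χ) {s : ℝ}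
    (hs : 0 < s) :
    ‖(inner ℂ χ (-Complex.I • opU (-s) (nl (k s))) : ℂ)‖ ≤
      s ^ (-(3 / 2) : ℝ) * (sobC4 ^ 2 * E ^ 3 * ∫ x, ‖χ x‖) := by
  rw [inner_smul_right, norm_mul, norm_neg, Complex.norm_I, one_mul]
  refine (norm_inner_opU_le_L1 (neg_ne_zero.mpr hs.ne') (integrable_nl _) hχ).trans ?_
  rw [abs_neg, abs_of_pos hs, mul_assoc]
  have h1 := integral_norm_nl_le (k s)
  have h2 : 0 ≤ ∫ x, ‖χ x‖ := integral_nonneg fun _ => norm_nonneg _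
  have h3 := hk.norm_le s
  gcongr
  refine h1.trans ?_
  gcongr

/-- The Duhamel integrand is `O(s^{-3/2})` against an integrable test function, so its integral
converges at infinity. Starting at time `1` avoids the singularity of this bound at `0`. -/
theorem tendsto_inner_schwartz (hk : IsFlow E k) (φ : 𝓢(R3, ℂ)) :
    ∃ c : ℂ, Tendsto (fun t => (inner ℂ (opB (φ.toLp 2)) (opU (-t) (k t)) : ℂ)) atTop (𝓝 c) := by
  set χ : L2 := φ.toLp 2
  have hχ : Integrable χ := integrable_toLp φ
  set f : ℝ → ℂ := fun s => inner ℂ χ (-Complex.I • opU (-s) (nl (k s)))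
  have hf : Continuous f := continuous_const.inner hk.continuous_smul_integrand
  have hint : IntegrableOn f (Ioi 1) := by
    have h1 : IntegrableOn (fun s : ℝ => s ^ (-(3 / 2) : ℝ) *
        (sobC4 ^ 2 * E ^ 3 * ∫ x, ‖χ x‖)) (Ioi 1) :=
      (integrableOn_Ioi_rpow_of_lt (by norm_num) one_pos).mul_const _
    refine h1.mono' hf.aestronglyMeasurable ?_
    filter_upwards [ae_restrict_mem measurableSet_Ioi] with s hs
    exact hk.norm_inner_integrand_le hχ (one_pos.trans hs)
  have h2 := intervalIntegral_tendsto_integral_Ioi 1 hint tendsto_id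
  refine ⟨_, (h2.const_add (inner ℂ χ (opU (-1) (opB (k 1))))).congr' ?_⟩
  filter_upwards [eventually_ge_atTop 1] with t ht
  have hd := hk.duhamel zero_le_one ht
  have e : ∀ x : L2, (inner ℂ (opB χ) (opU (-t) x) : ℂ) = inner ℂ χ (opU (-t) (opB x)) := by
    intro x
    rw [← inner_opB, opU_opB]
  rw [e, hd, inner_add_right, intervalIntegral.integral_of_le ht,
    integral_inner_left hk.continuous_smul_integrand, id, intervalIntegral.integral_of_le ht]

theorem norm_opU_neg_le (hk : IsFlow E k) (t : ℝ) : ‖opU (-t) (k t)‖ ≤ E :=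
  (norm_opU _ _).trans_le (hk.norm_le t)

/-- The uniform bound `E` makes the set of good test vectors closed. Density is used twice: for the
range of `opB`, then for Schwartz functions inside it. -/
theorem cauchySeq_inner (hk : IsFlow E k) (g : L2) :
    CauchySeq fun t => (inner ℂ g (opU (-t) (k t)) : ℂ) := by
  have hE := hk.nonneg
  have hcl : IsClosed {g : L2 | CauchySeq fun t => (inner ℂ g (opU (-t) (k t)) : ℂ)} := by
    have h := tendsto_zero_of_dense (ℱ := (atTop : Filter (ℝ × ℝ))) (C := 2 * E)
      (F := fun p g => (inner ℂ g (opU (-p.1) (k p.1) - opU (-p.2) (k p.2)) : ℂ))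
      (fun p g g' => by
        rw [← inner_sub_left]
        refine (norm_inner_le_norm _ _).trans ?_
        rw [mul_comm]
        have h1 := hk.norm_opU_neg_le p.1
        have h2 := hk.norm_opU_neg_le p.2
        have h3 := norm_sub_le (opU (-p.1) (k p.1)) (opU (-p.2) (k p.2))
        gcongr
        linarith)
    convert h using 3 with g
    rw [cauchySeq_iff_tendsto_dist_atTop_0]
    simp only [dist_eq_norm, inner_sub_right]
    exact tendsto_zero_iff_norm_tendsto_zero.symm
  refine opB_induction (p := fun g => CauchySeq fun t => (inner ℂ g (opU (-t) (k t)) : ℂ)) hcl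
    (fun χ => ?_) g
  refine schwartz_dense
    (p := fun χ => CauchySeq fun t => (inner ℂ (opB χ) (opU (-t) (k t)) : ℂ))
    (hcl.preimage opB.continuous) (fun φ => ?_) χ
  obtain ⟨c, hc⟩ := hk.tendsto_inner_schwartz φ
  exact hc.cauchySeq

/-- The curve `e^{-itΔ} u(t)` converges weakly in `H¹`. -/
theorem exists_weak_limit (hk : IsFlow E k) : ∃ p : L2, ‖p‖ ≤ E ∧
    ∀ g : L2, Tendsto (fun t => (inner ℂ g (opU (-t) (k t)) : ℂ)) atTop (𝓝 (inner ℂ g p)) := by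
  have hlim : ∀ g : L2, ∃ c : ℂ, Tendsto (fun t => (inner ℂ (opU (-t) (k t)) g : ℂ)) atTop (𝓝 c) := by
    intro g
    obtain ⟨c, hc⟩ := cauchySeq_tendsto_of_complete (hk.cauchySeq_inner g)
    refine ⟨starRingEnd ℂ c, ?_⟩
    refine ((Complex.continuous_conj.tendsto c).comp hc).congr fun t => ?_
    exact inner_conj_symm _ _
  choose c hc using hlim
  -- The limits define a functional of norm at most `E`, represented by a vector through Riesz; this
  -- also gives the bound on the limit.
  let ℓ : L2 →ₗ[ℂ] ℂ :=
    { toFun := c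
      map_add' := fun g g' => tendsto_nhds_unique (hc (g + g'))
        (((hc g).add (hc g')).congr fun t => (inner_add_right _ _ _).symm)
      map_smul' := fun a g => tendsto_nhds_unique (hc (a • g))
        (((hc g).const_mul a).congr fun t => (inner_smul_right _ _ _).symm) }
  have hb : ∀ g, ‖ℓ g‖ ≤ E * ‖g‖ := fun g => by
    refine le_of_tendsto (hc g).norm (Eventually.of_forall fun t => ?_)
    refine (norm_inner_le_norm _ _).trans ?_
    gcongr
    exact hk.norm_opU_neg_le t
  let L : L2 →L[ℂ] ℂ := ℓ.mkContinuous E hb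
  refine ⟨(InnerProductSpace.toDual ℂ L2).symm L, ?_, fun g => ?_⟩
  · rw [LinearIsometryEquiv.norm_map]
    exact ℓ.mkContinuous_norm_le hk.nonneg hb
  · have e : (inner ℂ g ((InnerProductSpace.toDual ℂ L2).symm L) : ℂ) = starRingEnd ℂ (c g) := by
      rw [← inner_conj_symm, InnerProductSpace.toDual_symm_apply]
      rfl
    rw [e]
    refine ((Complex.continuous_conj.tendsto (c g)).comp (hc g)).congr fun t => ?_
    exact inner_conj_symm _ _

end IsFlow

/-! ### The defect of the remainder -/

theorem cubic_eq (a : ℂ) : cubic a = -(a * a * starRingEnd ℂ a) := by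
  rw [cubic, mul_assoc, Complex.mul_conj']
  push_cast
  ring

/-- This controls increments of `F(a) - F(a - b)`. Each term contains the increment of `b`, or the
increment of `a` together with a factor `b` or `b'`, so the bound vanishes with `b` and its
increment even when `a` stays large. -/
theorem norm_cubic_diff_sub_le (a b a' b' : ℂ) :
    ‖(cubic a' - cubic (a' - b')) - (cubic a - cubic (a - b))‖ ≤
      6 * ((‖a‖ + ‖a'‖ + ‖b‖ + ‖b'‖) * (‖a‖ + ‖a'‖ + ‖b‖ + ‖b'‖) * ‖b' - b‖ +
        (‖a‖ + ‖a'‖ + ‖b‖ + ‖b'‖) * (‖b‖ + ‖b'‖) * ‖a' - a‖) := by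
  set m := ‖a‖ + ‖a'‖ + ‖b‖ + ‖b'‖
  set μ := ‖b‖ + ‖b'‖
  have a0 := norm_nonneg a
  have a1 := norm_nonneg a'
  have b0 := norm_nonneg b
  have b1 := norm_nonneg b'
  have hm : 0 ≤ m := by positivity
  have hμ : 0 ≤ μ := by positivity
  have hμm : μ ≤ m := by simp only [m, μ]; linarith
  have ha : ‖a‖ ≤ m := by simp only [m]; linarith
  have ha' : ‖a'‖ ≤ m := by simp only [m]; linarith
  have hb : ‖b‖ ≤ μ := by simp only [μ]; linarith
  have hb' : ‖b'‖ ≤ μ := by simp only [μ]; linarith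
  have hc : ‖a - b‖ ≤ m := (norm_sub_le _ _).trans (by simp only [m]; linarith)
  have hc' : ‖a' - b'‖ ≤ m := (norm_sub_le _ _).trans (by simp only [m]; linarith)
  have hd : ‖(a' - b') - (a - b)‖ ≤ ‖a' - a‖ + ‖b' - b‖ := by
    rw [show (a' - b') - (a - b) = (a' - a) - (b' - b) by ring]
    exact norm_sub_le _ _
  have T : ∀ {x y z : ℂ} {X Y Z : ℝ}, ‖x‖ ≤ X → ‖y‖ ≤ Y → ‖z‖ ≤ Z →
      ‖x * y * starRingEnd ℂ z‖ ≤ X * Y * Z := by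
    intro x y z X Y Z hx hy hz
    rw [norm_mul, norm_mul, RCLike.norm_conj]
    have := (norm_nonneg x).trans hx
    have := (norm_nonneg y).trans hy
    gcongr
  -- As `F` is trilinear, `F(a) - F(a - b)` is minus a sum of three products with one factor `b`
  -- each. Changing one factor at a time gives nine terms, and each of the two majorants is
  -- collected six times.
  have e : (cubic a' - cubic (a' - b')) - (cubic a - cubic (a - b)) =
      -(((b' - b) * a' * starRingEnd ℂ a' + b * (a' - a) * starRingEnd ℂ a' +
          b * a * starRingEnd ℂ (a' - a)) +
        (((a' - b') - (a - b)) * b' * starRingEnd ℂ a' + (a - b) * (b' - b) * starRingEnd ℂ a' +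
          (a - b) * b * starRingEnd ℂ (a' - a)) +
        (((a' - b') - (a - b)) * (a' - b') * starRingEnd ℂ b' +
          (a - b) * ((a' - b') - (a - b)) * starRingEnd ℂ b' +
          (a - b) * (a - b) * starRingEnd ℂ (b' - b))) := by
    simp only [cubic_eq, map_sub]
    ring
  rw [e, norm_neg]
  refine (norm_add₃_le.trans (add_le_add (add_le_add norm_add₃_le norm_add₃_le)
    norm_add₃_le)).trans ?_
  have t1 := T (le_refl ‖b' - b‖) ha' ha'
  have t2 := T hb (le_refl ‖a' - a‖) ha'
  have t3 := T hb ha (le_refl ‖a' - a‖)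
  have t4 := T hd hb' ha'
  have t5 := T hc (le_refl ‖b' - b‖) ha'
  have t6 := T hc hb (le_refl ‖a' - a‖)
  have t7 := T hd hc' hb'
  have t8 := T hc hd hb'
  have t9 := T hc hc (le_refl ‖b' - b‖)
  have hx : m * μ * ‖b' - b‖ ≤ m * m * ‖b' - b‖ := by gcongr
  nlinarith [t1, t2, t3, t4, t5, t6, t7, t8, t9, hx]

/-- The difference `F(u) - F(u - v)` for `u = ⟨D⟩⁻¹ k` and `v = ⟨D⟩⁻¹ l`. -/
def defect (k l : L2) : L2 := nl k - nl (k - l)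

theorem defect_zero_right (k : L2) : defect k 0 = 0 := by rw [defect, sub_zero, sub_self]

theorem opT_defect (h : R3) (k l : L2) : opT h (defect k l) = defect (opT h k) (opT h l) := by
  rw [defect, map_sub, opT_nl, opT_nl, map_sub, defect]

theorem norm_defect_sub_pointwise (k l k' l' : L2) : ∀ᵐ x,
    ‖(defect k' l' - defect k l : L2) x‖ ≤
      6 * ((‖opB k x‖ + ‖opB k' x‖ + ‖opB l x‖ + ‖opB l' x‖) *
          (‖opB k x‖ + ‖opB k' x‖ + ‖opB l x‖ + ‖opB l' x‖) * ‖opB (l' - l) x‖ +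
        (‖opB k x‖ + ‖opB k' x‖ + ‖opB l x‖ + ‖opB l' x‖) *
          (‖opB l x‖ + ‖opB l' x‖) * ‖opB (k' - k) x‖) := by
  filter_upwards [coeFn_nl k, coeFn_nl k', coeFn_nl (k - l), coeFn_nl (k' - l'),
    Lp.coeFn_sub (nl k) (nl (k - l)), Lp.coeFn_sub (nl k') (nl (k' - l')),
    Lp.coeFn_sub (defect k' l') (defect k l), Lp.coeFn_sub (opB k) (opB l),
    Lp.coeFn_sub (opB k') (opB l'), Lp.coeFn_sub (opB k') (opB k),
    Lp.coeFn_sub (opB l') (opB l)] with x e1 e2 e3 e4 e5 e6 e7 e8 e9 e10 e11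
  rw [e7, Pi.sub_apply, defect, defect, e5, e6, Pi.sub_apply, Pi.sub_apply, e1, e2, e3, e4,
    map_sub, map_sub, map_sub, map_sub, e8, e9, e10, e11]
  exact norm_cubic_diff_sub_le _ _ _ _

/-- Hölder with exponents `∞, 4, 4`. The sup norm falls on a factor without increment, so quantities
bounded in `L²_t L^∞` and in `L²_t L⁴` can be multiplied. -/
theorem ofReal_norm_defect_sub_le (k l k' l' : L2) {S : ℝ≥0∞}
    (hS : eLpNorm (opB k) ∞ volume + eLpNorm (opB k') ∞ volume + eLpNorm (opB l) ∞ volume +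
      eLpNorm (opB l') ∞ volume ≤ S) :
    ENNReal.ofReal ‖defect k' l' - defect k l‖ ≤
      S * ENNReal.ofReal (6 * ((n4 k + n4 k' + n4 l + n4 l') * n4 (l' - l) +
        (n4 l + n4 l') * n4 (k' - k))) := by
  have h1 : ENNReal.HolderTriple ∞ 4 4 := ⟨by simp⟩
  have h2 : ENNReal.HolderTriple 4 4 2 := holderTriple_of_toReal (by norm_num) (by norm_num)
    (by norm_num) (by norm_num)
  have hk := n4_nonneg k
  have hk' := n4_nonneg k'
  have hl := n4_nonneg l
  have hl' := n4_nonneg l'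
  have hd := n4_nonneg (l' - l)
  have hd' := n4_nonneg (k' - k)
  set m : R3 → ℝ := fun x => ‖opB k x‖ + ‖opB k' x‖ + ‖opB l x‖ + ‖opB l' x‖
  set μ : R3 → ℝ := fun x => ‖opB l x‖ + ‖opB l' x‖
  have m1 : AEStronglyMeasurable (fun x => ‖opB k x‖ + ‖opB k' x‖) volume :=
    aestronglyMeasurable_norm_add _ _
  have m2 : AEStronglyMeasurable (fun x => ‖opB k x‖ + ‖opB k' x‖ + ‖opB l x‖) volume :=
    m1.add (aestronglyMeasurable_norm _)
  have mm : AEStronglyMeasurable m volume := m2.add (aestronglyMeasurable_norm _)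
  have mμ : AEStronglyMeasurable μ volume := aestronglyMeasurable_norm_add _ _
  have em : ∀ p : ℝ≥0∞, 1 ≤ p → eLpNorm m p volume ≤ eLpNorm (opB k) p volume +
      eLpNorm (opB k') p volume + eLpNorm (opB l) p volume + eLpNorm (opB l') p volume := by
    intro p hp
    have t1 := eLpNorm_add_le m2 (aestronglyMeasurable_norm (opB l')) hp
    have t2 := eLpNorm_add_le m1 (aestronglyMeasurable_norm (opB l)) hp
    have t3 := eLpNorm_norm_add_le hp (opB k) (opB k')
    rw [eLpNorm_norm] at t1 t2
    exact t1.trans (add_le_add (t2.trans (add_le_add t3 le_rfl)) le_rfl)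
  have em4 : eLpNorm m 4 volume ≤ ENNReal.ofReal (n4 k + n4 k' + n4 l + n4 l') := by
    refine (em 4 (by norm_num)).trans_eq ?_
    rw [ENNReal.ofReal_add (by positivity) hl', ENNReal.ofReal_add (by positivity) hl,
      ENNReal.ofReal_add hk hk', ofReal_n4, ofReal_n4, ofReal_n4, ofReal_n4]
  have eS : eLpNorm m ∞ volume ≤ S := (em ∞ (by simp)).trans hS
  have mF : AEStronglyMeasurable (fun x => m x * m x * ‖opB (l' - l) x‖) volume :=
    (mm.mul mm).mul (aestronglyMeasurable_norm _)
  have mG : AEStronglyMeasurable (fun x => m x * μ x * ‖opB (k' - k) x‖) volume :=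
    (mm.mul mμ).mul (aestronglyMeasurable_norm _)
  have hm0 : ∀ x, 0 ≤ m x := fun x => by positivity
  have hμ0 : ∀ x, 0 ≤ μ x := fun x => by positivity
  have eF : eLpNorm (fun x => m x * m x * ‖opB (l' - l) x‖) 2 volume ≤
      S * ENNReal.ofReal (n4 k + n4 k' + n4 l + n4 l') * ENNReal.ofReal (n4 (l' - l)) := by
    refine (eLpNorm_le_mul_three h1 h2 mm mm (aestronglyMeasurable_norm (opB (l' - l)))
      (Eventually.of_forall fun x => ?_)).trans ?_
    · rw [Real.norm_eq_abs, abs_of_nonneg (mul_nonneg (mul_nonneg (hm0 x) (hm0 x)) (norm_nonneg _))]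
    · rw [eLpNorm_norm, ← ofReal_n4]
      gcongr
  have eG : eLpNorm (fun x => m x * μ x * ‖opB (k' - k) x‖) 2 volume ≤
      S * ENNReal.ofReal (n4 l + n4 l') * ENNReal.ofReal (n4 (k' - k)) := by
    refine (eLpNorm_le_mul_three h1 h2 mm mμ (aestronglyMeasurable_norm (opB (k' - k)))
      (Eventually.of_forall fun x => ?_)).trans ?_
    · rw [Real.norm_eq_abs, abs_of_nonneg (mul_nonneg (mul_nonneg (hm0 x) (hμ0 x)) (norm_nonneg _))]
    · rw [eLpNorm_norm, ← ofReal_n4]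
      gcongr
      exact eLpNorm_four_norm_add_le l l'
  rw [ofReal_norm_eq_eLpNorm]
  calc eLpNorm (defect k' l' - defect k l : L2) 2 volume
      ≤ ENNReal.ofReal 6 * eLpNorm ((fun x => m x * m x * ‖opB (l' - l) x‖) +
          fun x => m x * μ x * ‖opB (k' - k) x‖) 2 volume := by
        refine eLpNorm_le_mul_eLpNorm_of_ae_le_mul ?_ 2
        filter_upwards [norm_defect_sub_pointwise k l k' l'] with x hx
        refine hx.trans (mul_le_mul_of_nonneg_left (le_abs_self _) (by norm_num))
    _ ≤ ENNReal.ofReal 6 * (S * ENNReal.ofReal (n4 k + n4 k' + n4 l + n4 l') *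
          ENNReal.ofReal (n4 (l' - l)) +
        S * ENNReal.ofReal (n4 l + n4 l') * ENNReal.ofReal (n4 (k' - k))) := by
        gcongr
        exact (eLpNorm_add_le mF mG (by norm_num)).trans (add_le_add eF eG)
    _ = _ := by
        rw [ENNReal.ofReal_mul (by norm_num), ENNReal.ofReal_add
          (show 0 ≤ (n4 k + n4 k' + n4 l + n4 l') * n4 (l' - l) by positivity)
          (show 0 ≤ (n4 l + n4 l') * n4 (k' - k) by positivity), ENNReal.ofReal_mul (by positivity), ENNReal.ofReal_mul (by positivity)]
        ring

theorem eLpNorm_opB_opT (h : R3) (k : L2) (p : ℝ≥0∞) :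
    eLpNorm (opB (opT h k)) p volume = eLpNorm (opB k) p volume := by
  rw [← opT_opB, eLpNorm_congr_ae (coeFn_opT h _)]
  exact eLpNorm_comp_measurePreserving (Lp.aestronglyMeasurable _)
    (measurePreserving_add_right volume h)

/-- The defect vanishes for a zero free part, so this is the increment estimate from `l = 0` at
fixed `k`. -/
theorem norm_defect_le (k l : L2) :
    ENNReal.ofReal ‖defect k l‖ ≤ 2 * (supB k + supB l) *
      ENNReal.ofReal (6 * ((2 * n4 k + n4 l) * n4 l)) := by
  have h := ofReal_norm_defect_sub_le k 0 k l (S := 2 * (supB k + supB l)) (by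
    rw [map_zero, eLpNorm_congr_ae (Lp.coeFn_zero ℂ 2 volume), eLpNorm_zero, two_mul]
    have h1 := eLpNorm_top_le_supB k
    have h2 := eLpNorm_top_le_supB l
    calc eLpNorm (opB k) ∞ volume + eLpNorm (opB k) ∞ volume + 0 + eLpNorm (opB l) ∞ volume
        ≤ supB k + supB k + 0 + supB l := by gcongr
      _ ≤ supB k + supB k + supB l + supB l := by
        gcongr
        exact bot_le
      _ = _ := by ring)
  rw [defect_zero_right, sub_zero, sub_zero, sub_self, n4_zero] at h
  refine h.trans_eq ?_
  congr 2
  ring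

/-- Translation commutes with the defect and preserves all the norms, so the difference quotient is
an increment between two pairs of equal size. -/
theorem dq2_defect_le (j : Fin 3) (n : ℕ) (k l : L2) :
    dq2 j n (defect k l) ≤ 2 * (supB k + supB l) * ENNReal.ofReal (((n : ℝ) + 1) *
      (12 * ((n4 k + n4 l) * n4 (opT (step j n) l - l) +
        n4 l * n4 (opT (step j n) k - k)))) := by
  set h := step j n
  have h1 := ofReal_norm_defect_sub_le k l (opT h k) (opT h l) (S := 2 * (supB k + supB l)) (by
    rw [eLpNorm_opB_opT, eLpNorm_opB_opT]
    have h1 := eLpNorm_top_le_supB k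
    have h2 := eLpNorm_top_le_supB l
    calc eLpNorm (opB k) ∞ volume + eLpNorm (opB k) ∞ volume + eLpNorm (opB l) ∞ volume +
        eLpNorm (opB l) ∞ volume ≤ supB k + supB k + supB l + supB l := by gcongr
      _ = _ := by ring)
  rw [n4_opT, n4_opT] at h1
  rw [dq2, opT_defect, ENNReal.ofReal_mul (by positivity), ENNReal.ofReal_mul (by positivity)]
  refine (mul_le_mul' le_rfl h1).trans_eq ?_
  rw [mul_left_comm]
  congr 3
  ring

/-! ### Space-time bounds for the defect -/

theorem mul_le_weighted_sq_add (x y : ℝ≥0∞) {e : ℝ≥0∞} (h0 : e ≠ 0) (h1 : e ≠ ∞) :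
    x * y ≤ e * x ^ 2 + e⁻¹ * y ^ 2 := by
  rcases le_total y (e * x) with h | h
  · refine le_add_right ?_
    calc x * y ≤ x * (e * x) := by gcongr
      _ = e * x ^ 2 := by ring
  · refine le_add_left ?_
    have h2 : x ≤ e⁻¹ * y := by
      calc x = e⁻¹ * (e * x) := by rw [← mul_assoc, ENNReal.inv_mul_cancel h0 h1, one_mul]
        _ ≤ e⁻¹ * y := by gcongr
    calc x * y ≤ e⁻¹ * y * y := by gcongr
      _ = e⁻¹ * y ^ 2 := by ring

/-- Young's inequality with a free weight takes the place of Cauchy–Schwarz: a small `e` controls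
the merely bounded factor, and then the small factor beats `e⁻¹`. -/
theorem lintegral_mul_le_weighted {S Z : ℝ → ℝ≥0∞} (hS : Measurable S) {A : Set ℝ} {K z e : ℝ≥0∞}
    (h0 : e ≠ 0) (h1 : e ≠ ∞) (hK : ∫⁻ t in A, S t ^ 2 ≤ K) (hz : ∫⁻ t in A, Z t ^ 2 ≤ z) :
    ∫⁻ t in A, S t * Z t ≤ e * K + e⁻¹ * z := by
  calc ∫⁻ t in A, S t * Z t ≤ ∫⁻ t in A, (e * S t ^ 2 + e⁻¹ * Z t ^ 2) :=
        lintegral_mono fun t => mul_le_weighted_sq_add _ _ h0 h1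
    _ = e * (∫⁻ t in A, S t ^ 2) + e⁻¹ * ∫⁻ t in A, Z t ^ 2 := by
        rw [lintegral_add_left ((hS.pow_const 2).const_mul e), lintegral_const_mul' _ _ h1,
          lintegral_const_mul' _ _ (ENNReal.inv_ne_top.mpr h0)]
    _ ≤ _ := by gcongr

/-- A bound for the square integral in time of the sup norms of a solution and of a free
solution. -/
def supC (E τ : ℝ) : ℝ≥0∞ :=
  16 * (ballC ^ 2 * (4 * (ENNReal.ofReal ((sobC4 * E) ^ 2) * ENNReal.ofReal τ +
      3 * ENNReal.ofReal (transC E τ))) +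
    ballC ^ 2 * (4 * (ENNReal.ofReal ((sobC4 * E) ^ 2) * ENNReal.ofReal τ +
      3 * ENNReal.ofReal (8 * τ ^ (1 / 4 : ℝ) * (2 * Real.pi * E) ^ 2))))

theorem supC_ne_top (E τ : ℝ) : supC E τ ≠ ∞ := by
  have hb : ballC ^ 2 ≠ ∞ := ENNReal.pow_ne_top ballC_ne_top
  have h : ∀ x y z : ℝ, ballC ^ 2 * (4 * (ENNReal.ofReal x * ENNReal.ofReal y +
      3 * ENNReal.ofReal z)) ≠ ∞ := fun x y z =>
    ENNReal.mul_ne_top hb (ENNReal.mul_ne_top (by norm_num) (ENNReal.add_ne_top.mpr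
      ⟨ENNReal.mul_ne_top ENNReal.ofReal_ne_top ENNReal.ofReal_ne_top,
        ENNReal.mul_ne_top (by norm_num) ENNReal.ofReal_ne_top⟩))
  exact ENNReal.mul_ne_top (by norm_num) (ENNReal.add_ne_top.mpr ⟨h _ _ _, h _ _ _⟩)

theorem sq_two_mul_add_le (x y : ℝ≥0∞) : (2 * (x + y)) ^ 2 ≤ 16 * (x ^ 2 + y ^ 2) := by
  have h : ∀ {x y : ℝ≥0∞}, x ≤ y → (2 * (x + y)) ^ 2 ≤ 16 * (x ^ 2 + y ^ 2) := by
    intro x y h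
    calc (2 * (x + y)) ^ 2 ≤ (2 * (y + y)) ^ 2 := by gcongr
      _ = 16 * y ^ 2 := by ring
      _ ≤ _ := by
        gcongr
        exact le_add_self
  rcases le_total x y with hxy | hxy
  · exact h hxy
  · rw [add_comm x, add_comm (x ^ 2)]
    exact h hxy

namespace IsFlow

variable {E : ℝ} {k : ℝ → L2}

theorem measurable_sup (hk : IsFlow E k) (p : L2) :
    Measurable fun t => 2 * (supB (k t) + supB (opU t p)) :=
  ((measurable_supB_comp hk.continuous).add (measurable_supB_comp (continuous_opU p))).const_mul _

theorem n4_opU_le_bound {p : L2} (hp : ‖p‖ ≤ E) (t : ℝ) : n4 (opU t p) ≤ sobC4 * E := by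
  refine (n4_le _).trans (mul_le_mul_of_nonneg_left ?_ sobC4_pos.le)
  rwa [norm_opU]

theorem lintegral_sup_sq_le (hk : IsFlow E k) {p : L2} (hp : ‖p‖ ≤ E) {T τ : ℝ} (hT : 0 ≤ T)
    (hτ : 0 ≤ τ) :
    ∫⁻ t in Ioc T (T + τ), (2 * (supB (k t) + supB (opU t p))) ^ 2 ≤ supC E τ := by
  have hTτ : T ≤ T + τ := by linarith
  have hE := hk.nonneg
  have h1 := lintegral_supB_sq_lt_top hk.continuous hTτ hk.n4_le_bound
    fun h => hk.integral_n4_translate_le h hT hτ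
  have h2 := lintegral_supB_sq_lt_top (P := 8 * τ ^ (1 / 4 : ℝ) * (2 * Real.pi * E) ^ 2)
    (continuous_opU p) hTτ (n4_opU_le_bound hp) fun h => by
      refine (integral_n4_opU_translate_le p h hTτ).trans ?_
      rw [add_sub_cancel_left]
      gcongr
  rw [add_sub_cancel_left] at h1 h2
  calc ∫⁻ t in Ioc T (T + τ), (2 * (supB (k t) + supB (opU t p))) ^ 2
      ≤ ∫⁻ t in Ioc T (T + τ), 16 * (supB (k t) ^ 2 + supB (opU t p) ^ 2) :=
        lintegral_mono fun t => sq_two_mul_add_le _ _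
    _ = 16 * ((∫⁻ t in Ioc T (T + τ), supB (k t) ^ 2) +
        ∫⁻ t in Ioc T (T + τ), supB (opU t p) ^ 2) := by
        rw [lintegral_const_mul' _ _ (by norm_num),
          lintegral_add_left ((measurable_supB_comp hk.continuous).pow_const 2)]
    _ ≤ _ := by
        rw [supC]
        gcongr

theorem continuous_defect (hk : IsFlow E k) (p : L2) :
    Continuous fun t => defect (k t) (opU t p) :=
  (continuous_nl.comp hk.continuous).sub
    (continuous_nl.comp (hk.continuous.sub (continuous_opU p)))

/-- The majorant of the `H¹` norm of the defect. -/
def _root_.CubicNLS.defectBound (k l : L2) : ℝ≥0∞ :=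
  ENNReal.ofReal ‖defect k l‖ + ∑ j, liminf (fun n => dq2 j n (defect k l)) atTop

theorem continuous_dq2_defect (hk : IsFlow E k) (p : L2) (j : Fin 3) (n : ℕ) :
    Continuous fun t => dq2 j n (defect (k t) (opU t p)) :=
  ENNReal.continuous_ofReal.comp (continuous_const.mul
    (((opT _).continuous.comp (hk.continuous_defect p)).sub (hk.continuous_defect p)).norm)

/-- The space-time bound for the defect, in terms of the size of the free solution. -/
theorem lintegral_defectBound_le (hk : IsFlow E k) {p : L2} (hp : ‖p‖ ≤ E) {T τ x ν : ℝ}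
    (hT : 0 ≤ T) (hτ : 0 ≤ τ) (hν : ∀ t ∈ Icc T (T + τ), n4 (opU t p) ≤ ν)
    (hx : ∀ (j : Fin 3) (n : ℕ), ∫ t in T..(T + τ),
      (((n : ℝ) + 1) * n4 (opT (step j n) (opU t p) - opU t p)) ^ 2 ≤ x)
    {e : ℝ≥0∞} (h0 : e ≠ 0) (h1 : e ≠ ∞) :
    ∫⁻ t in Ioc T (T + τ), defectBound (k t) (opU t p) ≤
      4 * (e * supC E τ + e⁻¹ * ENNReal.ofReal ((18 * (sobC4 * E)) ^ 2 * ν ^ 2 * τ +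
        2 * (24 * (sobC4 * E)) ^ 2 * x + 2 * (12 * ν) ^ 2 * transC E τ)) := by
  have hTτ : T ≤ T + τ := by linarith
  set M := sobC4 * E
  have hM : 0 ≤ M := mul_nonneg sobC4_pos.le hk.nonneg
  set v : ℝ → L2 := fun t => opU t p
  have hv : Continuous v := continuous_opU p
  have hx0 : 0 ≤ x := le_trans (intervalIntegral.integral_nonneg hTτ fun t _ => sq_nonneg _) (hx 0 0)
  have hP := transC_nonneg E τ
  -- With both `L⁴` norms at most `M` and the free one at most `ν`: `18 = 6 · (2 + 1)` for the
  -- defect, and `24 = 12 · 2` and `12` for its quotients, whose sum is squared by `(x + y)² ≤ 2x² +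
  -- 2y²`.
  set z := (18 * M) ^ 2 * ν ^ 2 * τ + 2 * (24 * M) ^ 2 * x + 2 * (12 * ν) ^ 2 * transC E τ
  have hSm := hk.measurable_sup p
  have hS := hk.lintegral_sup_sq_le hp hT hτ
  have i1 : ∫⁻ t in Ioc T (T + τ), ENNReal.ofReal ‖defect (k t) (v t)‖ ≤
      e * supC E τ + e⁻¹ * ENNReal.ofReal z := by
    refine (lintegral_mono fun t => norm_defect_le (k t) (v t)).trans ?_
    refine lintegral_mul_le_weighted hSm h0 h1 hS ?_
    calc ∫⁻ t in Ioc T (T + τ), ENNReal.ofReal (6 * ((2 * n4 (k t) + n4 (v t)) * n4 (v t))) ^ 2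
        ≤ ∫⁻ _ in Ioc T (T + τ), ENNReal.ofReal ((18 * M) ^ 2 * ν ^ 2) := by
          refine setLIntegral_mono' measurableSet_Ioc fun t ht => ?_
          have a1 := hk.n4_le_bound t
          have a2 := n4_opU_le_bound hp t
          have a3 := hν t (Ioc_subset_Icc_self ht)
          have b1 := n4_nonneg (k t)
          have b2 := n4_nonneg (v t)
          rw [← ENNReal.ofReal_pow (by positivity)]
          refine ENNReal.ofReal_le_ofReal ?_
          calc (6 * ((2 * n4 (k t) + n4 (v t)) * n4 (v t))) ^ 2
              ≤ (6 * ((2 * M + M) * ν)) ^ 2 := by gcongr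
            _ = _ := by ring
      _ = ENNReal.ofReal ((18 * M) ^ 2 * ν ^ 2 * τ) := by
          rw [setLIntegral_const, Real.volume_Ioc, add_sub_cancel_left,
            ENNReal.ofReal_mul (by positivity : 0 ≤ (18 * M) ^ 2 * ν ^ 2)]
      _ ≤ ENNReal.ofReal z := by
          refine ENNReal.ofReal_le_ofReal ?_
          have : 0 ≤ 2 * (24 * M) ^ 2 * x + 2 * (12 * ν) ^ 2 * transC E τ := by positivity
          simp only [z]
          linarith
  have i2 : ∀ j n, ∫⁻ t in Ioc T (T + τ), dq2 j n (defect (k t) (v t)) ≤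
      e * supC E τ + e⁻¹ * ENNReal.ofReal z := by
    intro j n
    refine (lintegral_mono fun t => dq2_defect_le j n (k t) (v t)).trans ?_
    refine lintegral_mul_le_weighted hSm h0 h1 hS ?_
    set h := step j n
    set X : ℝ → ℝ := fun t => (((n : ℝ) + 1) * n4 (opT h (v t) - v t)) ^ 2
    set Y : ℝ → ℝ := fun t => (((n : ℝ) + 1) * n4 (opT h (k t) - k t)) ^ 2
    have cX : Continuous X := (continuous_const.mul
      (continuous_n4.comp (((opT h).continuous.comp hv).sub hv))).pow 2
    have cY : Continuous Y := (continuous_const.mul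
      (continuous_n4.comp (((opT h).continuous.comp hk.continuous).sub hk.continuous))).pow 2
    have hY : ∫ t in T..(T + τ), Y t ≤ transC E τ := by
      simp only [Y, mul_pow]
      rw [intervalIntegral.integral_const_mul]
      have := hk.integral_n4_translate_le h hT hτ
      rw [norm_step] at this
      calc ((n : ℝ) + 1) ^ 2 * ∫ t in T..(T + τ), n4 (opT h (k t) - k t) ^ 2
          ≤ ((n : ℝ) + 1) ^ 2 * (transC E τ * (1 / ((n : ℝ) + 1)) ^ 2) := by gcongr
        _ = _ := by
          have : (n : ℝ) + 1 ≠ 0 := by positivity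
          field_simp
    calc ∫⁻ t in Ioc T (T + τ), ENNReal.ofReal (((n : ℝ) + 1) *
          (12 * ((n4 (k t) + n4 (v t)) * n4 (opT h (v t) - v t) +
            n4 (v t) * n4 (opT h (k t) - k t)))) ^ 2
        ≤ ∫⁻ t in Ioc T (T + τ), ENNReal.ofReal (2 * (24 * M) ^ 2 * X t +
            2 * (12 * ν) ^ 2 * Y t) := by
          refine setLIntegral_mono' measurableSet_Ioc fun t ht => ?_
          have a1 := hk.n4_le_bound t
          have a2 := n4_opU_le_bound hp t
          have a3 := hν t (Ioc_subset_Icc_self ht)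
          have b1 := n4_nonneg (k t)
          have b2 := n4_nonneg (v t)
          have b3 := n4_nonneg (opT h (v t) - v t)
          have b4 := n4_nonneg (opT h (k t) - k t)
          rw [← ENNReal.ofReal_pow (by positivity)]
          refine ENNReal.ofReal_le_ofReal ?_
          calc (((n : ℝ) + 1) * (12 * ((n4 (k t) + n4 (v t)) * n4 (opT h (v t) - v t) +
                n4 (v t) * n4 (opT h (k t) - k t)))) ^ 2
              ≤ (((n : ℝ) + 1) * (12 * ((M + M) * n4 (opT h (v t) - v t) +
                ν * n4 (opT h (k t) - k t)))) ^ 2 := by gcongr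
            _ = (24 * M * (((n : ℝ) + 1) * n4 (opT h (v t) - v t)) +
                12 * ν * (((n : ℝ) + 1) * n4 (opT h (k t) - k t))) ^ 2 := by ring
            _ ≤ _ := by
              refine add_sq_le.trans_eq ?_
              simp only [X, Y]
              ring
      _ = ENNReal.ofReal (2 * (24 * M) ^ 2 * (∫ t in T..(T + τ), X t) +
            2 * (12 * ν) ^ 2 * ∫ t in T..(T + τ), Y t) := by
          have cX' : Continuous fun t => 2 * (24 * M) ^ 2 * X t := continuous_const.mul cX
          have cY' : Continuous fun t => 2 * (12 * ν) ^ 2 * Y t := continuous_const.mul cY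
          rw [lintegral_ofReal_eq (F := fun t => 2 * (24 * M) ^ 2 * X t + 2 * (12 * ν) ^ 2 * Y t)
            (cX'.add cY') (fun t => by positivity) hTτ, intervalIntegral.integral_add
            (cX'.intervalIntegrable _ _) (cY'.intervalIntegrable _ _),
            intervalIntegral.integral_const_mul, intervalIntegral.integral_const_mul]
      _ ≤ ENNReal.ofReal z := by
          refine ENNReal.ofReal_le_ofReal ?_
          have h2 : 2 * (24 * M) ^ 2 * (∫ t in T..(T + τ), X t) ≤ 2 * (24 * M) ^ 2 * x := by
            gcongr
            exact hx j n
          have h3 : 2 * (12 * ν) ^ 2 * (∫ t in T..(T + τ), Y t) ≤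
              2 * (12 * ν) ^ 2 * transC E τ := by gcongr
          have : 0 ≤ (18 * M) ^ 2 * ν ^ 2 * τ := by positivity
          simp only [z]
          linarith
  have i3 : ∀ j, ∫⁻ t in Ioc T (T + τ), liminf (fun n => dq2 j n (defect (k t) (v t))) atTop ≤
      e * supC E τ + e⁻¹ * ENNReal.ofReal z := by
    intro j
    refine (lintegral_liminf_le fun n => (hk.continuous_dq2_defect p j n).measurable).trans ?_
    exact liminf_le_of_le (by isBoundedDefault) fun b hb => by
      obtain ⟨n, hn⟩ := hb.exists
      exact hn.trans (i2 j n)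
  simp only [defectBound]
  rw [lintegral_add_left (hk.continuous_defect p).norm.measurable.ennreal_ofReal,
    lintegral_finsetSum _ fun j _ => Measurable.liminf fun n =>
      (hk.continuous_dq2_defect p j n).measurable, Fin.sum_univ_three]
  -- One bound for the defect itself and one for each of the three directions give the factor `4`.
  refine (add_le_add i1 (add_le_add (add_le_add (i3 0) (i3 1)) (i3 2))).trans_eq ?_
  ring

theorem lintegral_defectBound_ne_top (hk : IsFlow E k) {p : L2} (hp : ‖p‖ ≤ E) {T τ : ℝ}
    (hT : 0 ≤ T) (hτ : 0 ≤ τ) : ∫⁻ t in Ioc T (T + τ), defectBound (k t) (opU t p) ≠ ∞ := by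
  -- Finiteness needs no smallness: the uniform `L⁴` bound, the Strichartz bound and weight `1`
  -- suffice.
  have h := hk.lintegral_defectBound_le hp hT hτ (ν := sobC4 * E)
    (x := 8 * τ ^ (1 / 4 : ℝ) * (2 * Real.pi * ‖p‖) ^ 2)
    (fun t _ => n4_opU_le_bound hp t) (fun j n => by
      have h1 := integral_n4_opU_translate_le p (step j n) (a := T) (b := T + τ) (by linarith)
      rw [norm_step, add_sub_cancel_left] at h1
      simp only [mul_pow]
      rw [intervalIntegral.integral_const_mul]
      calc ((n : ℝ) + 1) ^ 2 * ∫ t in T..(T + τ), n4 (opT (step j n) (opU t p) - opU t p) ^ 2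
          ≤ ((n : ℝ) + 1) ^ 2 * (8 * τ ^ (1 / 4 : ℝ) * (2 * Real.pi * ‖p‖) ^ 2 *
            (1 / ((n : ℝ) + 1)) ^ 2) := by gcongr
        _ = _ := by
          have : (n : ℝ) + 1 ≠ 0 := by positivity
          field_simp) one_ne_zero ENNReal.one_ne_top
  refine (h.trans_lt ?_).ne
  exact ENNReal.mul_lt_top (by norm_num) (ENNReal.add_lt_top.mpr
    ⟨ENNReal.mul_lt_top ENNReal.one_lt_top (supC_ne_top E τ).lt_top,
      ENNReal.mul_lt_top (by simp) ENNReal.ofReal_lt_top⟩)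

/-- The order of choices matters: first the weight `e`, against the fixed sup-norm bound; then `δ`,
depending on `e`; then `T`, so late that the free solution is below `δ`. -/
theorem tendsto_lintegral_defectBound (hk : IsFlow E k) {p : L2} (hp : ‖p‖ ≤ E) {τ : ℝ}
    (hτ : 0 ≤ τ) :
    Tendsto (fun T => ∫⁻ t in Ioc T (T + τ), defectBound (k t) (opU t p)) atTop (𝓝 0) := by
  rw [ENNReal.tendsto_nhds_zero]
  intro ε hε
  obtain ⟨ε', hε'0, hε'⟩ := ENNReal.lt_iff_exists_nnreal_btwn.mp hε
  have hK := supC_ne_top E τ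
  have hε'pos : (0 : ℝ≥0∞) < ε' := hε'0
  obtain ⟨e, he0, he1, heK⟩ : ∃ e : ℝ≥0∞, e ≠ 0 ∧ e ≠ ∞ ∧ 4 * (e * supC E τ) ≤ ε' / 2 := by
    refine ⟨ε' / 2 / (4 * (supC E τ + 1)), ?_, ?_, ?_⟩
    · exact (ENNReal.div_pos (ENNReal.half_pos hε'pos.ne').ne' (ENNReal.mul_ne_top (by norm_num)
        (ENNReal.add_ne_top.mpr ⟨hK, ENNReal.one_ne_top⟩))).ne'
    · exact ENNReal.div_ne_top (ENNReal.div_ne_top ENNReal.coe_ne_top (by norm_num)) (by simp)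
    · calc 4 * (ε' / 2 / (4 * (supC E τ + 1)) * supC E τ)
          = ε' / 2 / (4 * (supC E τ + 1)) * (4 * supC E τ) := by ring
        _ ≤ ε' / 2 / (4 * (supC E τ + 1)) * (4 * (supC E τ + 1)) := by
          gcongr
          exact le_self_add
        _ = ε' / 2 := ENNReal.div_mul_cancel (by simp)
            (ENNReal.mul_ne_top (by norm_num) (ENNReal.add_ne_top.mpr ⟨hK, ENNReal.one_ne_top⟩))
  set B : ℝ → ℝ := fun δ => (18 * (sobC4 * E)) ^ 2 * δ ^ 2 * τ +
    2 * (24 * (sobC4 * E)) ^ 2 * δ + 2 * (12 * δ) ^ 2 * transC E τ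
  have hB : Tendsto (fun δ => 4 * (e⁻¹ * ENNReal.ofReal (B δ))) (𝓝[>] 0) (𝓝 0) := by
    have c : Continuous B := by fun_prop
    have h1 : Tendsto (fun δ => ENNReal.ofReal (B δ)) (𝓝 0) (𝓝 0) := by
      have := (ENNReal.continuous_ofReal.comp c).tendsto 0
      simpa [B, Function.comp_def] using this
    have h2 := ENNReal.Tendsto.const_mul (a := 4) (ENNReal.Tendsto.const_mul (a := e⁻¹) h1
      (Or.inr (ENNReal.inv_ne_top.mpr he0))) (Or.inr (by norm_num))
    rw [mul_zero, mul_zero] at h2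
    exact h2.mono_left nhdsWithin_le_nhds
  have hB2 := (ENNReal.tendsto_nhds_zero.mp hB (ε' / 2) (ENNReal.half_pos hε'pos.ne')).and
    self_mem_nhdsWithin
  obtain ⟨δ, hδ, hδ0⟩ := hB2.exists
  have hδ0 : 0 < δ := hδ0
  obtain ⟨T₁, hT₁⟩ := eventually_atTop.mp ((tendsto_n4_opU p).eventually (eventually_le_nhds hδ0))
  filter_upwards [eventually_integral_n4_opU_dq_le p hτ hδ0, eventually_ge_atTop T₁,
    eventually_ge_atTop 0] with T h1 h2 h3
  refine (hk.lintegral_defectBound_le hp h3 hτ (fun t ht => hT₁ t (h2.trans ht.1)) h1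
    he0 he1).trans ?_
  rw [mul_add]
  refine (add_le_add heK hδ).trans ?_
  rw [ENNReal.add_halves]
  exact hε'.le

end IsFlow

/-! ### The remainder is an approximate solution -/

/-- Bounded approximations of `⟨ξ⟩`. -/
def symInv (m : ℕ) : R3 →ᵇ ℂ := ∑ i ∈ Finset.range m, (1 - symB) ^ i

theorem symInv_mul_symB (m : ℕ) : symInv m * symB = 1 - (1 - symB) ^ m := by
  have := mul_neg_geom_sum (1 - symB : R3 →ᵇ ℂ) m
  rwa [sub_sub_cancel, mul_comm] at this

theorem norm_one_sub_symB_lt (ξ : R3) : ‖1 - symB ξ‖ < 1 := by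
  have h1 := norm_symB_le ξ
  have h0 : 0 < (1 + ‖ξ‖ ^ 2) ^ ((-1 : ℝ) / 2) := Real.rpow_pos_of_pos (one_le_bracket ξ) _
  rw [symB_apply, Complex.norm_real, Real.norm_eq_abs, abs_of_pos h0] at h1
  rw [symB_apply, ← Complex.ofReal_one, ← Complex.ofReal_sub, Complex.norm_real, Real.norm_eq_abs,
    abs_of_nonneg (by linarith)]
  linarith

/-- A Neumann series: the partial sums multiply `⟨ξ⟩⁻¹` to `1 - (1 - ⟨ξ⟩⁻¹)^m`, which tends to `1`
pointwise. Thus the unbounded `⟨D⟩` is a strong limit of bounded operators on its domain. -/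
theorem tendsto_symInv (k : L2) : Tendsto (fun m => fmul (symInv m) (opB k)) atTop (𝓝 k) := by
  have e : ∀ m, fmul (symInv m) (opB k) = fmul (1 - (1 - symB) ^ m) k := fun m => by
    rw [← symInv_mul_symB, fmul_mul]
    rfl
  simp only [e]
  have hp : ∀ m ξ, (1 - (1 - symB) ^ m : R3 →ᵇ ℂ) ξ = 1 - (1 - symB ξ) ^ m := fun m ξ => by simp
  have h := tendsto_fmul (l := (atTop : Filter ℕ)) (σ := fun m => (1 - (1 - symB) ^ m : R3 →ᵇ ℂ))
    (τ := 1) (C := 2) (fun m ξ => by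
      rw [hp]
      refine (norm_sub_le _ _).trans ?_
      rw [norm_one, norm_pow]
      have := pow_le_one₀ (n := m) (norm_nonneg _) (norm_one_sub_symB_lt ξ).le
      linarith) (fun ξ => by
      simp only [hp]
      have := (tendsto_pow_atTop_nhds_zero_of_norm_lt_one (norm_one_sub_symB_lt ξ)).const_sub 1
      simpa using this) k
  rwa [fmul_one] at h

theorem memH_defect {k l : L2} (h : defectBound k l ≠ ∞) :
    MemH 1 (defect k l : Distr) ∧ opB (J 1 (defect k l : Distr)) = defect k l ∧
      ‖J 1 (defect k l : Distr)‖ₑ ≤ defectBound k l := by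
  have hfin : ∀ j, liminf (fun n => dq2 j n (defect k l)) atTop ≠ ∞ := by
    intro j hj
    refine h ?_
    rw [defectBound, ENNReal.add_eq_top]
    exact Or.inr (ENNReal.sum_eq_top.mpr ⟨j, Finset.mem_univ j, hj⟩)
  obtain ⟨g, hg, hle⟩ := exists_opB_of_dq2 hfin
  rw [← hg, J_opB]
  refine ⟨memH_opB g, rfl, ?_⟩
  rw [← ofReal_norm]
  exact hle

theorem coe_sub (f g : L2) : ((f - g : L2) : Distr) = (f : Distr) - (g : Distr) := by
  rw [← Lp.toTemperedDistributionCLM_apply, map_sub, Lp.toTemperedDistributionCLM_apply,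
    Lp.toTemperedDistributionCLM_apply]

namespace IsFlow

variable {E : ℝ} {k : ℝ → L2}

theorem ae_defectBound_ne_top (hk : IsFlow E k) {p : L2} (hp : ‖p‖ ≤ E) {T τ : ℝ} (hT : 0 ≤ T)
    (hτ : 0 ≤ τ) : ∀ᵐ t ∂(volume.restrict (Ioc T (T + τ))), defectBound (k t) (opU t p) ≠ ∞ := by
  have hm : Measurable fun t => defectBound (k t) (opU t p) := by
    have h1 : Measurable fun t => ENNReal.ofReal ‖defect (k t) (opU t p)‖ :=
      (hk.continuous_defect p).norm.measurable.ennreal_ofReal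
    have h2 : Measurable fun t =>
        ∑ j, liminf (fun n => dq2 j n (defect (k t) (opU t p))) atTop :=
      Finset.measurable_fun_sum _ fun j _ =>
        Measurable.liminf fun n => (hk.continuous_dq2_defect p j n).measurable
    exact h1.add h2
  filter_upwards [ae_lt_top hm (hk.lintegral_defectBound_ne_top hp hT hτ)] with t ht
  exact ht.ne

/-- The defect is continuous in time only as an `L²` curve. Its image under `⟨D⟩` is measurable as
an almost everywhere limit of the continuous curves obtained from the bounded approximations. -/
theorem aestronglyMeasurable_J_defect (hk : IsFlow E k) {p : L2} (hp : ‖p‖ ≤ E) {T τ : ℝ}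
    (hT : 0 ≤ T) (hτ : 0 ≤ τ) :
    AEStronglyMeasurable (fun t => J 1 (defect (k t) (opU t p) : Distr))
      (volume.restrict (Ioc T (T + τ))) := by
  refine aestronglyMeasurable_of_tendsto_ae atTop
    (f := fun m t => fmul (symInv m) (defect (k t) (opU t p))) (fun m =>
      ((fmul (symInv m)).continuous.comp (hk.continuous_defect p)).aestronglyMeasurable) ?_
  filter_upwards [hk.ae_defectBound_ne_top hp hT hτ] with t ht
  have h := tendsto_symInv (J 1 (defect (k t) (opU t p) : Distr))
  rwa [(memH_defect ht).2.1] at h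

theorem lintegral_J_defect_le (hk : IsFlow E k) {p : L2} (hp : ‖p‖ ≤ E) {T τ : ℝ}
    (hT : 0 ≤ T) (hτ : 0 ≤ τ) :
    ∫⁻ t in Ioc T (T + τ), ‖J 1 (defect (k t) (opU t p) : Distr)‖ₑ ≤
      ∫⁻ t in Ioc T (T + τ), defectBound (k t) (opU t p) := by
  refine lintegral_mono_ae ?_
  filter_upwards [hk.ae_defectBound_ne_top hp hT hτ] with t ht
  exact (memH_defect ht).2.2

theorem integrableOn_J_defect (hk : IsFlow E k) {p : L2} (hp : ‖p‖ ≤ E) {T τ : ℝ}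
    (hT : 0 ≤ T) (hτ : 0 ≤ τ) :
    IntegrableOn (fun t => J 1 (defect (k t) (opU t p) : Distr)) (Ioc T (T + τ)) :=
  ⟨hk.aestronglyMeasurable_J_defect hp hT hτ, (hk.lintegral_J_defect_le hp hT hτ).trans_lt
    (hk.lintegral_defectBound_ne_top hp hT hτ).lt_top⟩

theorem tendsto_integral_J_defect (hk : IsFlow E k) {p : L2} (hp : ‖p‖ ≤ E) {τ : ℝ}
    (hτ : 0 ≤ τ) :
    Tendsto (fun T => ∫ t in T..(T + τ), ‖J 1 (defect (k t) (opU t p) : Distr)‖) atTop (𝓝 0) := by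
  have h := (ENNReal.tendsto_toReal ENNReal.zero_ne_top).comp (hk.tendsto_lintegral_defectBound hp hτ)
  rw [ENNReal.toReal_zero] at h
  refine squeeze_zero' ?_ ?_ h
  · exact Eventually.of_forall fun T =>
      intervalIntegral.integral_nonneg (by linarith) fun t _ => norm_nonneg _
  · filter_upwards [eventually_ge_atTop 0] with T hT
    rw [intervalIntegral.integral_of_le (by linarith), integral_norm_eq_lintegral_enorm
      (hk.aestronglyMeasurable_J_defect hp hT hτ)]
    exact ENNReal.toReal_mono (hk.lintegral_defectBound_ne_top hp hT hτ)
      (hk.lintegral_J_defect_le hp hT hτ)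

theorem ae_memH_defect (hk : IsFlow E k) {p : L2} (hp : ‖p‖ ≤ E) :
    ∀ᵐ t ∂(volume.restrict (Ici (0 : ℝ))), MemH 1 (defect (k t) (opU t p) : Distr) := by
  have hsub : Ioi (0 : ℝ) ⊆ ⋃ n : ℕ, Ioc (0 : ℝ) (0 + n) := by
    intro t ht
    obtain ⟨n, hn⟩ := exists_nat_ge t
    exact mem_iUnion.mpr ⟨n, ht, by simpa using hn⟩
  rw [← Measure.restrict_congr_set (Ioi_ae_eq_Ici (μ := (volume : Measure ℝ)) (a := (0 : ℝ)))]
  refine ae_restrict_of_ae_restrict_of_subset hsub ?_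
  rw [ae_restrict_iUnion_iff]
  intro n
  filter_upwards [hk.ae_defectBound_ne_top hp le_rfl n.cast_nonneg] with t ht
  exact (memH_defect ht).1

end IsFlow

/-- The remainder after subtracting the free solution with initial value `⟨D⟩⁻¹ p`. -/
def remainder (u : ℝ → Distr) (p : L2) (t : ℝ) : Distr := u t - freeProp t (opB p : Distr)

theorem memH_freeProp_opB (t : ℝ) (p : L2) : MemH 1 (freeProp t (opB p : Distr)) :=
  (memH_opB p).freeProp t

theorem J_freeProp_opB (t : ℝ) (p : L2) : J 1 (freeProp t (opB p : Distr)) = opU t p := by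
  rw [J_freeProp (memH_opB p), J_opB]

theorem MemH.sub {s : ℝ} {v w : Distr} (hv : MemH s v) (hw : MemH s w) : MemH s (v - w) :=
  MemSobolev.sub hv hw

theorem MemH.add {s : ℝ} {v w : Distr} (hv : MemH s v) (hw : MemH s w) : MemH s (v + w) :=
  MemSobolev.add hv hw

theorem MemH.smul {s : ℝ} {v : Distr} (hv : MemH s v) (c : ℂ) : MemH s (c • v) :=
  MemSobolev.smul c hv

namespace IsSolution

variable {u : ℝ → Distr} {E : ℝ}

theorem memH_remainder (hu : IsSolution u) (p : L2) {t : ℝ} (ht : 0 ≤ t) :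
    MemH 1 (remainder u p t) := (hu.memH t ht).sub (memH_freeProp_opB t p)

theorem J_remainder (hu : IsSolution u) (p : L2) {t : ℝ} (ht : 0 ≤ t) :
    J 1 (remainder u p t) = flowOf u t - opU t p := by
  rw [remainder, J_sub (hu.memH t ht) (memH_freeProp_opB t p), J_freeProp_opB, flowOf_of_nonneg u ht]

theorem isApproxSolution_remainder (hu : IsSolution u) (hE : ∀ t, 0 ≤ t → normH 1 (u t) ≤ E)
    {p : L2} (hp : ‖p‖ ≤ E) : IsApproxSolution (remainder u p) := by
  have hk := hu.isFlow hE
  set w := remainder u p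
  -- Subtracting the free equation leaves `i w_t + Δw = F(u)`; solved for `w_t`, this makes the
  -- defect exactly `F(u) - F(w)`.
  let wt : ℝ → Distr := fun t => -Complex.I • nonlin (u t) + Complex.I • Δ (w t)
  have hdef : ∀ t, 0 ≤ t → nlsDefect (w t) (wt t) = (defect (flowOf u t) (opU t p) : Distr) := by
    intro t ht
    have hI : Complex.I • wt t = nonlin (u t) - Δ (w t) := by
      simp only [wt]
      rw [smul_add, smul_smul, smul_smul, mul_neg, Complex.I_mul_I, neg_neg, one_smul, neg_one_smul,
        sub_eq_add_neg]
    rw [nlsDefect, hI, sub_add_cancel, nonlin_eq (hu.memH t ht), nonlin_eq (hu.memH_remainder p ht),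
      hu.J_remainder p ht, defect, coe_sub, flowOf_of_nonneg u ht]
  have hd : ∀ t, 0 ≤ t → HasDerivH (-1) w (wt t) t := by
    intro t ht
    have m1 : MemH (-1) (nonlin (u t)) := by
      rw [nonlin_eq (hu.memH t ht)]
      exact memH_neg_one_coe _
    have m2 : MemH (-1) (Δ (w t)) := memH_laplacian (hu.memH_remainder p ht)
    refine ⟨(m1.smul _).add (m2.smul _), ?_⟩
    have e : J (-1) (wt t) = -Complex.I • (opL (flowOf u t) + opB (nl (flowOf u t))) -
        -Complex.I • opL (opU t p) := by
      simp only [wt]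
      rw [J_add (m1.smul _) (m2.smul _), J_smul _ m1, J_smul _ m2, nonlin_eq (hu.memH t ht),
        J_neg_one_coe, J_laplacian (hu.memH_remainder p ht), hu.J_remainder p ht, map_sub,
        flowOf_of_nonneg u ht]
      module
    rw [e]
    have h := (hk.deriv t ht).sub (hasDerivAt_opU t p).hasDerivWithinAt
    refine h.congr (fun r hr => ?_) ?_
    · rw [J_neg_one (hu.memH_remainder p hr), hu.J_remainder p hr, map_sub, map_sub]
      rfl
    · rw [J_neg_one (hu.memH_remainder p ht), hu.J_remainder p ht, map_sub, map_sub]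
      rfl
  refine ⟨wt, hd, ?_, fun τ hτ => ⟨fun T hT => ?_, ?_⟩⟩
  · filter_upwards [hk.ae_memH_defect hp, ae_restrict_mem measurableSet_Ici] with t h1 h2
    rwa [hdef t h2]
  · rw [intervalIntegrable_iff_integrableOn_Ioc_of_le (by linarith)]
    refine (hk.integrableOn_J_defect hp hT hτ.le).congr_fun (fun t ht => ?_) measurableSet_Ioc
    simp only
    rw [hdef t (hT.trans ht.1.le)]
  · refine (hk.tendsto_integral_J_defect hp hτ.le).congr' ?_
    filter_upwards [eventually_ge_atTop 0] with T hT
    refine intervalIntegral.integral_congr fun t ht => ?_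
    rw [uIcc_of_le (by linarith)] at ht
    simp only [normH]
    rw [hdef t (hT.trans ht.1)]

end IsSolution

/-! ### The decomposition -/

/-- `p` is the asymptotic state of the curve `k`. -/
def IsAsymptoticState (k : ℝ → L2) (p : L2) : Prop :=
  ∀ g : L2, Tendsto (fun t => (inner ℂ g (opU (-t) (k t)) : ℂ)) atTop (𝓝 (inner ℂ g p))

theorem IsAsymptoticState.tendsto_inner {k : ℝ → L2} {p : L2} (h : IsAsymptoticState k p) (g : L2) :
    Tendsto (fun t => (inner ℂ (opU t g) (k t) : ℂ)) atTop (𝓝 (inner ℂ g p)) :=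
  (h g).congr fun t => opU_neg_inner t g (k t)

theorem inner_opU_opU (t : ℝ) (f g : L2) : inner ℂ (opU t f) (opU t g) = inner ℂ f g := by
  rw [inner_opU, opU_neg_opU]

namespace IsSolution

variable {u : ℝ → Distr} {E : ℝ} {p : L2}

theorem isDecomposition (hu : IsSolution u) (p : L2) :
    IsDecomposition u (remainder u p) (opB p : Distr) :=
  ⟨fun _ ht => hu.memH_remainder p ht, memH_opB p, fun _ _ => (sub_add_cancel _ _).symm⟩

/-- Unitarity of the propagator turns the pairing of the remainder with `e^{itΔ}f` into the weak
convergence defining `p`. -/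
theorem asymptOrthL2 (hu : IsSolution u) (hp : IsAsymptoticState (flowOf u) p) :
    AsymptOrthL2 (remainder u p) := by
  rw [asymptOrthL2_iff]
  intro m
  have h := (hp.tendsto_inner m).sub_const (inner ℂ m p)
  rw [sub_self] at h
  refine h.congr' ?_
  filter_upwards [eventually_ge_atTop 0] with t ht
  rw [hu.J_remainder p ht, inner_sub_right, inner_opU_opU]

/-- Orthogonality forces the coordinate of the radiation to be the weak limit, and weak limits are
unique. -/
theorem _root_.CubicNLS.IsAsymptoticState.decomposition_unique (hp : IsAsymptoticState (flowOf u) p)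
    {w : ℝ → Distr} {q : Distr} (hd : IsDecomposition u w q) (hw : AsymptOrthL2 w) :
    q = (opB p : Distr) ∧ ∀ t, 0 ≤ t → w t = remainder u p t := by
  rw [asymptOrthL2_iff] at hw
  have hq : J 1 q = p := by
    refine ext_inner_left ℂ fun m => ?_
    have h1 := (hp.tendsto_inner m).sub (hw m)
    rw [sub_zero] at h1
    refine tendsto_nhds_unique (h1.congr' ?_) tendsto_const_nhds |>.symm
    filter_upwards [eventually_ge_atTop 0] with t ht
    rw [flowOf_of_nonneg u ht, hd.eq t ht, J_add (hd.memH_left t ht) (hd.memH_right.freeProp t),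
      J_freeProp hd.memH_right, inner_add_right, add_sub_cancel_left, inner_opU_opU]
  have e : q = (opB p : Distr) := by rw [← hq, coe_opB_J hd.memH_right]
  refine ⟨e, fun t ht => ?_⟩
  rw [remainder, hd.eq t ht, e, add_sub_cancel_right]

/-- On expanding the square, the mass of `u` is conserved and that of the free part constant; the
cross term tends to `-2‖u₊‖²` by weak convergence. -/
theorem mass_decoupling (hu : IsSolution u) (hE : ∀ t, 0 ≤ t → normH 1 (u t) ≤ E)
    (hp : IsAsymptoticState (flowOf u) p) :
    ∃ m : ℝ, Tendsto (fun T => mass (remainder u p T)) atTop (𝓝 m) ∧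
      mass (opB p : Distr) + m = mass (u 0) := by
  have hk := hu.isFlow hE
  refine ⟨‖opB (flowOf u 0)‖ ^ 2 - ‖opB p‖ ^ 2, ?_, ?_⟩
  · have h1 := (Complex.continuous_re.tendsto _).comp (hp.tendsto_inner (opB (opB p)))
    have h2 := (h1.const_mul 2).const_sub (‖opB (flowOf u 0)‖ ^ 2 + ‖opB p‖ ^ 2)
    have e : (inner ℂ (opB (opB p)) p : ℂ).re = ‖opB p‖ ^ 2 := by
      rw [← inner_opB, inner_self_eq_norm_sq_to_K]
      norm_cast
    rw [e] at h2
    rw [show ‖opB (flowOf u 0)‖ ^ 2 - ‖opB p‖ ^ 2 =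
      ‖opB (flowOf u 0)‖ ^ 2 + ‖opB p‖ ^ 2 - 2 * ‖opB p‖ ^ 2 by ring]
    refine h2.congr' ?_
    filter_upwards [eventually_ge_atTop 0] with t ht
    rw [mass_eq (hu.memH_remainder p ht), hu.J_remainder p ht, map_sub, @norm_sub_sq ℂ,
      hk.norm_eq ht, ← opU_opB, norm_opU, ← inner_re_symm, opU_opB, inner_opB, ← opU_opB, ← opU_opB]
    simp only [Function.comp_apply, RCLike.re_to_complex]
    ring
  · rw [mass_eq (memH_opB p), mass_eq (hu.memH 0 le_rfl), J_opB, flowOf_of_nonneg u le_rfl]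
    ring

/-- For an invariant curve the pairings with `p` and with its rotation agree at every time, so `⟨Rp,
p⟩ = ‖p‖²`; equality in Cauchy–Schwarz gives `Rp = p`. -/
theorem opR_asymptoticState (hp : IsAsymptoticState (flowOf u) p) {A : R3 ≃ₗᵢ[ℝ] R3}
    (hA : ∀ t, opR A (flowOf u t) = flowOf u t) : opR A p = p := by
  have e : (inner ℂ (opR A p) p : ℂ) = inner ℂ p p := by
    refine tendsto_nhds_unique (hp (opR A p)) ((hp p).congr fun t => ?_)
    rw [← LinearIsometry.inner_map_map (opR A), ← opU_opR, hA]
  have h : ‖opR A p - p‖ ^ 2 = 0 := by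
    rw [@norm_sub_sq ℂ, e, LinearIsometry.norm_map, inner_self_eq_norm_sq (𝕜 := ℂ)]
    ring
  rwa [sq_eq_zero_iff, norm_eq_zero, sub_eq_zero] at h

theorem isRadial (hu : IsSolution u) (hp : IsAsymptoticState (flowOf u) p)
    (hr : ∀ t, 0 ≤ t → IsRadial (u t)) :
    (∀ t, 0 ≤ t → IsRadial (remainder u p t)) ∧ IsRadial (opB p : Distr) := by
  have h1 : ∀ A t, opR A (flowOf u t) = flowOf u t := fun A t =>
    (isRadial_iff (hu.memH _ (le_max_right t 0))).mp (hr _ (le_max_right t 0)) A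
  have h2 : ∀ A, opR A p = p := fun A => opR_asymptoticState hp (h1 A)
  refine ⟨fun t ht => ?_, ?_⟩
  · rw [isRadial_iff (hu.memH_remainder p ht)]
    intro A
    rw [hu.J_remainder p ht, map_sub, h1, ← opU_opR, h2]
  · rw [isRadial_iff (memH_opB p)]
    intro A
    rw [J_opB, h2]

end IsSolution

/-! ### Conservation of the energy -/

/-- The energy of `⟨D⟩⁻¹ k`. -/
def en (k : L2) : ℝ := (1 / 2) * (inner ℂ k (opL k) : ℂ).re - (1 / 4) * n4 k ^ 4

theorem energy_eq {v : Distr} (hv : MemH 1 v) : energy v = en (J 1 v) := by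
  have hi : Integrable fun x => ‖toL2 v x‖ ^ 4 := by
    rw [toL2_eq_opB hv]
    exact integrable_norm_four _
  rw [energy, integral_sub ((integrable_gradSq v).const_mul _) (hi.const_mul _),
    integral_const_mul, integral_const_mul, integral_gradSq hv, toL2_eq_opB hv, ← n4_pow_four, en]

theorem continuous_en : Continuous en :=
  (continuous_const.mul (Complex.continuous_re.comp
    (continuous_id.inner opL.continuous))).sub (continuous_const.mul (continuous_n4.pow 4))

/-- The operator `-⟨D⟩⁻¹ (Δ - F) ⟨D⟩⁻¹`, the derivative of the energy. -/
def gradEn (k : L2) : L2 := opL k + opB (nl k)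

theorem continuous_gradEn : Continuous gradEn :=
  opL.continuous.add (opB.continuous.comp continuous_nl)

theorem norm_gradEn_le {E : ℝ} {k : L2} (hk : ‖k‖ ≤ E) :
    ‖gradEn k‖ ≤ ‖opL‖ * E + sobC ^ 3 * E ^ 3 := by
  have := sobC_pos
  refine (norm_add_le _ _).trans (add_le_add ?_ ?_)
  · exact (opL.le_opNorm k).trans (by gcongr)
  · refine (norm_opB_le _).trans ((norm_nl_le k).trans ?_)
    gcongr

/-- The error of the trapezoidal rule for the energy. -/
def enRem (a b : L2) : ℝ := en b - en a - (1 / 2) * (inner ℂ (b - a) (gradEn a + gradEn b) : ℂ).re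

/-- The trapezoidal rule is exact for the quadratic form of `opL`, so only the quartic part
contributes an error. -/
theorem enRem_eq_nl (a b : L2) : enRem a b =
    -(1 / 4) * (n4 b ^ 4 - n4 a ^ 4) - (1 / 2) * (inner ℂ (opB (b - a)) (nl a + nl b) : ℂ).re := by
  have h : (inner ℂ b (opL a) : ℂ).re = (inner ℂ a (opL b) : ℂ).re := by
    rw [inner_opL, ← inner_conj_symm, Complex.conj_re]
  rw [enRem, en, en, gradEn, gradEn]
  simp only [inner_add_right, inner_sub_left, Complex.add_re, Complex.sub_re, map_sub, inner_opB, h]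
  ring

/-- The quartic error contains the full square `|b - a|²`. Estimated in `L²`, it leaves only sup
norms of the solution itself. -/
theorem trapezoid_pointwise (a b : ℂ) :
    -(1 / 4) * (‖b‖ ^ 4 - ‖a‖ ^ 4) - (1 / 2) * (inner ℂ (b - a) (cubic a + cubic b) : ℂ).re =
      (1 / 4) * (‖b - a‖ ^ 2 * (‖b‖ ^ 2 - ‖a‖ ^ 2)) := by
  have e : ∀ z : ℂ, ‖z‖ ^ 4 = (‖z‖ ^ 2) ^ 2 := fun z => by ring
  rw [e, e, RCLike.inner_apply, cubic, cubic, ← Complex.normSq_eq_norm_sq, ← Complex.normSq_eq_norm_sq,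
    ← Complex.normSq_eq_norm_sq]
  simp only [Complex.normSq_apply, Complex.mul_re, Complex.add_re, Complex.neg_re, Complex.neg_im,
    Complex.add_im, Complex.mul_im, Complex.conj_re, Complex.conj_im, Complex.sub_re,
    Complex.sub_im, Complex.ofReal_re, Complex.ofReal_im]
  ring

theorem enRem_eq_integral (a b : L2) : enRem a b =
    ∫ x, (1 / 4) * (‖opB (b - a) x‖ ^ 2 * (‖opB b x‖ ^ 2 - ‖opB a x‖ ^ 2)) := by
  have hi : Integrable fun x => (inner ℂ (opB (b - a) x) ((nl a + nl b : L2) x) : ℂ) :=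
    L2.integrable_inner _ _
  rw [enRem_eq_nl, n4_pow_four, n4_pow_four, ← integral_sub (integrable_norm_four b)
    (integrable_norm_four a), ← integral_const_mul, L2.inner_def]
  have h2 : (∫ x, (inner ℂ (opB (b - a) x) ((nl a + nl b : L2) x) : ℂ)).re =
      ∫ x, (inner ℂ (opB (b - a) x) ((nl a + nl b : L2) x) : ℂ).re := (integral_re hi).symm
  have i1 : Integrable fun x => -(1 / 4 : ℝ) * (‖opB b x‖ ^ 4 - ‖opB a x‖ ^ 4) :=
    ((integrable_norm_four b).sub (integrable_norm_four a)).const_mul _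
  have i2 : Integrable fun x =>
      (1 / 2 : ℝ) * (inner ℂ (opB (b - a) x) ((nl a + nl b : L2) x) : ℂ).re := hi.re.const_mul _
  rw [h2, ← integral_const_mul, ← integral_sub i1 i2]
  refine integral_congr_ae ?_
  have hs : opB (b - a) = opB b - opB a := map_sub _ _ _
  rw [hs]
  filter_upwards [coeFn_nl a, coeFn_nl b, Lp.coeFn_add (nl a) (nl b),
    Lp.coeFn_sub (opB b) (opB a)] with x h3 h4 h5 h6
  rw [h5, h6, Pi.add_apply, Pi.sub_apply, h3, h4]
  exact trapezoid_pointwise _ _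

theorem enorm_enRem_le (a b : L2) :
    ‖enRem a b‖ₑ ≤ (supB a ^ 2 + supB b ^ 2) * ‖opB (b - a)‖ₑ ^ 2 := by
  have hs : ∀ l : L2, ∀ᵐ x, ‖opB l x‖ₑ ≤ supB l := fun l => by
    filter_upwards [ae_le_eLpNormEssSup (f := opB l) (μ := volume)] with x hx
    refine hx.trans ?_
    rw [← eLpNorm_exponent_top]
    exact eLpNorm_top_le_supB l
  have h2 : ‖opB (b - a)‖ₑ ^ 2 = ∫⁻ x, ‖opB (b - a) x‖ₑ ^ 2 := by
    have := lintegral_pow_of_eLpNorm (opB (b - a)) 2 two_ne_zero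
    rw [this, Lp.enorm_def, Nat.cast_ofNat]
  rw [enRem_eq_integral, h2, ← lintegral_const_mul'' _
    ((Lp.aestronglyMeasurable (opB (b - a))).enorm.pow_const 2)]
  refine (enorm_integral_le_lintegral_enorm _).trans (lintegral_mono_ae ?_)
  filter_upwards [hs a, hs b] with x ha hb
  have h1 : ‖(1 / 4 : ℝ) * (‖opB (b - a) x‖ ^ 2 * (‖opB b x‖ ^ 2 - ‖opB a x‖ ^ 2))‖ ≤
      (‖opB a x‖ ^ 2 + ‖opB b x‖ ^ 2) * ‖opB (b - a) x‖ ^ 2 := by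
    rw [Real.norm_eq_abs, abs_mul, abs_mul, abs_of_nonneg (by norm_num : (0 : ℝ) ≤ 1 / 4),
      abs_of_nonneg (by positivity : 0 ≤ ‖opB (b - a) x‖ ^ 2)]
    have h3 : |‖opB b x‖ ^ 2 - ‖opB a x‖ ^ 2| ≤ ‖opB a x‖ ^ 2 + ‖opB b x‖ ^ 2 := by
      rw [abs_le]
      constructor <;> nlinarith [sq_nonneg ‖opB a x‖, sq_nonneg ‖opB b x‖]
    have h4 := mul_le_mul_of_nonneg_left h3 (sq_nonneg ‖opB (b - a) x‖)
    nlinarith [mul_nonneg (sq_nonneg ‖opB (b - a) x‖) (abs_nonneg (‖opB b x‖ ^ 2 - ‖opB a x‖ ^ 2))]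
  calc ‖(1 / 4 : ℝ) * (‖opB (b - a) x‖ ^ 2 * (‖opB b x‖ ^ 2 - ‖opB a x‖ ^ 2))‖ₑ
      ≤ ENNReal.ofReal ((‖opB a x‖ ^ 2 + ‖opB b x‖ ^ 2) * ‖opB (b - a) x‖ ^ 2) := by
        rw [← ofReal_norm]
        exact ENNReal.ofReal_le_ofReal h1
    _ = (‖opB a x‖ₑ ^ 2 + ‖opB b x‖ₑ ^ 2) * ‖opB (b - a) x‖ₑ ^ 2 := by
        rw [ENNReal.ofReal_mul (by positivity), ENNReal.ofReal_add (by positivity) (by positivity),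
          ENNReal.ofReal_pow (norm_nonneg _), ENNReal.ofReal_pow (norm_nonneg _),
          ENNReal.ofReal_pow (norm_nonneg _), ofReal_norm, ofReal_norm, ofReal_norm]
    _ ≤ _ := by gcongr

/-! ### Averaged difference quotients in time. -/

theorem tendsto_natCast_mul_sub {f : ℝ → ℝ} {f' a : ℝ} (h : HasDerivWithinAt f f' (Ici a) a) :
    Tendsto (fun n : ℕ => ((n : ℝ) + 1) * (f (a + 1 / ((n : ℝ) + 1)) - f a)) atTop (𝓝 f') := by
  rw [hasDerivWithinAt_iff_tendsto_slope] at h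
  have h1 : Tendsto (fun n : ℕ => a + 1 / ((n : ℝ) + 1)) atTop (𝓝[Ici a \ {a}] a) := by
    refine tendsto_nhdsWithin_iff.mpr ⟨?_, Eventually.of_forall fun n => ?_⟩
    · simpa using tendsto_one_div_add_atTop_nhds_zero_nat.const_add a
    · have : 0 < 1 / ((n : ℝ) + 1) := by positivity
      refine ⟨by simp only [mem_Ici]; linarith, ?_⟩
      simp only [mem_singleton_iff]
      linarith
  refine (h.comp h1).congr fun n => ?_
  simp [slope_def_module]

theorem tendsto_natCast_mul_integral {f : ℝ → ℝ} (hf : Continuous f) (a : ℝ) :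
    Tendsto (fun n : ℕ => ((n : ℝ) + 1) * ∫ t in a..(a + 1 / ((n : ℝ) + 1)), f t) atTop
      (𝓝 (f a)) := by
  have h := tendsto_natCast_mul_sub
    (intervalIntegral.integral_hasDerivAt_right (hf.intervalIntegrable a a)
      (hf.stronglyMeasurableAtFilter _ _) hf.continuousAt).hasDerivWithinAt
  simpa using h

/-- After cancellation the integral of an increment is a difference of two averages at the
endpoints, so continuity of `f` replaces differentiability. -/
theorem tendsto_natCast_mul_integral_sub {f : ℝ → ℝ} (hf : Continuous f) (a b : ℝ) :
    Tendsto (fun n : ℕ => ((n : ℝ) + 1) * ∫ t in a..b, (f (t + 1 / ((n : ℝ) + 1)) - f t)) atTop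
      (𝓝 (f b - f a)) := by
  refine ((tendsto_natCast_mul_integral hf b).sub (tendsto_natCast_mul_integral hf a)).congr
    fun n => ?_
  have hi : ∀ x y, IntervalIntegrable f volume x y := fun x y => hf.intervalIntegrable x y
  have hf' : Continuous fun t => f (t + 1 / ((n : ℝ) + 1)) := hf.comp (continuous_add_const _)
  rw [intervalIntegral.integral_sub (hf'.intervalIntegrable _ _) (hi _ _),
    intervalIntegral.integral_comp_add_right, ← mul_sub]
  congr 1
  have h1 := intervalIntegral.integral_add_adjacent_intervals (hi a b) (hi b (b + 1 / ((n : ℝ) + 1)))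
  have h2 := intervalIntegral.integral_add_adjacent_intervals (hi a (a + 1 / ((n : ℝ) + 1)))
    (hi (a + 1 / ((n : ℝ) + 1)) (b + 1 / ((n : ℝ) + 1)))
  linarith

namespace IsFlow

variable {E : ℝ} {k : ℝ → L2}

/-- The current `Re (i ⟨u(s), u(t)⟩_{L²})`. -/
def _root_.CubicNLS.current (k : ℝ → L2) (s t : ℝ) : ℝ :=
  (Complex.I * inner ℂ (opB (k s)) (opB (k t)) : ℂ).re

theorem hasDerivWithinAt_shift (hk : IsFlow E k) {t h : ℝ} (ht : 0 ≤ t) (hh : 0 ≤ h) :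
    HasDerivWithinAt (fun s => opB (opB (k (s + h)))) (-Complex.I • gradEn (k (t + h))) (Ici 0) t := by
  have h1 : HasDerivWithinAt (fun s : ℝ => s + h) 1 (Ici 0) t :=
    ((hasDerivAt_id t).add_const h).hasDerivWithinAt
  have h2 := (hk.deriv (t + h) (by linarith)).scomp t h1
    (fun s hs => mem_Ici.mpr (add_nonneg (mem_Ici.mp hs) hh))
  rwa [one_smul] at h2

/-- This is the antisymmetric part of the trapezoidal expression for the energy; being an exact
derivative, it integrates to boundary terms. -/
theorem hasDerivWithinAt_current_diag (hk : IsFlow E k) {t h : ℝ} (ht : 0 ≤ t) (hh : 0 ≤ h) :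
    HasDerivWithinAt (fun s => current k s (s + h))
      ((inner ℂ (k t) (gradEn (k (t + h))) : ℂ).re - (inner ℂ (k (t + h)) (gradEn (k t)) : ℂ).re)
      (Ici 0) t := by
  have h1 := (hasDerivWithinAt_inner_opB (q := fun s => k (s + h))
    (hk.continuous.comp (continuous_add_const h)).continuousWithinAt (hk.deriv t ht)
    (hk.hasDerivWithinAt_shift ht hh)).const_mul Complex.I
  have h2 := Complex.reCLM.hasFDerivAt.comp_hasDerivWithinAt t h1
  refine h2.congr_deriv ?_
  have e : (inner ℂ (gradEn (k t)) (k (t + h)) : ℂ).re = (inner ℂ (k (t + h)) (gradEn (k t)) : ℂ).re := by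
    rw [← inner_conj_symm, Complex.conj_re]
  rw [← e, gradEn, gradEn]
  simp only [inner_smul_left, inner_smul_right, map_neg, Complex.conj_I, neg_neg, Complex.reCLM_apply]
  rw [← Complex.sub_re]
  congr 1
  linear_combination (inner ℂ (opL (k t) + opB (nl (k t))) (k (t + h)) -
    inner ℂ (k t) (opL (k (t + h)) + opB (nl (k (t + h))))) * Complex.I_mul_I

/-- The current vanishes on the diagonal, so these quotients converge to its derivative in the
second time variable. -/
theorem tendsto_current (hk : IsFlow E k) {t : ℝ} (ht : 0 ≤ t) :
    Tendsto (fun n : ℕ => ((n : ℝ) + 1) * current k t (t + 1 / ((n : ℝ) + 1))) atTop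
      (𝓝 (inner ℂ (k t) (gradEn (k t)) : ℂ).re) := by
  have hc : HasDerivWithinAt (fun _ : ℝ => opB (opB (k t))) 0 (Ici 0) t :=
    hasDerivWithinAt_const _ _ _
  have h1 := (hasDerivWithinAt_inner_opB (p := fun _ => k t) hk.continuous.continuousWithinAt hc
    (hk.deriv t ht)).const_mul Complex.I
  have h2 := Complex.reCLM.hasFDerivAt.comp_hasDerivWithinAt t h1
  have h3 := tendsto_natCast_mul_sub (h2.mono (Ici_subset_Ici.mpr ht))
  have e1 : Complex.reCLM (Complex.I * (inner ℂ 0 (k t) +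
      inner ℂ (k t) (-Complex.I • (opL (k t) + opB (nl (k t)))))) =
      (inner ℂ (k t) (gradEn (k t)) : ℂ).re := by
    rw [inner_zero_left, zero_add, inner_smul_right, ← mul_assoc, mul_neg, Complex.I_mul_I, neg_neg,
      one_mul]
    rfl
  have e2 : (Complex.I * inner ℂ (opB (k t)) (opB (k t)) : ℂ).re = 0 := by
    rw [inner_self_eq_norm_sq_to_K, Complex.mul_re, Complex.I_re, Complex.I_im]
    rw [← RCLike.ofReal_pow, RCLike.ofReal_eq_complex_ofReal, Complex.ofReal_im]
    simp
  rw [e1] at h3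
  refine h3.congr fun n => ?_
  simp only [Function.comp_apply, Complex.reCLM_apply, current]
  rw [e2, sub_zero]

/-- Interpolation of `L²` between `H¹` and `H⁻¹`: the curve is Lipschitz in `H⁻¹` and continuous in
`H¹`, so the squared increment in `L²` is `o(h)`. -/
theorem norm_opB_sub_sq_le (hk : IsFlow E k) {t h : ℝ} (ht : 0 ≤ t) (hh : 0 ≤ h) :
    ‖opB (k (t + h) - k t)‖ ^ 2 ≤ ‖k (t + h) - k t‖ * ((‖opL‖ * E + sobC ^ 3 * E ^ 3) * h) := by
  have h1 := (convex_Ici (0 : ℝ)).norm_image_sub_le_of_norm_hasDerivWithin_le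
    (fun s hs => hk.deriv s hs) (C := ‖opL‖ * E + sobC ^ 3 * E ^ 3) (fun s _ => by
      rw [norm_smul, norm_neg, Complex.norm_I, one_mul]
      exact norm_gradEn_le (hk.norm_le s)) (mem_Ici.mpr ht) (mem_Ici.mpr (add_nonneg ht hh))
  rw [add_sub_cancel_left, Real.norm_of_nonneg hh, ← map_sub, ← map_sub] at h1
  have h2 : ‖opB (k (t + h) - k t)‖ ^ 2 =
      ‖(inner ℂ (k (t + h) - k t) (opB (opB (k (t + h) - k t))) : ℂ)‖ := by
    rw [inner_opB, inner_self_eq_norm_sq_to_K, norm_pow, RCLike.norm_ofReal,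
      abs_of_nonneg (norm_nonneg _)]
  rw [h2]
  exact (norm_inner_le_norm _ _).trans (by gcongr)

theorem continuous_enRem (hk : IsFlow E k) (h : ℝ) :
    Continuous fun t => enRem (k t) (k (t + h)) := by
  have h1 := hk.continuous
  have h2 : Continuous fun t => k (t + h) := hk.continuous.comp (continuous_add_const h)
  exact ((continuous_en.comp h2).sub (continuous_en.comp h1)).sub (continuous_const.mul
    (Complex.continuous_re.comp ((h2.sub h1).inner
      ((continuous_gradEn.comp h1).add (continuous_gradEn.comp h2)))))

theorem lintegral_supB_shift_le (B : ℝ) {h : ℝ} (h0 : 0 ≤ h) (h1 : h ≤ 1) :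
    ∫⁻ t in Ioc 0 B, supB (k (t + h)) ^ 2 ≤ ∫⁻ t in Ioc 0 (B + 1), supB (k t) ^ 2 := by
  have e := (measurePreserving_add_right (volume : Measure ℝ) h).setLIntegral_comp_preimage_emb
    (measurableEmbedding_addRight h) (fun t => supB (k t) ^ 2) (Ioc h (B + h))
  rw [preimage_add_const_Ioc, sub_self, add_sub_cancel_right] at e
  rw [e]
  exact lintegral_mono_set (Ioc_subset_Ioc h0 (by linarith))

theorem enorm_integral_enRem_le (hk : IsFlow E k) {B h δ : ℝ} (hB : 0 ≤ B) (h0 : 0 ≤ h) (h1 : h ≤ 1)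
    (hδ : ∀ t ∈ Ioc 0 B, ‖k (t + h) - k t‖ ≤ δ) :
    ‖∫ t in (0 : ℝ)..B, enRem (k t) (k (t + h))‖ₑ ≤
      2 * supC E (B + 1) * ENNReal.ofReal (δ * ((‖opL‖ * E + sobC ^ 3 * E ^ 3) * h)) := by
  have hE := hk.nonneg
  have hs := sobC_pos
  -- The joint bound with the zero free solution; the extra unit of time leaves room for shifts `h ≤
  -- 1`.
  have hS : ∫⁻ t in Ioc 0 (B + 1), supB (k t) ^ 2 ≤ supC E (B + 1) := by
    have h2 := hk.lintegral_sup_sq_le (p := 0) (T := 0) (τ := B + 1) (by simpa using hE) le_rfl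
      (by linarith)
    rw [zero_add] at h2
    refine (lintegral_mono fun t => ?_).trans h2
    gcongr
    calc supB (k t) ≤ supB (k t) + supB (opU t 0) := le_self_add
      _ ≤ 2 * (supB (k t) + supB (opU t 0)) := le_mul_of_one_le_left' (by norm_num)
  rw [intervalIntegral.integral_of_le hB]
  refine (enorm_integral_le_lintegral_enorm _).trans ?_
  calc ∫⁻ t in Ioc 0 B, ‖enRem (k t) (k (t + h))‖ₑ
      ≤ ∫⁻ t in Ioc 0 B, (supB (k t) ^ 2 + supB (k (t + h)) ^ 2) *
          ENNReal.ofReal (δ * ((‖opL‖ * E + sobC ^ 3 * E ^ 3) * h)) := by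
        refine setLIntegral_mono' measurableSet_Ioc fun t ht => ?_
        refine (enorm_enRem_le _ _).trans ?_
        gcongr
        rw [← ofReal_norm, ← ENNReal.ofReal_pow (norm_nonneg _)]
        refine ENNReal.ofReal_le_ofReal ((hk.norm_opB_sub_sq_le ht.1.le h0).trans ?_)
        gcongr
        exact hδ t ht
    _ = ((∫⁻ t in Ioc 0 B, supB (k t) ^ 2) + ∫⁻ t in Ioc 0 B, supB (k (t + h)) ^ 2) *
          ENNReal.ofReal (δ * ((‖opL‖ * E + sobC ^ 3 * E ^ 3) * h)) := by
        rw [lintegral_mul_const' _ _ ENNReal.ofReal_ne_top,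
          lintegral_add_left ((measurable_supB_comp hk.continuous).pow_const 2)]
    _ ≤ _ := by
        gcongr
        rw [two_mul]
        refine add_le_add ((lintegral_mono_set (Ioc_subset_Ioc le_rfl (by linarith))).trans hS)
          ((lintegral_supB_shift_le B h0 h1).trans hS)

/-- Uniform continuity in `H¹` on the compact interval makes `δ` arbitrarily small, while the factor
`h` in the error cancels `n + 1`. -/
theorem tendsto_integral_enRem (hk : IsFlow E k) {B : ℝ} (hB : 0 ≤ B) :
    Tendsto (fun n : ℕ => ((n : ℝ) + 1) *
      ∫ t in (0 : ℝ)..B, enRem (k t) (k (t + 1 / ((n : ℝ) + 1)))) atTop (𝓝 0) := by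
  have hE := hk.nonneg
  have hs := sobC_pos
  set M : ℝ := (2 * supC E (B + 1)).toReal * (‖opL‖ * E + sobC ^ 3 * E ^ 3) with hM
  have hM0 : 0 ≤ M := by positivity
  have hfin : 2 * supC E (B + 1) ≠ ∞ := ENNReal.mul_ne_top (by norm_num) (supC_ne_top _ _)
  rw [Metric.tendsto_nhds]
  intro ε hε
  have hu := (isCompact_Icc (a := (0 : ℝ)) (b := B + 1)).uniformContinuousOn_of_continuous
    hk.continuous.continuousOn
  obtain ⟨r, hr, hkr⟩ := Metric.uniformContinuousOn_iff.mp hu (ε / (2 * (M + 1))) (by positivity)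
  filter_upwards [(tendsto_one_div_add_atTop_nhds_zero_nat (𝕜 := ℝ)).eventually (gt_mem_nhds hr)]
    with n hn
  set h : ℝ := 1 / ((n : ℝ) + 1)
  have h0 : 0 ≤ h := by positivity
  have h1 : h ≤ 1 := by
    rw [div_le_one (by positivity)]
    linarith [(Nat.cast_nonneg n : (0 : ℝ) ≤ n)]
  have hnh : ((n : ℝ) + 1) * h = 1 := mul_one_div_cancel (by positivity)
  have h2 := hk.enorm_integral_enRem_le hB h0 h1 (δ := ε / (2 * (M + 1))) (fun t ht => by
    rw [← dist_eq_norm]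
    refine (hkr _ ⟨by linarith [ht.1], by linarith [ht.2]⟩ _ ⟨ht.1.le, by linarith [ht.2]⟩ ?_).le
    rwa [Real.dist_eq, add_sub_cancel_left, abs_of_nonneg h0])
  rw [← ENNReal.ofReal_toReal hfin, ← ENNReal.ofReal_mul ENNReal.toReal_nonneg, ← ofReal_norm,
    ENNReal.ofReal_le_ofReal_iff (by positivity)] at h2
  rw [dist_zero_right, norm_mul, Real.norm_of_nonneg (by positivity : 0 ≤ (n : ℝ) + 1)]
  calc ((n : ℝ) + 1) * ‖∫ t in (0 : ℝ)..B, enRem (k t) (k (t + h))‖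
      ≤ ((n : ℝ) + 1) * ((2 * supC E (B + 1)).toReal *
        (ε / (2 * (M + 1)) * ((‖opL‖ * E + sobC ^ 3 * E ^ 3) * h))) := by gcongr
    _ = (((n : ℝ) + 1) * h) * (M * (ε / (2 * (M + 1)))) := by rw [hM]; ring
    _ = ε * (M / (2 * (M + 1))) := by rw [hnh]; ring
    _ < ε * 1 := by
        gcongr
        rw [div_lt_one (by positivity)]
        linarith
    _ = ε := mul_one ε

/-- Conservation of the energy. -/
theorem en_eq (hk : IsFlow E k) {B : ℝ} (hB : 0 ≤ B) : en (k B) = en (k 0) := by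
  set q : ℝ → ℝ := fun t => (inner ℂ (k t) (gradEn (k t)) : ℂ).re
  have hg : Continuous fun t => gradEn (k t) := continuous_gradEn.comp hk.continuous
  have hq : Continuous q := Complex.continuous_re.comp (hk.continuous.inner hg)
  have hen : Continuous fun t => en (k t) := continuous_en.comp hk.continuous
  have t1 := tendsto_natCast_mul_integral_sub hen 0 B
  have t2 := tendsto_natCast_mul_integral_sub hq 0 B
  have t3 := (hk.tendsto_current hB).sub (hk.tendsto_current le_rfl)
  -- The symmetric terms average to the increment of `q` between `0` and `B`, and the current
  -- quotients at the endpoints have the same limit; what is left is the error, which tends to zero.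
  have t4 := ((t2.sub t3).const_mul (1 / 2)).add (hk.tendsto_integral_enRem hB)
  rw [sub_self, mul_zero, zero_add] at t4
  have key : en (k B) - en (k 0) = 0 := by
    refine tendsto_nhds_unique t1 (t4.congr fun n => ?_)
    set h : ℝ := 1 / ((n : ℝ) + 1)
    have h0 : 0 ≤ h := by positivity
    have hkh : Continuous fun t => k (t + h) := hk.continuous.comp (continuous_add_const h)
    set ω : ℝ → ℝ := fun t => (inner ℂ (k t) (gradEn (k (t + h))) : ℂ).re -
      (inner ℂ (k (t + h)) (gradEn (k t)) : ℂ).re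
    have hω : Continuous ω := (Complex.continuous_re.comp (hk.continuous.inner
      (continuous_gradEn.comp hkh))).sub (Complex.continuous_re.comp (hkh.inner hg))
    have e1 : ∫ t in (0 : ℝ)..B, ω t = current k B (B + h) - current k 0 (0 + h) := by
      refine intervalIntegral.integral_eq_sub_of_hasDerivAt_of_le
        (f := fun s => current k s (s + h)) hB (fun t ht => ?_) (fun t ht => ?_)
        (hω.intervalIntegrable _ _)
      · exact ((hk.hasDerivWithinAt_current_diag ht.1 h0).continuousWithinAt).mono
          Icc_subset_Ici_self
      · exact (hk.hasDerivWithinAt_current_diag ht.1.le h0).hasDerivAt (Ici_mem_nhds ht.1)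
    have e2 : ∀ t, en (k (t + h)) - en (k t) =
        (1 / 2) * ((q (t + h) - q t) - ω t) + enRem (k t) (k (t + h)) := by
      intro t
      simp only [enRem, q, ω, inner_sub_left, inner_add_right, Complex.sub_re, Complex.add_re]
      ring
    have i1 : Continuous fun t => q (t + h) - q t := (hq.comp (continuous_add_const h)).sub hq
    have i2 : Continuous fun t => (1 / 2) * ((q (t + h) - q t) - ω t) :=
      continuous_const.mul (i1.sub hω)
    simp only [e2]
    rw [intervalIntegral.integral_add (i2.intervalIntegrable _ _)
        ((hk.continuous_enRem h).intervalIntegrable _ _),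
      intervalIntegral.integral_const_mul, intervalIntegral.integral_sub
        (i1.intervalIntegrable _ _) (hω.intervalIntegrable _ _), e1]
    ring
  linarith

end IsFlow

/-! ### Decoupling of the energy -/

theorem opL_opU (t : ℝ) (k : L2) : opL (opU t k) = opU t (opL k) := fmul_comm _ _ _

theorem abs_pow_four_sub_le {x y M d : ℝ} (hx : |x| ≤ M) (hy : |y| ≤ M) (hd : |x - y| ≤ d) :
    |x ^ 4 - y ^ 4| ≤ 4 * M ^ 3 * d := by
  have hM : 0 ≤ M := (abs_nonneg x).trans hx
  have e : x ^ 4 - y ^ 4 = (x - y) * ((x + y) * (x ^ 2 + y ^ 2)) := by ring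
  have h1 : |x + y| ≤ 2 * M := (abs_add_le _ _).trans (by linarith)
  have h2 : |x ^ 2 + y ^ 2| ≤ 2 * M ^ 2 := by
    rw [abs_of_nonneg (by positivity), ← sq_abs x, ← sq_abs y, two_mul]
    gcongr
  rw [e, abs_mul, abs_mul]
  calc |x - y| * (|x + y| * |x ^ 2 + y ^ 2|) ≤ d * (2 * M * (2 * M ^ 2)) := by
        have := (abs_nonneg _).trans hd
        gcongr
    _ = 4 * M ^ 3 * d := by ring

theorem en_sub (a v : L2) : en (a - v) = en a - (1 / 4) * (n4 (a - v) ^ 4 - n4 a ^ 4) -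
    (inner ℂ (opL v) a : ℂ).re + (1 / 2) * (inner ℂ v (opL v) : ℂ).re := by
  have h : (inner ℂ a (opL v) : ℂ).re = (inner ℂ (opL v) a : ℂ).re := by
    rw [← inner_conj_symm, Complex.conj_re]
  rw [en, en, map_sub]
  simp only [inner_sub_left, inner_sub_right, Complex.sub_re, inner_opL v a, h]
  ring

/-- The quartic part does not notice the free solution, whose `L⁴` norm tends to zero. In the
quadratic part the cross term converges weakly to the gradient term of `p`, of which half is
returned by the free solution. -/
theorem IsFlow.tendsto_en_sub {E : ℝ} {k : ℝ → L2} {p : L2} (hk : IsFlow E k)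
    (hp : IsAsymptoticState k p) :
    Tendsto (fun t => en (k t - opU t p)) atTop
      (𝓝 (en (k 0) - (1 / 2) * (inner ℂ p (opL p) : ℂ).re)) := by
  have h1 : Tendsto (fun t => n4 (k t - opU t p) ^ 4 - n4 (k t) ^ 4) atTop (𝓝 0) := by
    have hb : Tendsto (fun t => 4 * (sobC4 * E + sobC4 * ‖p‖) ^ 3 * n4 (opU t p)) atTop (𝓝 0) := by
      simpa using (tendsto_n4_opU p).const_mul (4 * (sobC4 * E + sobC4 * ‖p‖) ^ 3)
    refine squeeze_zero_norm (fun t => ?_) hb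
    have a1 := hk.n4_le_bound t
    have a2 := n4_opU_le_bound (le_refl ‖p‖) t
    have a3 := n4_sub_le (k t) (opU t p)
    have a4 := n4_add_le (k t - opU t p) (opU t p)
    rw [sub_add_cancel] at a4
    have a5 := n4_nonneg (k t)
    have a6 := n4_nonneg (opU t p)
    refine abs_pow_four_sub_le ?_ ?_ ?_
    · rw [abs_of_nonneg (n4_nonneg _)]
      linarith
    · rw [abs_of_nonneg a5]
      linarith
    · rw [abs_le]
      constructor <;> linarith
  have h2 := (Complex.continuous_re.tendsto _).comp (hp.tendsto_inner (opL p))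
  have h3 := ((h1.const_mul (1 / 4)).const_sub (en (k 0))).sub h2
  have h4 := h3.add_const ((1 / 2) * (inner ℂ p (opL p) : ℂ).re)
  rw [← inner_opL] at h4
  rw [show en (k 0) - (1 / 2) * (inner ℂ p (opL p) : ℂ).re = en (k 0) - 1 / 4 * 0 -
    (inner ℂ p (opL p) : ℂ).re + (1 / 2) * (inner ℂ p (opL p) : ℂ).re by ring]
  refine h4.congr' ?_
  filter_upwards [eventually_ge_atTop 0] with t ht
  rw [en_sub, hk.en_eq ht, opL_opU, inner_opU_opU]
  rfl

theorem IsSolution.energy_decoupling {u : ℝ → Distr} {E : ℝ} {p : L2} (hu : IsSolution u)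
    (hE : ∀ t, 0 ≤ t → normH 1 (u t) ≤ E) (hp : IsAsymptoticState (flowOf u) p) :
    ∃ e : ℝ, Tendsto (fun T => energy (remainder u p T)) atTop (𝓝 e) ∧
      (1 / 2) * (∫ x, gradSq (opB p : Distr) x) + e = energy (u 0) := by
  refine ⟨_, ((hu.isFlow hE).tendsto_en_sub hp).congr' ?_, ?_⟩
  · filter_upwards [eventually_ge_atTop 0] with t ht
    rw [energy_eq (hu.memH_remainder p ht), hu.J_remainder p ht]
  · rw [integral_gradSq (memH_opB p), J_opB, energy_eq (hu.memH 0 le_rfl), flowOf_of_nonneg u le_rfl]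
    ring

end CubicNLS

end

theorem theorem1p2 (E : ℝ) (hE : 0 < E) :
    ∃ C : ℝ, 0 < C ∧ ∀ u : ℝ → CubicNLS.Distr, CubicNLS.IsSolution u →
      (∀ t, 0 ≤ t → CubicNLS.normH 1 (u t) ≤ E) →
      -- the two forms of asymptotic orthogonality are equivalent
      (∀ w : ℝ → CubicNLS.Distr, (∀ t, 0 ≤ t → CubicNLS.MemH 1 (w t)) →
        (CubicNLS.AsymptOrthL2 w ↔ CubicNLS.AsymptOrthH1 w)) ∧
      ∃ (uwb : ℝ → CubicNLS.Distr) (uplus : CubicNLS.Distr),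
        -- the decomposition, the bounds and the asymptotic orthogonality
        CubicNLS.IsDecomposition u uwb uplus ∧
        CubicNLS.normH 1 uplus ≤ C ∧
        (∀ t, 0 ≤ t → CubicNLS.normH 1 (uwb t) ≤ C) ∧
        CubicNLS.AsymptOrthL2 uwb ∧
        CubicNLS.AsymptOrthH1 uwb ∧
        -- uniqueness
        (∀ (w : ℝ → CubicNLS.Distr) (p : CubicNLS.Distr), CubicNLS.IsDecomposition u w p →
          CubicNLS.AsymptOrthL2 w → p = uplus ∧ ∀ t, 0 ≤ t → w t = uwb t) ∧
        -- approximate solution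
        CubicNLS.IsApproxSolution uwb ∧
        -- mass decoupling
        (∃ m : ℝ, Tendsto (fun T => CubicNLS.mass (uwb T)) atTop (𝓝 m) ∧
          CubicNLS.mass uplus + m = CubicNLS.mass (u 0)) ∧
        -- energy decoupling
        (∃ e : ℝ, Tendsto (fun T => CubicNLS.energy (uwb T)) atTop (𝓝 e) ∧
          (1 / 2) * (∫ x, CubicNLS.gradSq uplus x) + e = CubicNLS.energy (u 0)) ∧
        -- spherical symmetry
        ((∀ t, 0 ≤ t → CubicNLS.IsRadial (u t)) →
          (∀ t, 0 ≤ t → CubicNLS.IsRadial (uwb t)) ∧ CubicNLS.IsRadial uplus) := by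
  -- The bound `E` passes to the weak limit, and the triangle inequality with the isometric free
  -- flow bounds the remainder by `2E`.
  refine ⟨2 * E, by linarith, fun u hu hb => ⟨fun w hw => CubicNLS.asymptOrth_equiv hw, ?_⟩⟩
  have hk := hu.isFlow hb
  obtain ⟨p, hpE, hp⟩ := hk.exists_weak_limit
  have hs : CubicNLS.IsAsymptoticState (CubicNLS.flowOf u) p := hp
  have ho := CubicNLS.IsSolution.asymptOrthL2 hu hs
  refine ⟨CubicNLS.remainder u p, (CubicNLS.opB p : CubicNLS.Distr), hu.isDecomposition p, ?_,
    fun t ht => ?_, ho, (CubicNLS.asymptOrth_equiv fun t ht => hu.memH_remainder p ht).mp ho,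
    fun w q hd hw => hs.decomposition_unique hd hw, hu.isApproxSolution_remainder hb hpE,
    hu.mass_decoupling hb hs, hu.energy_decoupling hb hs, hu.isRadial hs⟩
  · rw [CubicNLS.normH, CubicNLS.J_opB]
    linarith
  · rw [CubicNLS.normH, hu.J_remainder p ht]
    refine (norm_sub_le _ _).trans ?_
    rw [CubicNLS.norm_opU]
    linarith [hk.norm_le t]
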